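/- **Setting.** Let $X$ be a second countable topological space. A *conical complex* $\Pi$ on $X$ is a finite covering of $X$ by closed subsets $\sigma$ (cones), together with, for each cone, a finite dimensional real vector space $M^\sigma$ of continuous functions on $\sigma$ (linear functions), with dual $N^\sigma$, such that: (i) evaluation $\sigma\to N^\sigma$ is a homeomorphism onto a strictly convex full-dimensional polyhedral cone; (ii) each face $\tau$ of $\sigma$ (write $\tau\prec\sigma$) is a cone of $\Pi$ and $M^\tau$ consists of the restrictions of $M^\sigma$; (iii) the intersection of two cones is a union of common faces. Put $\dim\sigma=\dim M^\sigma$, and let $\Pi(k)$ be the set of $k$-dimensional cones. $\Pi'$ is a *subdivision* of $\Pi$ if each cone of $\Pi'$ is contained in a cone of $\Pi$, the inclusion being linear; two complexes are equivalent if they have a common subdivision. A *Euclidean conical space* is such an $X$ with an equivalence class of conical complexes and a map $\iota:X\to N$ to a finite dimensional Euclidean space which is linear and injective on each cone of some complex of the class; $R(X)$ denotes the set of complexes $\Pi$ of the class having this property. Through $\iota$ identify $N^\sigma$ with $\operatorname{Span}\iota(\sigma)$. Assume $X$ has pure dimension $n$ (all maximal cones have dimension $n$). For $\tau\prec\sigma$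 with $\dim\sigma=\dim\tau+1$ let $\hat v_{\sigma/\tau}$ be the unit vector of $N^\sigma$ orthogonal to $N^\tau$ that points in the direction of $\sigma$; for a ray $\tau$ let $\hat v_\tau$ be the point $x\in\tau$ with $\|\iota(x)\|=1$. A *$k$-dimensional Minkowski weight* on $\Pi\in R(X)$ is a function $c:\Pi\to\mathbb R$ that vanishes outside $\Pi(k)$ and satisfies $\sum_{\sigma\in\Pi(k),\,\sigma\succ\tau}c(\sigma)\hat v_{\sigma/\tau}=0$ for all $\tau\in\Pi(k-1)$. Its pull-back to a subdivision $\Pi'$ takes at $\sigma'$ the value $c(\sigma)$ if the minimal cone $\sigma\in\Pi$ containing $\sigma'$ has dimension $\dim\sigma'$, and the value $0$ otherwise; a *tropical cycle* is a class of Minkowski weights modulo pull-back. $X$ is *balanced* by a cycle $[X]$ that is represented on some complex in $R(X)$ by an $n$-dimensional Minkowski weight with positive values on all $n$-dimensional cones. $\mathrm{PL}(X)$ is the space of functions $\phi:X\to\mathbb R$ that are linear on the cones of some $\Pi\in R(X)$; then on each $\sigma\in\Pi$ one has $\phi|_\sigma=\phi_\sigma\circ\iota$ with $\phi_\sigma$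 a linear functional. For a $k$-dimensional Minkowski weight $c$ on the same $\Pi$, the $(k-1)$-dimensional weight $\phi\cdot c$ is $\tau\mapsto\sum_{\sigma\in\Pi(k),\,\sigma\succ\tau}-\phi_\sigma(\hat v_{\sigma/\tau})\,c(\sigma)$; this induces a product $\phi\cdot z$ with tropical cycles $z$. A cycle is *positive* if it is represented by a weight with nonnegative values. Let $\mathbb S^X=\{x\in X:\|\iota(x)\|=1\}$, which is compact. A Radon measure on $\mathbb S^X$ is a continuous linear form on $C^0(\mathbb S^X)$; the space of these carries the weak-$*$ topology. For a $1$-dimensional cycle $z$ represented by $c$ on $\Pi$ put $\mu_z=\sum_{\tau\in\Pi(1)}c(\tau)\,\delta_{\hat v_\tau}$. $\mathrm{Conic}(X)$ is the space of functions $\phi:X\to\mathbb R$ with $\phi(\lambda x)=\lambda\phi(x)$ for all $x\in X$, $\lambda\ge0$, with the topology of pointwise convergence. An *admissible family* is a set $\mathcal C\subseteq\mathrm{PL}(X)$, closed under addition and under multiplication by positive reals, such that $\phi_1\cdots\phi_r\cdot[X]$ is positive for all $r\le n$ and $\phi_1,\dots,\phi_r\in\mathcal C$, and such that the restrictions to $\mathbb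 S^X$ of the elements of $\mathcal C-\mathcal C$ are dense in $C^0(\mathbb S^X)$ for uniform convergence. $\mathrm{Conic}(X)_{\mathcal C}$, the space of *$\mathcal C$-concave functions*, is the closure of $\mathcal C$ in $\mathrm{Conic}(X)$, and $\mathrm{PL}(X)_{\mathcal C}=\mathrm{PL}(X)\cap\mathrm{Conic}(X)_{\mathcal C}\supseteq\mathcal C$. **Theorem.** Let $X$ be a Euclidean conical space of pure dimension $n$ balanced by $[X]$, let $\mathcal C$ be an admissible family on $X$, $k\in\{0,\dots,n-1\}$ and $\gamma_1,\dots,\gamma_{n-1-k}\in\mathcal C-\mathcal C$. 1. Let $\psi\in\mathrm{Conic}(X)_{\mathcal C}$, and let $(\phi_i)_{i\in\mathbb N}$ and $(\phi'_j)_{j\in\mathbb N}$ be sequences in $\mathrm{PL}(X)_{\mathcal C}$ that both converge to $\psi$. If $\mu_{\gamma_1\cdots\gamma_{n-1-k}\cdot\phi_i^k\cdot[X]}\to\mu$ and $\mu_{\gamma_1\cdots\gamma_{n-1-k}\cdot\phi_j'^k\cdot[X]}\to\nu$ in the weak-$*$ topology for some Radon measures $\mu,\nu$, then $\mu=\nu$.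 2. The map $\phi\mapsto\mu_{\gamma_1\cdots\gamma_{n-1-k}\cdot\phi^k\cdot[X]}$ from $\mathrm{PL}(X)_{\mathcal C}$ to Radon measures on $\mathbb S^X$ extends, in a unique way, to a continuous map from $\mathrm{Conic}(X)_{\mathcal C}$ (with pointwise convergence) to Radon measures on $\mathbb S^X$ (with the weak-$*$ topology). -/

import Mathlib

open Filter Topology
open scoped Pointwise

noncomputable section

/-- `F` is a face of the cone `σ`, where `M` is the space of linear functions on `σ`: it is the
zero locus of a linear function that is nonnegative on `σ`. -/
def IsFaceOf {X : Type*} (σ : Set X) (M : Submodule ℝ (σ → ℝ)) (F : Set X) : Prop :=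
  ∃ u ∈ M, (∀ x, 0 ≤ u x) ∧ F = Subtype.val '' {x : σ | u x = 0}

/-- The evaluation map `σ → Hom(M, ℝ)`, `x ↦ (u ↦ u x)`. -/
def coneEval {X : Type*} (σ : Set X) (M : Submodule ℝ (σ → ℝ)) (x : σ) : Module.Dual ℝ M :=
  (LinearMap.proj x : (σ → ℝ) →ₗ[ℝ] ℝ).comp M.subtype

/-- A conical polyhedral structure (conical complex) on a topological space `X`: a finite set of
closed subsets covering `X`, the cones, and for each cone `σ` a finite dimensional space `lin σ`
of continuous real functions on `σ`, the linear functions (`lin σ` is irrelevant when `σ` is not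
one of the cones). -/
structure ConicalComplex (X : Type*) [TopologicalSpace X] where
  cones : Finset (Set X)
  lin : (σ : Set X) → Submodule ℝ (σ → ℝ)
  isClosed : ∀ σ ∈ cones, IsClosed σ
  cover : ⋃₀ (cones : Set (Set X)) = Set.univ
  finiteDimensional : ∀ σ ∈ cones, FiniteDimensional ℝ (lin σ)
  continuous_lin : ∀ σ ∈ cones, ∀ u ∈ lin σ, Continuous u
  /-- The evaluation map is a homeomorphism onto its image. The vector space topology of the
  finite dimensional space `Hom(lin σ, ℝ)` is that of pointwise convergence on `lin σ`. -/
  isEmbedding : ∀ σ ∈ cones, IsEmbedding fun (x : σ) (u : lin σ) => coneEval σ (lin σ) x u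
  /-- The image of the evaluation map is a strictly convex, full-dimensional polyhedral cone. -/
  polyhedral : ∀ σ ∈ cones, ∃ P : PointedCone ℝ (Module.Dual ℝ (lin σ)),
    Set.range (coneEval σ (lin σ)) = (P : Set (Module.Dual ℝ (lin σ))) ∧
    Submodule.FG P ∧ (∀ v ∈ P, -v ∈ P → v = 0) ∧
    Submodule.span ℝ (P : Set (Module.Dual ℝ (lin σ))) = ⊤
  face_mem : ∀ σ ∈ cones, ∀ F, IsFaceOf σ (lin σ) F → F ∈ cones
  face_lin : ∀ σ ∈ cones, ∀ F, IsFaceOf σ (lin σ) F → ∀ h : F ⊆ σ,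
    lin F = (lin σ).map (LinearMap.funLeft ℝ ℝ (Set.inclusion h))
  /-- The intersection of two cones is a union of common faces. -/
  inter : ∀ σ ∈ cones, ∀ σ' ∈ cones, ∃ 𝓕 : Set (Set X),
    (∀ F ∈ 𝓕, IsFaceOf σ (lin σ) F ∧ IsFaceOf σ' (lin σ') F) ∧ σ ∩ σ' = ⋃₀ 𝓕

namespace ConicalComplex

variable {X : Type*} [TopologicalSpace X]

/-- The relation `τ ≺ σ` between cones of a complex. -/
def IsFace (P : ConicalComplex X) (τ σ : Set X) : Prop := IsFaceOf σ (P.lin σ) τ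

/-- The dimension of a cone. -/
def dim (P : ConicalComplex X) (σ : Set X) : ℕ := Module.finrank ℝ (P.lin σ)

/-- `P'` is a subdivision of `P`: every cone of `P'` is contained in a cone of `P`, the inclusion
being linear. -/
def IsSubdivision (P' P : ConicalComplex X) : Prop :=
  ∀ σ' ∈ P'.cones, ∃ σ ∈ P.cones, ∃ h : σ' ⊆ σ,
    ∀ u ∈ P.lin σ, u ∘ Set.inclusion h ∈ P'.lin σ'

/-- Two complexes are equivalent if they admit a common subdivision. -/
def Equivalent (P P' : ConicalComplex X) : Prop :=
  ∃ P'' : ConicalComplex X, P''.IsSubdivision P ∧ P''.IsSubdivision P'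

/-- `X` has pure dimension `n`: every maximal cone has dimension `n`. -/
def IsPure (P : ConicalComplex X) (n : ℕ) : Prop :=
  ∀ σ, Maximal (· ∈ P.cones) σ → P.dim σ = n

/-- A real function on `X` is linear on each cone of the complex: it lies in `PL(Π)`. -/
def IsPL (P : ConicalComplex X) (φ : X → ℝ) : Prop :=
  ∀ σ ∈ P.cones, (fun x : σ => φ x) ∈ P.lin σ

/-- A map to a real vector space is linear on each cone, i.e. its composition with any linear
functional is linear on each cone. -/
def IsLinearMap (P : ConicalComplex X) {N : Type*} [AddCommGroup N] [Module ℝ N]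
    (f : X → N) : Prop :=
  ∀ ℓ : Module.Dual ℝ N, P.IsPL fun x => ℓ (f x)

/-- A weight on a complex is a real function on its set of cones. -/
abbrev Weight (P : ConicalComplex X) : Type _ := {σ // σ ∈ P.cones} → ℝ

/-- `σ` is the minimal cone of the complex that contains the set `s`. -/
def IsMinimalCone (P : ConicalComplex X) (s σ : Set X) : Prop :=
  σ ∈ P.cones ∧ s ⊆ σ ∧ ∀ ρ ∈ P.cones, s ⊆ ρ → σ ⊆ ρ

open Classical in
/-- The pull-back of a weight `c` on `P` to a subdivision `P'`: its value at `σ'` is `c σ` if the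
minimal cone `σ` of `P` containing `σ'` has the same dimension as `σ'`, and `0` otherwise.
(The sum has at most one term.) -/
def pullback (P P' : ConicalComplex X) (c : P.Weight) : P'.Weight := fun σ' =>
  ∑ σ with P.IsMinimalCone σ'.1 σ.1 ∧ P.dim σ.1 = P'.dim σ'.1, c σ

end ConicalComplex

/-- A Euclidean conical space: a topological space with an equivalence class of conical complexes,
given by a representative `complex`, and a quasi-embedding `ι` into a Euclidean space `N`, that is,
a map that is linear and injective on each cone of the complex. -/
structure EuclideanConicalSpace (X N : Type*) [TopologicalSpace X]
    [NormedAddCommGroup N] [InnerProductSpace ℝ N] where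
  complex : ConicalComplex X
  ι : X → N
  isLinear : complex.IsLinearMap ι
  injOn : ∀ σ ∈ complex.cones, Set.InjOn ι σ

namespace EuclideanConicalSpace

variable {X N : Type*} [TopologicalSpace X] [NormedAddCommGroup N] [InnerProductSpace ℝ N]

/-- The set `R(X)` of conical complexes on the quasi-embedded space: the complexes in the
equivalence class on whose cones the quasi-embedding is linear and injective. -/
def complexes (S : EuclideanConicalSpace X N) : Set (ConicalComplex X) :=
  {P | P.Equivalent S.complex ∧ P.IsLinearMap S.ι ∧ ∀ σ ∈ P.cones, Set.InjOn S.ι σ}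

/-- The linear span of the image of a cone, identified with the vector space of the cone. -/
def spanOf (S : EuclideanConicalSpace X N) (σ : Set X) : Submodule ℝ N :=
  Submodule.span ℝ (S.ι '' σ)

/-- `v` is a unit vector in the span of `σ`, orthogonal to `τ`, pointing in the direction
of `σ`. -/
def IsNormalVector (S : EuclideanConicalSpace X N) (σ τ : Set X) (v : N) : Prop :=
  v ∈ S.spanOf σ ∧ ‖v‖ = 1 ∧ (∀ w ∈ S.spanOf τ, inner ℝ v w = 0) ∧
    ∀ x ∈ σ, 0 ≤ inner ℝ v (S.ι x)

/-- The Euclidean normal vector of `σ` relative to a face `τ` of codimension one, which is the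
unique vector with the property `IsNormalVector`. -/
def normalVector (S : EuclideanConicalSpace X N) (σ τ : Set X) : N :=
  Classical.epsilon fun v => S.IsNormalVector σ τ v

open Classical in
/-- The Euclidean balancing condition: `c` is a `k`-dimensional Euclidean Minkowski weight. -/
def IsMinkowskiWeight (S : EuclideanConicalSpace X N) (P : ConicalComplex X) (k : ℕ)
    (c : P.Weight) : Prop :=
  (∀ σ, P.dim σ.1 ≠ k → c σ = 0) ∧
  ∀ τ ∈ P.cones, P.dim τ + 1 = k →
    ∑ σ with P.dim σ.1 = k ∧ P.IsFace τ σ.1, c σ • S.normalVector σ.1 τ = 0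

/-- A linear functional on `N` whose composition with the quasi-embedding is `φ` on the cone `σ`
(it exists if `φ` is linear on `σ`, and it is then unique on the span of `σ`). -/
def linearExtension (S : EuclideanConicalSpace X N) (φ : X → ℝ) (σ : Set X) : Module.Dual ℝ N :=
  Classical.epsilon fun ℓ => ∀ x ∈ σ, φ x = ℓ (S.ι x)

open Classical in
/-- The Euclidean tropical intersection product of a function `φ`, linear on the cones of `P`, and
a weight `c` on `P`:
`(φ · c)(τ) = ∑ -φ_σ(v_{σ/τ}) c(σ)`, over the `σ ≻ τ` with `dim σ = dim τ + 1`. It sends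
`k`-dimensional weights to `(k - 1)`-dimensional weights. -/
def intersect (S : EuclideanConicalSpace X N) (P : ConicalComplex X) (φ : X → ℝ)
    (c : P.Weight) : P.Weight := fun τ =>
  ∑ σ with P.dim σ.1 = P.dim τ.1 + 1 ∧ P.IsFace τ.1 σ.1,
    -(S.linearExtension φ σ.1 (S.normalVector σ.1 τ.1)) * c σ

/-- The space `PL(X)` of piecewise linear functions. -/
def PL (S : EuclideanConicalSpace X N) : Set (X → ℝ) :=
  {φ | ∃ P ∈ S.complexes, P.IsPL φ}

/-- The space `Conic(X)` of conical functions: `φ (λ x) = λ φ x` for `λ ≥ 0`, where `y = λ x` means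
that `x, y` lie in a common cone and `ι y = λ ι x`. It has the topology of pointwise convergence,
as a subspace of `X → ℝ`. -/
def Conic (S : EuclideanConicalSpace X N) : Set (X → ℝ) :=
  {φ | ∀ σ ∈ S.complex.cones, ∀ x ∈ σ, ∀ y ∈ σ, ∀ t : ℝ, 0 ≤ t →
    S.ι y = t • S.ι x → φ y = t * φ x}

/-- The unit sphere of `X`. -/
def sphere (S : EuclideanConicalSpace X N) : Set X := {x | ‖S.ι x‖ = 1}

/-- The finite (signed) Radon measures on the unit sphere, that is, the continuous linear forms on
the space of continuous functions, with the weak-* topology. -/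
abbrev RadonMeasure (S : EuclideanConicalSpace X N) : Type _ := WeakDual ℝ C(S.sphere, ℝ)

open Classical in
/-- The Dirac measure at the unit vector of a ray `τ`, that is, at the unique point of the unit
sphere that lies in `τ`. -/
def diracRay (S : EuclideanConicalSpace X N) (τ : Set X) : S.RadonMeasure :=
  if h : ∃ x : S.sphere, x.1 ∈ τ then
    StrongDual.toWeakDual (ContinuousMap.evalCLM ℝ h.choose)
  else 0

open Classical in
/-- The discrete measure `∑ c(τ) δ_{v_τ}`, over the rays `τ`, of a weight `c` of dimension one. -/
def discreteMeasure (S : EuclideanConicalSpace X N) (P : ConicalComplex X) (c : P.Weight) :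
    S.RadonMeasure :=
  ∑ τ with P.dim τ.1 = 1, c τ • S.diracRay τ.1

end EuclideanConicalSpace

/-- A balanced Euclidean conical space of pure dimension `n`: it is provided with a tropical cycle
`[X]` of dimension `n`, represented by a Minkowski weight that is positive on the cones of
dimension `n`. The complex by which the space is given is one on which this weight lives. -/
structure BalancedSpace (X N : Type*) [TopologicalSpace X]
    [NormedAddCommGroup N] [InnerProductSpace ℝ N] (n : ℕ) extends EuclideanConicalSpace X N where
  pure : complex.IsPure n
  weight : complex.Weight
  isMinkowski : toEuclideanConicalSpace.IsMinkowskiWeight complex n weight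
  weight_pos : ∀ σ, complex.dim σ.1 = n → 0 < weight σ

namespace BalancedSpace

variable {X N : Type*} [TopologicalSpace X] [NormedAddCommGroup N] [InnerProductSpace ℝ N]
  {n : ℕ}

/-- A complex on which the cycle `φ₁ ⋯ φᵣ · [X]`, `L = [φ₁, …, φᵣ]`, can be computed: it
subdivides the one on which `[X]` is given, and every `φᵢ` is linear on its cones. -/
def IsDefinedOn (S : BalancedSpace X N n) (L : List (X → ℝ)) (P : ConicalComplex X) : Prop :=
  P ∈ S.complexes ∧ P.IsSubdivision S.complex ∧ ∀ φ ∈ L, P.IsPL φ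

/-- The weight on `P` that represents the tropical cycle `φ₁ ⋯ φᵣ · [X]`, `L = [φ₁, …, φᵣ]`. -/
def productWeight (S : BalancedSpace X N n) (P : ConicalComplex X) (L : List (X → ℝ)) :
    P.Weight :=
  L.foldr (S.intersect P) (S.complex.pullback P S.weight)

/-- The tropical cycle `φ₁ ⋯ φᵣ · [X]` is positive: it is represented by a positive weight. -/
def IsPositiveProduct (S : BalancedSpace X N n) (L : List (X → ℝ)) : Prop :=
  ∃ P, S.IsDefinedOn L P ∧ ∀ σ, 0 ≤ S.productWeight P L σ

open Classical in
/-- The discrete measure of the one-dimensional cycle `φ₁ ⋯ φₙ₋₁ · [X]`, `L = [φ₁, …, φₙ₋₁]`,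
computed on any complex on which it is defined (such a complex exists if the `φᵢ` are piecewise
linear, and the measure does not depend on it). -/
def cycleMeasure (S : BalancedSpace X N n) (L : List (X → ℝ)) : S.RadonMeasure :=
  if h : ∃ P, S.IsDefinedOn L P then S.discreteMeasure h.choose (S.productWeight h.choose L)
  else 0

/-- The measure of the cycle `γ₁ ⋯ γ_m · φ ^ k · [X]`. -/
def mixedMeasure (S : BalancedSpace X N n) {m : ℕ} (γ : Fin m → X → ℝ) (k : ℕ) (φ : X → ℝ) :
    S.RadonMeasure :=
  S.cycleMeasure (List.ofFn γ ++ List.replicate k φ)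

/-- An admissible family of concave functions. -/
structure IsAdmissible (S : BalancedSpace X N n) (C : Set (X → ℝ)) : Prop where
  subset_PL : C ⊆ S.PL
  positive : ∀ L : List (X → ℝ), L.length ≤ n → (∀ φ ∈ L, φ ∈ C) → S.IsPositiveProduct L
  add_mem : ∀ φ ∈ C, ∀ ψ ∈ C, φ + ψ ∈ C
  smul_mem : ∀ t : ℝ, 0 < t → ∀ φ ∈ C, t • φ ∈ C
  /-- `C - C` is dense in the space of continuous functions on the unit sphere, with the topology
  of uniform convergence. -/
  dense : Dense {f : C(S.sphere, ℝ) | ∃ φ ∈ C - C, ∀ x : S.sphere, f x = φ x}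

/-- The space `Conic(X)_C` of `C`-concave functions: the closure of `C` in `Conic(X)` for pointwise
convergence. -/
def conicC (S : BalancedSpace X N n) (C : Set (X → ℝ)) : Set (X → ℝ) :=
  S.Conic ∩ closure C

/-- The space `PL(X)_C` of piecewise linear `C`-concave functions. It contains `C`. -/
def plC (S : BalancedSpace X N n) (C : Set (X → ℝ)) : Set (X → ℝ) :=
  S.PL ∩ S.conicC C

end BalancedSpace

end

/-! For n = 1 the measure does not involve φ. For n ≥ 2 the map is extended by continuity from the
piecewise linear functions, which are dense; the first assertion follows, both limits being the
value of the extension at ψ. Two facts are needed: pointwise convergence of C-concave functions is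
uniform on the unit sphere, and the measures are locally bounded and, against test functions in C -
C, locally Lipschitz in φ for the uniform norm on the sphere.

Algebra. The product of a weight with two functions is a sum over flags of cones. Between a cone and
a face of codimension two there are exactly two facets, whose normal vectors satisfy a symmetric
relation, so the products commute (`intersect_comm`). They also commute with pull-back
(`intersect_pullback`), because the two sides of a new wall inside a cone have opposite normal
vectors and cancel. So the measure of a product is well defined and symmetric in the factors. The
integral of a piecewise linear g against the measure of a cycle is minus a degree; hence f and g can
be exchanged in the integral of g against the measure of f · z. This is the integration by parts
`cycleMeasure_swap`.

Equicontinuity. Here only φ · [X] ≥ 0 for φ in C is used. A function min(ℓ, 0) acts positively on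
every nonnegative balanced weight, so multiplying by such functions slices [X] down to a
two-dimensional weight d that still satisfies φ · d ≥ 0 (`IsTest.exists_slice`). At a ray inside a
two-dimensional cone this inequality says that the slopes of φ decrease across the ray; hence φ is
concave on the maximal cones (`IsTest.add_le`). At an arbitrary ray it bounds the slope of φ into
one cone by the slopes into the others, and concavity bounds those by finitely many values of φ;
this excludes jumps at the boundary of a cone (`IsTest.exists_upper_bound`). The result is a modulus
of continuity at each point off the apexes, controlled by a pointwise continuous quantity
(`IsTest.exists_modulus`). It passes to the closure of C and makes evaluation jointly continuous
(`continuous_eval`).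

Estimates. Exchanging a factor with a test function in C - C makes the integral a finite combination
of values of that factor. This extends positivity from C to its piecewise linear closure
(`cycleMeasure_nonneg_of_plC`), bounds the mass by induction on the number of variable factors
(`exists_mass_bound`), and gives the Lipschitz estimate by replacing one factor at a time
(`exists_lipschitz_replicate`). Weak-* compactness and density of C - C finish the proof. -/

noncomputable section

/-! ### Duality for finitely generated cones -/

section PolyhedralCones

variable {V : Type*} [AddCommGroup V] [Module ℝ V]

/-- Fourier–Motzkin elimination of one nonnegative variable. -/
lemma exists_nonneg_forall_sub_mul_nonneg {J : Type*} (I : Finset J) (α β : J → ℝ)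
    (h0 : ∀ i ∈ I, 0 ≤ β i → 0 ≤ α i)
    (h : ∀ i ∈ I, ∀ j ∈ I, 0 < β i → β j < 0 → 0 ≤ β i * α j - β j * α i) :
    ∃ t : ℝ, 0 ≤ t ∧ ∀ i ∈ I, 0 ≤ α i - t * β i := by
  classical
  rcases (I.filter fun j => β j < 0 ∧ α j < 0).eq_empty_or_nonempty with he | hne
  · refine ⟨0, le_rfl, fun i hi => ?_⟩
    by_contra hcon
    have hα : α i < 0 := by linarith
    have hβ : β i < 0 := by
      by_contra hb
      linarith [h0 i hi (not_lt.mp hb)]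
    have : i ∈ I.filter fun j => β j < 0 ∧ α j < 0 := by simp [hi, hα, hβ]
    simp [he] at this
  -- Indices with β negative bound t from below by α / β, those with β positive bound it from above.
  -- By `h` every lower bound is below every upper bound, so the largest lower bound works.
  · obtain ⟨j, hj, hmax⟩ := Finset.exists_max_image _ (fun j => α j / β j) hne
    simp only [Finset.mem_filter] at hj hmax
    obtain ⟨hjI, hβj, hαj⟩ := hj
    have ht : 0 ≤ α j / β j := (div_pos_of_neg_of_neg hαj hβj).le
    refine ⟨α j / β j, ht, fun i hi => ?_⟩
    rcases lt_trichotomy (β i) 0 with hb | hb | hb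
    · rcases lt_or_ge (α i) 0 with ha | ha
      · have := hmax i ⟨hi, hb, ha⟩
        rw [div_le_iff_of_neg hb] at this
        linarith
      · nlinarith [mul_nonneg ht (neg_pos.mpr hb).le]
    · have := h0 i hi hb.ge
      rw [hb]; simpa
    · have := h i hi j hjI hb hβj
      have h1 : α j / β j * β i = (β i * α j) / β j := by ring
      have h2 : (β i * α j) / β j ≤ α i := by
        rw [div_le_iff_of_neg hβj]; linarith
      linarith

lemma nonneg_of_mem_hull {s : Set V} {v : V} (hv : v ∈ PointedCone.hull ℝ s)
    (ℓ : Module.Dual ℝ V) (h : ∀ g ∈ s, 0 ≤ ℓ g) : 0 ≤ ℓ v := by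
  induction hv using Submodule.span_induction with
  | mem x hx => exact h x hx
  | zero => simp
  | add x y _ _ hx hy => rw [map_add]; exact add_nonneg hx hy
  | smul a x _ hx =>
    have : ℓ (a • x) = (a : ℝ) * ℓ x := by
      rw [← smul_eq_mul, ← map_smul]; rfl
    rw [this]; exact mul_nonneg a.2 hx

variable [FiniteDimensional ℝ V]

/-- Weyl's theorem: a finitely generated cone is cut out by finitely many inequalities. -/
theorem PointedCone.exists_finset_dual_of_hull_finset (G : Finset V) :
    ∃ Λ : Finset (Module.Dual ℝ V), ∀ v, v ∈ PointedCone.hull ℝ (G : Set V) ↔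
      ∀ ℓ ∈ Λ, 0 ≤ ℓ v := by
  classical
  induction G using Finset.induction_on with
  | empty =>
    let b := Module.finBasis ℝ V
    refine ⟨Finset.univ.image b.coord ∪ Finset.univ.image (fun i => -b.coord i), fun v => ?_⟩
    simp only [Finset.coe_empty, PointedCone.hull, Submodule.span_empty, Submodule.mem_bot]
    constructor
    · rintro rfl; simp
    · intro h
      apply b.ext_elem
      intro i
      have h1 := h (b.coord i) (by simp)
      have h2 := h (-b.coord i) (by simp)
      simp only [LinearMap.neg_apply, Module.Basis.coord_apply] at h1 h2
      simp only [map_zero, Finsupp.coe_zero, Pi.zero_apply]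
      linarith
  | insert g G _ ih =>
    obtain ⟨Λ, hΛ⟩ := ih
    -- The vector v lies in the new cone iff v - t • g lies in the old one for some t ≥ 0.
    -- Eliminating t keeps the inequalities that are nonnegative at g and adds, for each pair of
    -- opposite signs at g, its combination vanishing at g; other pairs contribute the void
    -- inequality 0 ≥ 0.
    refine ⟨Λ.filter (fun ℓ => 0 ≤ ℓ g) ∪
      (Λ ×ˢ Λ).image (fun p => if 0 < p.1 g ∧ p.2 g < 0 then p.1 g • p.2 - p.2 g • p.1 else 0),
      fun v => ?_⟩
    rw [Finset.coe_insert, PointedCone.hull, Submodule.mem_span_insert]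
    constructor
    · rintro ⟨a, z, hz, rfl⟩ ℓ hℓ
      have hz' := (hΛ z).1 hz
      have hsm : ∀ m : Module.Dual ℝ V, m (a • g + z) = (a : ℝ) * m g + m z := by
        intro m
        rw [map_add, ← smul_eq_mul, ← map_smul]; rfl
      rw [hsm]
      simp only [Finset.mem_union, Finset.mem_filter, Finset.mem_image, Finset.mem_product,
        Prod.exists] at hℓ
      rcases hℓ with ⟨h1, h2⟩ | ⟨l, m, ⟨hl, hm⟩, rfl⟩
      · exact add_nonneg (mul_nonneg a.2 h2) (hz' ℓ h1)
      · split_ifs with hc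
        · simp only [LinearMap.sub_apply, LinearMap.smul_apply, smul_eq_mul]
          have e1 := mul_nonneg hc.1.le (hz' m hm)
          have e2 := mul_nonneg (neg_pos.mpr hc.2).le (hz' l hl)
          nlinarith
        · simp
    · intro h
      obtain ⟨t, ht, hall⟩ := exists_nonneg_forall_sub_mul_nonneg Λ (fun ℓ => ℓ v) (fun ℓ => ℓ g)
        (fun ℓ hℓ hg => h ℓ (by simp [hℓ, hg]))
        (fun l hl m hm h1 h2 => by
          have := h (l g • m - m g • l) (by
            simp only [Finset.mem_union, Finset.mem_image, Finset.mem_product, Prod.exists]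
            exact Or.inr ⟨l, m, ⟨hl, hm⟩, by rw [if_pos ⟨h1, h2⟩]⟩)
          simpa using this)
      refine ⟨⟨t, ht⟩, v - t • g, (hΛ _).2 fun ℓ hℓ => ?_, ?_⟩
      · simpa using hall ℓ hℓ
      · change v = t • g + (v - t • g)
        abel

/-- A functional that is nonnegative on a finitely generated cone of functionals comes from a
point: auxiliary description of the cone generated by finitely many functionals. -/
lemma exists_finset_of_hull_dual (Λ : Finset (Module.Dual ℝ V)) :
    ∃ G : Finset V, ∀ m : Module.Dual ℝ V,
      m ∈ PointedCone.hull ℝ (Λ : Set (Module.Dual ℝ V)) ↔ ∀ g ∈ G, 0 ≤ m g := by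
  classical
  obtain ⟨Γ, hΓ⟩ := PointedCone.exists_finset_dual_of_hull_finset Λ
  refine ⟨Γ.image (Module.evalEquiv ℝ V).symm, fun m => ?_⟩
  rw [hΓ]
  simp only [Finset.mem_image, forall_exists_index, and_imp, forall_apply_eq_imp_iff₂]
  refine forall₂_congr fun γ _ => ?_
  rw [Module.apply_evalEquiv_symm_apply]

/-- Farkas' lemma. -/
theorem mem_hull_of_forall_nonneg {Λ : Finset (Module.Dual ℝ V)} {m : Module.Dual ℝ V}
    (h : ∀ v, (∀ ℓ ∈ Λ, 0 ≤ ℓ v) → 0 ≤ m v) :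
    m ∈ PointedCone.hull ℝ (Λ : Set (Module.Dual ℝ V)) := by
  obtain ⟨G, hG⟩ := exists_finset_of_hull_dual Λ
  -- The points of G cut out the cone generated by Λ, so all functionals of Λ are nonnegative at
  -- them and `h` applies to them.
  refine (hG m).2 fun g hg => h g fun ℓ hℓ => ?_
  exact (hG ℓ).1 (Submodule.subset_span hℓ) g hg

/-- Minkowski's theorem: a cone cut out by finitely many inequalities is finitely generated. -/
theorem exists_finset_hull_of_dual (Λ : Finset (Module.Dual ℝ V)) :
    ∃ G : Finset V, ∀ v, (∀ ℓ ∈ Λ, 0 ≤ ℓ v) ↔ v ∈ PointedCone.hull ℝ (G : Set V) := by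
  obtain ⟨G, hG⟩ := exists_finset_of_hull_dual Λ
  refine ⟨G, fun v => ⟨fun hv => ?_, fun hv ℓ hℓ => ?_⟩⟩
  -- Biduality: the inequalities M that describe the cone of G are nonnegative on G, hence lie in
  -- the cone generated by Λ.
  · obtain ⟨M, hM⟩ := PointedCone.exists_finset_dual_of_hull_finset G
    refine (hM v).2 fun m hm => ?_
    have : m ∈ PointedCone.hull ℝ (Λ : Set (Module.Dual ℝ V)) :=
      (hG m).2 fun g hg => (hM g).1 (Submodule.subset_span hg) m hm
    have h2 := nonneg_of_mem_hull this (Module.Dual.eval ℝ V v) (fun g hg => hv g hg)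
    exact h2
  · exact nonneg_of_mem_hull hv ℓ fun g hg => (hG ℓ).1 (Submodule.subset_span hℓ) g hg

/-- A functional that is nonnegative on the intersection of a polyhedral cone with a half-space is
the sum of one that is nonnegative on the cone and a nonnegative multiple of the one defining the
half-space. -/
lemma exists_nonneg_add_smul {Λ : Finset (Module.Dual ℝ V)} {m ℓ : Module.Dual ℝ V}
    (h : ∀ v, (∀ l ∈ Λ, 0 ≤ l v) → 0 ≤ ℓ v → 0 ≤ m v) :
    ∃ (m' : Module.Dual ℝ V) (a : ℝ), 0 ≤ a ∧ (∀ v, (∀ l ∈ Λ, 0 ≤ l v) → 0 ≤ m' v) ∧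
      m = m' + a • ℓ := by
  classical
  have := mem_hull_of_forall_nonneg (Λ := insert ℓ Λ) (m := m) (fun v hv =>
    h v (fun l hl => hv l (Finset.mem_insert_of_mem hl)) (hv ℓ (Finset.mem_insert_self _ _)))
  rw [Finset.coe_insert, PointedCone.hull, Submodule.mem_span_insert] at this
  obtain ⟨a, z, hz, rfl⟩ := this
  refine ⟨z, a, a.2, fun v hv => ?_, by rw [add_comm]; rfl⟩
  exact nonneg_of_mem_hull hz (Module.Dual.eval ℝ V v) (fun g hg => hv g hg)

end PolyhedralCones

lemma PointedCone.exists_sub_of_mem_span {V : Type*} [AddCommGroup V] [Module ℝ V]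
    (K : PointedCone ℝ V) {v : V} (hv : v ∈ Submodule.span ℝ (K : Set V)) :
    ∃ a ∈ K, ∃ b ∈ K, v = a - b := by
  induction hv using Submodule.span_induction with
  | mem x hx => exact ⟨x, hx, 0, K.zero_mem, by simp⟩
  | zero => exact ⟨0, K.zero_mem, 0, K.zero_mem, by simp⟩
  | add x y _ _ hx hy =>
    obtain ⟨a, ha, b, hb, rfl⟩ := hx
    obtain ⟨c, hc, d, hd, rfl⟩ := hy
    exact ⟨a + c, K.add_mem ha hc, b + d, K.add_mem hb hd, by abel⟩
  | smul t x _ hx =>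
    obtain ⟨a, ha, b, hb, rfl⟩ := hx
    rcases le_total 0 t with ht | ht
    · exact ⟨t • a, PointedCone.smul_mem K ht ha, t • b, PointedCone.smul_mem K ht hb,
        by rw [smul_sub]⟩
    · refine ⟨(-t) • b, PointedCone.smul_mem K (by linarith) hb, (-t) • a,
        PointedCone.smul_mem K (by linarith) ha, ?_⟩
      rw [smul_sub, neg_smul, neg_smul]; abel

/-! ### The cones of a complex as polyhedral cones in N -/

namespace EuclideanConicalSpace

variable {X N : Type*} [TopologicalSpace X] [NormedAddCommGroup N] [InnerProductSpace ℝ N]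

/-- The quasi-embedding is linear and injective on the cones of the complex. -/
def Good (S : EuclideanConicalSpace X N) (P : ConicalComplex X) : Prop :=
  P.IsLinearMap S.ι ∧ ∀ σ ∈ P.cones, Set.InjOn S.ι σ

lemma good_complex (S : EuclideanConicalSpace X N) : S.Good S.complex := ⟨S.isLinear, S.injOn⟩

variable {S : EuclideanConicalSpace X N} {P : ConicalComplex X}

lemma Good.of_isSubdivision {Q : ConicalComplex X} (hP : S.Good P) (h : Q.IsSubdivision P) :
    S.Good Q := by
  refine ⟨fun ℓ σ' hσ' => ?_, fun σ' hσ' => ?_⟩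
  · obtain ⟨σ, hσ, hsub, hlin⟩ := h σ' hσ'
    exact hlin _ (hP.1 ℓ σ hσ)
  · obtain ⟨σ, hσ, hsub, -⟩ := h σ' hσ'
    exact (hP.2 σ hσ).mono hsub

namespace Good

variable {σ τ : Set X}

lemma restrict_mem (hP : S.Good P) (hσ : σ ∈ P.cones) (ℓ : Module.Dual ℝ N) :
    (fun x : σ => ℓ (S.ι x)) ∈ P.lin σ := hP.1 ℓ σ hσ

/-- The restriction of linear functionals to a cone. -/
def restrictDual (hP : S.Good P) (hσ : σ ∈ P.cones) : Module.Dual ℝ N →ₗ[ℝ] P.lin σ where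
  toFun ℓ := ⟨fun x => ℓ (S.ι x), hP.restrict_mem hσ ℓ⟩
  map_add' _ _ := rfl
  map_smul' _ _ := rfl

variable [FiniteDimensional ℝ N]

/-- `J` is the transpose of the restriction of functionals from N to the cone. Its kernel is zero
because, the cone being full-dimensional, a kernel vector is a difference of evaluations at two
points with the same image under ι, and ι is injective on the cone. -/
lemma exists_linear_extension (hP : S.Good P) (hσ : σ ∈ P.cones) :
    ∃ J : Module.Dual ℝ (P.lin σ) →ₗ[ℝ] N, (∀ x : σ, J (coneEval σ (P.lin σ) x) = S.ι x) ∧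
      J = (Module.evalEquiv ℝ N).symm.toLinearMap ∘ₗ (hP.restrictDual hσ).dualMap ∧
      Function.Injective J := by
  refine ⟨_, ?_, rfl, ?_⟩
  · intro x
    simp only [LinearMap.comp_apply, LinearEquiv.coe_coe]
    rw [LinearEquiv.symm_apply_eq]
    rfl
  have hJ : ∀ x : σ, ((Module.evalEquiv ℝ N).symm.toLinearMap ∘ₗ
      (hP.restrictDual hσ).dualMap) (coneEval σ (P.lin σ) x) = S.ι x := by
    intro x
    simp only [LinearMap.comp_apply, LinearEquiv.coe_coe]
    rw [LinearEquiv.symm_apply_eq]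
    rfl
  rw [injective_iff_map_eq_zero]
  intro v hv
  obtain ⟨K, hK, -, -, hspan⟩ := P.polyhedral σ hσ
  obtain ⟨a, ha, b, hb, rfl⟩ := K.exists_sub_of_mem_span (v := v) (by rw [hspan]; trivial)
  rw [← SetLike.mem_coe, ← hK] at ha hb
  obtain ⟨x, rfl⟩ := ha
  obtain ⟨y, rfl⟩ := hb
  rw [map_sub, hJ, hJ, sub_eq_zero] at hv
  rw [Subtype.ext (hP.2 σ hσ x.2 y.2 hv), sub_self]

/-- Transposed injectivity of `J`. From here on, a linear function on a cone can be replaced by a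
functional on N. -/
lemma restrictDual_surjective (hP : S.Good P) (hσ : σ ∈ P.cones) :
    Function.Surjective (hP.restrictDual hσ) := by
  obtain ⟨J, -, hJ, hinj⟩ := hP.exists_linear_extension hσ
  have := P.finiteDimensional σ hσ
  rw [← LinearMap.dualMap_injective_iff]
  intro a b hab
  apply hinj
  rw [hJ]
  simp [hab]

lemma mem_lin_iff (hP : S.Good P) (hσ : σ ∈ P.cones) {u : σ → ℝ} :
    u ∈ P.lin σ ↔ ∃ ℓ : Module.Dual ℝ N, ∀ x : σ, u x = ℓ (S.ι x) := by
  constructor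
  · intro hu
    obtain ⟨ℓ, hℓ⟩ := hP.restrictDual_surjective hσ ⟨u, hu⟩
    exact ⟨ℓ, fun x => (congrFun (congrArg Subtype.val hℓ) x).symm⟩
  · rintro ⟨ℓ, hℓ⟩
    rw [funext hℓ]
    exact hP.restrict_mem hσ ℓ

lemma isPL_iff (hP : S.Good P) {φ : X → ℝ} :
    P.IsPL φ ↔ ∀ σ ∈ P.cones, ∃ ℓ : Module.Dual ℝ N, ∀ x ∈ σ, φ x = ℓ (S.ι x) := by
  refine forall₂_congr fun σ hσ => ?_
  rw [hP.mem_lin_iff hσ]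
  simp

lemma exists_hull (hP : S.Good P) (hσ : σ ∈ P.cones) :
    ∃ G : Finset N, ∀ v, v ∈ S.ι '' σ ↔ v ∈ PointedCone.hull ℝ (G : Set N) := by
  classical
  obtain ⟨K, hK, ⟨T, hT⟩, -, -⟩ := P.polyhedral σ hσ
  obtain ⟨J, hJ, -, -⟩ := hP.exists_linear_extension hσ
  refine ⟨T.image J, fun v => ?_⟩
  have h1 : PointedCone.hull ℝ ((T.image J : Finset N) : Set N) = K.map J := by
    rw [← hT, Finset.coe_image]
    exact (Submodule.map_span (J.restrictScalars {c : ℝ // 0 ≤ c}) (T : Set _)).symm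
  rw [h1, PointedCone.mem_map]
  constructor
  · rintro ⟨x, hx, rfl⟩
    refine ⟨coneEval σ _ ⟨x, hx⟩, ?_, hJ ⟨x, hx⟩⟩
    rw [← SetLike.mem_coe, ← hK]
    exact ⟨_, rfl⟩
  · rintro ⟨w, hw, rfl⟩
    rw [← SetLike.mem_coe, ← hK] at hw
    obtain ⟨x, rfl⟩ := hw
    exact ⟨x, x.2, (hJ x).symm⟩

lemma exists_ineq (hP : S.Good P) (hσ : σ ∈ P.cones) :
    ∃ Λ : Finset (Module.Dual ℝ N), ∀ v, v ∈ S.ι '' σ ↔ ∀ ℓ ∈ Λ, 0 ≤ ℓ v := by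
  obtain ⟨G, hG⟩ := hP.exists_hull hσ
  obtain ⟨Λ, hΛ⟩ := PointedCone.exists_finset_dual_of_hull_finset G
  exact ⟨Λ, fun v => (hG v).trans (hΛ v)⟩

lemma exists_comb (hP : S.Good P) (hσ : σ ∈ P.cones) {x y : X} (hx : x ∈ σ) (hy : y ∈ σ)
    {a b : ℝ} (ha : 0 ≤ a) (hb : 0 ≤ b) : ∃ z ∈ σ, S.ι z = a • S.ι x + b • S.ι y := by
  obtain ⟨Λ, hΛ⟩ := hP.exists_ineq hσ
  refine (hΛ _).2 fun ℓ hℓ => ?_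
  rw [map_add, map_smul, map_smul]
  exact add_nonneg (mul_nonneg ha ((hΛ _).1 ⟨x, hx, rfl⟩ ℓ hℓ))
    (mul_nonneg hb ((hΛ _).1 ⟨y, hy, rfl⟩ ℓ hℓ))

lemma exists_smul (hP : S.Good P) (hσ : σ ∈ P.cones) {x : X} (hx : x ∈ σ)
    {a : ℝ} (ha : 0 ≤ a) : ∃ z ∈ σ, S.ι z = a • S.ι x := by
  obtain ⟨z, hz, h⟩ := hP.exists_comb hσ hx hx ha le_rfl
  exact ⟨z, hz, by simpa using h⟩

lemma exists_zero (hP : S.Good P) (hσ : σ ∈ P.cones) : ∃ z ∈ σ, S.ι z = 0 := by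
  obtain ⟨Λ, hΛ⟩ := hP.exists_ineq hσ
  exact (hΛ 0).2 fun ℓ _ => by simp

lemma eq_zero_of_eq_neg (hP : S.Good P) (hσ : σ ∈ P.cones) {x y : X} (hx : x ∈ σ) (hy : y ∈ σ)
    (h : S.ι x = -S.ι y) : S.ι x = 0 := by
  obtain ⟨K, hK, -, hsal, -⟩ := P.polyhedral σ hσ
  obtain ⟨J, hJ, -, hinj⟩ := hP.exists_linear_extension hσ
  have e : coneEval σ (P.lin σ) ⟨x, hx⟩ = -coneEval σ (P.lin σ) ⟨y, hy⟩ := by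
    apply hinj
    rw [map_neg, hJ, hJ]; exact h
  have h0 : coneEval σ (P.lin σ) ⟨x, hx⟩ = 0 := by
    apply hsal
    · rw [← SetLike.mem_coe, ← hK]; exact ⟨_, rfl⟩
    · rw [e, neg_neg, ← SetLike.mem_coe, ← hK]; exact ⟨_, rfl⟩
  have := hJ ⟨x, hx⟩
  rw [h0, map_zero] at this
  exact this.symm

lemma dim_eq (hP : S.Good P) (hσ : σ ∈ P.cones) :
    P.dim σ = Module.finrank ℝ (S.spanOf σ) := by
  obtain ⟨K, hK, -, -, hspan⟩ := P.polyhedral σ hσ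
  obtain ⟨J, hJ, -, hinj⟩ := hP.exists_linear_extension hσ
  have := P.finiteDimensional σ hσ
  have h1 : S.spanOf σ = LinearMap.range J := by
    rw [LinearMap.range_eq_map, ← hspan, Submodule.map_span, ← hK, ← Set.range_comp, spanOf]
    congr 1
    ext v
    constructor
    · rintro ⟨x, hx, rfl⟩; exact ⟨⟨x, hx⟩, hJ _⟩
    · rintro ⟨x, rfl⟩; exact ⟨x, x.2, (hJ x).symm⟩
  rw [h1, LinearMap.finrank_range_of_inj hinj, Subspace.dual_finrank_eq]
  rfl

lemma isFace_iff (hP : S.Good P) (hσ : σ ∈ P.cones) : P.IsFace τ σ ↔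
    ∃ ℓ : Module.Dual ℝ N, (∀ x ∈ σ, 0 ≤ ℓ (S.ι x)) ∧ τ = {x ∈ σ | ℓ (S.ι x) = 0} := by
  constructor
  · rintro ⟨u, hu, h0, rfl⟩
    obtain ⟨ℓ, hℓ⟩ := (hP.mem_lin_iff hσ).1 hu
    refine ⟨ℓ, fun x hx => by rw [← hℓ ⟨x, hx⟩]; exact h0 _, ?_⟩
    ext x
    constructor
    · rintro ⟨y, hy, rfl⟩; exact ⟨y.2, by rw [← hℓ y]; exact hy⟩
    · rintro ⟨hx, h⟩; exact ⟨⟨x, hx⟩, by rw [Set.mem_ofPred_eq, hℓ]; exact h, rfl⟩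
  · rintro ⟨ℓ, h0, rfl⟩
    refine ⟨_, hP.restrict_mem hσ ℓ, fun x => h0 x x.2, ?_⟩
    ext x
    constructor
    · rintro ⟨hx, h⟩; exact ⟨⟨x, hx⟩, h, rfl⟩
    · rintro ⟨y, hy, rfl⟩; exact ⟨y.2, hy⟩

end Good

lemma mem_spanOf {σ : Set X} {x : X} (hx : x ∈ σ) : S.ι x ∈ S.spanOf σ :=
  Submodule.subset_span ⟨x, hx, rfl⟩

lemma eq_zero_of_mem_spanOf {σ : Set X} {ℓ : Module.Dual ℝ N} (h : ∀ x ∈ σ, ℓ (S.ι x) = 0)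
    {v : N} (hv : v ∈ S.spanOf σ) : ℓ v = 0 := by
  have : S.spanOf σ ≤ LinearMap.ker ℓ := by
    refine Submodule.span_le.2 ?_
    rintro _ ⟨x, hx, rfl⟩
    exact h x hx
  exact this hv

lemma spanOf_mono {σ τ : Set X} (h : τ ⊆ σ) : S.spanOf τ ≤ S.spanOf σ :=
  Submodule.span_mono (Set.image_mono h)

/-! ### Relative interiors, carriers and faces -/

/-- `x` lies in the relative interior of the cone `σ`: it lies in no proper face. -/
def Inner (S : EuclideanConicalSpace X N) (σ : Set X) (x : X) : Prop :=
  x ∈ σ ∧ ∀ ℓ : Module.Dual ℝ N, (∀ y ∈ σ, 0 ≤ ℓ (S.ι y)) → ℓ (S.ι x) = 0 →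
    ∀ y ∈ σ, ℓ (S.ι y) = 0

lemma Inner.of_comb {σ : Set X} {x y z : X} (hx : S.Inner σ x)
    (hy : y ∈ σ) (hz : z ∈ σ) {a b : ℝ} (ha : 0 < a) (hb : 0 ≤ b)
    (h : S.ι z = a • S.ι x + b • S.ι y) : S.Inner σ z := by
  refine ⟨hz, fun ℓ h0 hℓ => hx.2 ℓ h0 ?_⟩
  rw [h, map_add, map_smul, map_smul, smul_eq_mul, smul_eq_mul] at hℓ
  nlinarith [h0 x hx.1, h0 y hy, mul_nonneg ha.le (h0 x hx.1), mul_nonneg hb (h0 y hy)]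

namespace Good

variable [FiniteDimensional ℝ N] {σ τ : Set X}

lemma exists_inner (hP : S.Good P) (hσ : σ ∈ P.cones) : ∃ x, S.Inner σ x := by
  obtain ⟨G, hG⟩ := hP.exists_hull hσ
  -- The sum of the generators: a functional that is nonnegative on the cone and vanishes at the sum
  -- vanishes at each generator.
  obtain ⟨x, hx, hxG⟩ := (hG (∑ g ∈ G, g)).2
    (Submodule.sum_mem _ fun g hg => Submodule.subset_span hg)
  refine ⟨x, hx, fun ℓ h0 hℓx y hy => ?_⟩
  have hg : ∀ g ∈ G, 0 ≤ ℓ g := by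
    intro g hg
    obtain ⟨z, hz, rfl⟩ := (hG g).2 (Submodule.subset_span hg)
    exact h0 z hz
  rw [hxG, map_sum, Finset.sum_eq_zero_iff_of_nonneg hg] at hℓx
  refine le_antisymm ?_ (h0 y hy)
  have := nonneg_of_mem_hull ((hG (S.ι y)).1 ⟨y, hy, rfl⟩) (-ℓ) (fun g hg => by
    simp [hℓx g hg])
  simpa using this

/-- A relative interior point can be moved a little in all directions of the span. -/
lemma exists_move (hP : S.Good P) (hσ : σ ∈ P.cones) {x : X} (hx : S.Inner σ x) {w : N}
    (hw : w ∈ S.spanOf σ) :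
    ∃ ε > 0, ∀ t : ℝ, |t| ≤ ε → ∃ z ∈ σ, S.ι z = S.ι x + t • w := by
  classical
  obtain ⟨Λ, hΛ⟩ := hP.exists_ineq hσ
  have key : ∀ ℓ ∈ Λ, ∃ ε > 0, ∀ t : ℝ, |t| ≤ ε → 0 ≤ ℓ (S.ι x + t • w) := by
    intro ℓ hℓ
    have h0 : ∀ y ∈ σ, 0 ≤ ℓ (S.ι y) := fun y hy => (hΛ _).1 ⟨y, hy, rfl⟩ ℓ hℓ
    rcases (h0 x hx.1).eq_or_lt with h | h
    · have := hx.2 ℓ h0 h.symm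
      refine ⟨1, one_pos, fun t _ => ?_⟩
      rw [map_add, map_smul, ← h, eq_zero_of_mem_spanOf this hw]
      simp
    · refine ⟨ℓ (S.ι x) / (|ℓ w| + 1), by positivity, fun t ht => ?_⟩
      rw [le_div_iff₀ (by positivity)] at ht
      rw [map_add, map_smul, smul_eq_mul]
      have h1 : |t * ℓ w| ≤ |t| * (|ℓ w| + 1) := by
        rw [abs_mul]; nlinarith [abs_nonneg t]
      linarith [neg_abs_le (t * ℓ w)]
  choose! ε hε hmove using key
  rcases Λ.eq_empty_or_nonempty with rfl | hne
  · exact ⟨1, one_pos, fun t _ => (hΛ _).2 (by simp)⟩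
  · refine ⟨Λ.inf' hne ε, (Finset.lt_inf'_iff _).2 fun ℓ hℓ => hε ℓ hℓ, fun t ht => ?_⟩
    exact (hΛ _).2 fun ℓ hℓ => hmove ℓ hℓ t (ht.trans (Finset.inf'_le _ hℓ))

lemma eq_of_inner_of_isFace (hP : S.Good P) (hσ : σ ∈ P.cones) {x : X} (hx : S.Inner σ x)
    (hτ : P.IsFace τ σ) (hxτ : x ∈ τ) : τ = σ := by
  obtain ⟨ℓ, h0, rfl⟩ := (hP.isFace_iff hσ).1 hτ
  ext y
  exact ⟨fun h => h.1, fun h => ⟨h, hx.2 ℓ h0 hxτ.2 y h⟩⟩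

lemma isFace_mem (hσ : σ ∈ P.cones) (h : P.IsFace τ σ) : τ ∈ P.cones := P.face_mem σ hσ τ h

lemma isFace_subset (h : P.IsFace τ σ) : τ ⊆ σ := by
  obtain ⟨u, -, -, rfl⟩ := h
  rintro _ ⟨x, -, rfl⟩
  exact x.2

/-- A cone that contains a relative interior point of another one has it as a face. -/
lemma isFace_of_inner (hP : S.Good P) (hσ : σ ∈ P.cones) (hτ : τ ∈ P.cones) {x : X}
    (hx : S.Inner τ x) (hxσ : x ∈ σ) : P.IsFace τ σ := by
  obtain ⟨𝓕, h𝓕, he⟩ := P.inter σ hσ τ hτ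
  have : x ∈ ⋃₀ 𝓕 := he ▸ ⟨hxσ, hx.1⟩
  obtain ⟨F, hF, hxF⟩ := this
  have := hP.eq_of_inner_of_isFace hτ hx (h𝓕 F hF).2 hxF
  rw [← this]
  exact (h𝓕 F hF).1

lemma subset_of_inner (hP : S.Good P) (hσ : σ ∈ P.cones) (hτ : τ ∈ P.cones) {x : X}
    (hx : S.Inner τ x) (hxσ : x ∈ σ) : τ ⊆ σ := isFace_subset (hP.isFace_of_inner hσ hτ hx hxσ)

lemma isFace_iff_subset (hP : S.Good P) (hσ : σ ∈ P.cones) :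
    P.IsFace τ σ ↔ τ ∈ P.cones ∧ τ ⊆ σ := by
  refine ⟨fun h => ⟨isFace_mem hσ h, isFace_subset h⟩, fun h => ?_⟩
  obtain ⟨x, hx⟩ := hP.exists_inner h.1
  exact hP.isFace_of_inner hσ h.1 hx (h.2 hx.1)

/-- Every point lies in the relative interior of a cone. -/
lemma exists_carrier (hP : S.Good P) (x : X) : ∃ σ ∈ P.cones, S.Inner σ x := by
  classical
  have : x ∈ ⋃₀ (P.cones : Set (Set X)) := P.cover ▸ Set.mem_univ x
  obtain ⟨σ, hσ, hx⟩ := this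
  have hσ : σ ∈ P.cones := hσ
  obtain ⟨Λ, hΛ⟩ := hP.exists_ineq hσ
  -- The sum of the inequalities that are equalities at x; its zero locus is the smallest face
  -- containing x.
  set m : Module.Dual ℝ N := ∑ ℓ ∈ Λ with ℓ (S.ι x) = 0, ℓ with hm
  have hnn : ∀ y ∈ σ, ∀ ℓ ∈ Λ, 0 ≤ ℓ (S.ι y) := fun y hy => (hΛ _).1 ⟨y, hy, rfl⟩
  have hmap : ∀ v, m v = ∑ ℓ ∈ Λ with ℓ (S.ι x) = 0, ℓ v := fun v => by
    rw [hm, LinearMap.sum_apply]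
  have hface : P.IsFace {y ∈ σ | m (S.ι y) = 0} σ := by
    refine (hP.isFace_iff hσ).2 ⟨m, fun y hy => ?_, rfl⟩
    rw [hmap]
    exact Finset.sum_nonneg fun ℓ hℓ => hnn y hy ℓ (Finset.mem_filter.1 hℓ).1
  have hF : ∀ y ∈ σ, m (S.ι y) = 0 → ∀ ℓ ∈ Λ, ℓ (S.ι x) = 0 → ℓ (S.ι y) = 0 := by
    intro y hy h ℓ hℓ hx0
    rw [hmap, Finset.sum_eq_zero_iff_of_nonneg
      (fun ℓ hℓ => hnn y hy ℓ (Finset.mem_filter.1 hℓ).1)] at h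
    exact h ℓ (Finset.mem_filter.2 ⟨hℓ, hx0⟩)
  refine ⟨_, isFace_mem hσ hface, ⟨hx, ?_⟩, ?_⟩
  · rw [hmap]
    exact Finset.sum_eq_zero fun ℓ hℓ => (Finset.mem_filter.1 hℓ).2
  rintro l h0 hlx y ⟨hy, hmy⟩
  refine le_antisymm ?_ (h0 y ⟨hy, hmy⟩)
  -- Within this face x can be moved slightly away from y: the inequalities tight at x vanish at y,
  -- the others are strict at x. Evaluating `l` at the moved point gives l(y) ≤ 0.
  have key : ∃ ε : ℝ, 0 < ε ∧ ∀ ℓ ∈ Λ, 0 ≤ ℓ (S.ι x - ε • S.ι y) := by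
    have : ∀ ℓ ∈ Λ, ∀ᶠ ε in 𝓝[>] (0 : ℝ), 0 ≤ ℓ (S.ι x - ε • S.ι y) := by
      intro ℓ hℓ
      rcases (hnn x hx ℓ hℓ).eq_or_lt with h | h
      · refine Eventually.of_forall fun ε => ?_
        rw [map_sub, map_smul, ← h, hF y hy hmy ℓ hℓ h.symm]; simp
      · have hc : Tendsto (fun ε : ℝ => ℓ (S.ι x) - ε * ℓ (S.ι y)) (𝓝[>] 0)
            (𝓝 (ℓ (S.ι x) - 0 * ℓ (S.ι y))) :=
          ((continuous_const.sub (continuous_id.mul continuous_const)).tendsto 0).mono_left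
            nhdsWithin_le_nhds
        rw [zero_mul, sub_zero] at hc
        filter_upwards [hc.eventually (lt_mem_nhds h)] with ε hε
        rw [map_sub, map_smul]; exact hε.le
    obtain ⟨ε, h1, h2⟩ := (((Filter.eventually_all_finset Λ).2 this).and
      self_mem_nhdsWithin).exists
    exact ⟨ε, h2, h1⟩
  obtain ⟨ε, hε, hmem⟩ := key
  obtain ⟨z, hz, hzι⟩ := (hΛ _).2 hmem
  have h1 : 0 ≤ l (S.ι z) := by
    refine h0 z ⟨hz, ?_⟩
    rw [hzι, map_sub, map_smul, hmy, hmap]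
    rw [Finset.sum_eq_zero fun ℓ hℓ => (Finset.mem_filter.1 hℓ).2]
    simp
  rw [hzι, map_sub, map_smul, hlx, smul_eq_mul] at h1
  nlinarith

lemma dim_le (hP : S.Good P) (hσ : σ ∈ P.cones) (hτ : τ ∈ P.cones) (h : τ ⊆ σ) :
    P.dim τ ≤ P.dim σ := by
  rw [hP.dim_eq hσ, hP.dim_eq hτ]
  exact Submodule.finrank_mono (spanOf_mono h)

/-- The smaller cone is a face, cut out by a functional that vanishes on its span; by dimension this
is the span of the larger cone. -/
lemma eq_of_subset_of_dim_le (hP : S.Good P) (hσ : σ ∈ P.cones) (hτ : τ ∈ P.cones) (h : τ ⊆ σ)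
    (hd : P.dim σ ≤ P.dim τ) : τ = σ := by
  rw [hP.dim_eq hσ, hP.dim_eq hτ] at hd
  have hs := Submodule.eq_of_le_of_finrank_le (spanOf_mono (S := S) h) hd
  obtain ⟨ℓ, h0, rfl⟩ := (hP.isFace_iff hσ).1 ((hP.isFace_iff_subset hσ).2 ⟨hτ, h⟩)
  ext y
  refine ⟨fun h => h.1, fun hy => ⟨hy, ?_⟩⟩
  refine eq_zero_of_mem_spanOf (σ := {x ∈ σ | ℓ (S.ι x) = 0}) (fun x hx => hx.2) ?_
  rw [hs]
  exact mem_spanOf hy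

/-! ### Minimal cones and pull-back -/

section Subdivision

variable {Q : ConicalComplex X}

/-- The relative interior of a cone of a subdivision meets only cones that contain it. -/
lemma subset_of_inner_of_isSubdivision (hP : S.Good P) (hQ : Q.IsSubdivision P) {σ' : Set X}
    (hσ' : σ' ∈ Q.cones) (hσ : σ ∈ P.cones) {x : X} (hx : S.Inner σ' x) (hxσ : x ∈ σ) :
    σ' ⊆ σ := by
  obtain ⟨ρ, hρ, hsub, -⟩ := hQ σ' hσ'
  obtain ⟨𝓕, h𝓕, he⟩ := P.inter ρ hρ σ hσ
  have : x ∈ ⋃₀ 𝓕 := he ▸ ⟨hsub hx.1, hxσ⟩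
  obtain ⟨F, hF, hxF⟩ := this
  obtain ⟨ℓ, h0, rfl⟩ := (hP.isFace_iff hρ).1 (h𝓕 F hF).1
  have h2 := isFace_subset (h𝓕 _ hF).2
  intro y hy
  exact h2 ⟨hsub hy, hx.2 ℓ (fun z hz => h0 z (hsub hz)) hxF.2 y hy⟩

/-- The minimal cone around a cone of the subdivision is the carrier of any one of its relative
interior points. Pull-backs can therefore be computed at a single point. -/
lemma isMinimalCone_iff (hP : S.Good P) (hQ : Q.IsSubdivision P) {σ' : Set X}
    (hσ' : σ' ∈ Q.cones) {x : X} (hx : S.Inner σ' x) :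
    P.IsMinimalCone σ' σ ↔ σ ∈ P.cones ∧ S.Inner σ x := by
  have main : ∀ σ, σ ∈ P.cones → S.Inner σ x → P.IsMinimalCone σ' σ := fun σ hσ hxσ =>
    ⟨hσ, hP.subset_of_inner_of_isSubdivision hQ hσ' hσ hx hxσ.1, fun ρ hρ hsub =>
      hP.subset_of_inner hρ hσ hxσ (hsub hx.1)⟩
  refine ⟨fun h => ?_, fun h => main σ h.1 h.2⟩
  obtain ⟨ρ, hρ, hxρ⟩ := hP.exists_carrier x
  have h2 := main ρ hρ hxρ
  have : σ = ρ := (h.2.2 ρ hρ h2.2.1).antisymm (h2.2.2 σ h.1 h.2.1)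
  rw [this]
  exact ⟨hρ, hxρ⟩

lemma carrier_unique (hP : S.Good P) (hσ : σ ∈ P.cones) (hτ : τ ∈ P.cones) {x : X}
    (h1 : S.Inner σ x) (h2 : S.Inner τ x) : σ = τ :=
  (hP.subset_of_inner hτ hσ h1 h2.1).antisymm (hP.subset_of_inner hσ hτ h2 h1.1)

lemma pullback_apply (hP : S.Good P) (hQ : Q.IsSubdivision P) (c : P.Weight)
    {σ' : {s // s ∈ Q.cones}} {σ : {s // s ∈ P.cones}} {x : X} (hx : S.Inner σ'.1 x)
    (hxσ : S.Inner σ.1 x) :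
    P.pullback Q c σ' = if P.dim σ.1 = Q.dim σ'.1 then c σ else 0 := by
  classical
  rw [ConicalComplex.pullback]
  have : ∀ ρ : {s // s ∈ P.cones}, (P.IsMinimalCone σ'.1 ρ.1 ∧ P.dim ρ.1 = Q.dim σ'.1) ↔
      (ρ = σ ∧ P.dim σ.1 = Q.dim σ'.1) := by
    intro ρ
    rw [hP.isMinimalCone_iff hQ σ'.2 hx]
    constructor
    · rintro ⟨⟨h1, h2⟩, h3⟩
      have : ρ = σ := Subtype.ext (hP.carrier_unique ρ.2 σ.2 h2 hxσ)
      subst this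
      exact ⟨rfl, h3⟩
    · rintro ⟨rfl, h⟩
      exact ⟨⟨ρ.2, hxσ⟩, h⟩
  simp only [this]
  split_ifs with h
  · simp [h, Finset.sum_filter]
  · simp [h]

end Subdivision

end Good

end EuclideanConicalSpace

/-! ### Cutting a complex with a hyperplane -/

namespace EuclideanConicalSpace

variable {X N : Type*} [TopologicalSpace X] [NormedAddCommGroup N] [InnerProductSpace ℝ N]
  [FiniteDimensional ℝ N] {S : EuclideanConicalSpace X N} {P : ConicalComplex X} {σ : Set X}

namespace Good

/-- On a cone, the quasi-embedding is a homeomorphism onto its image. -/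
lemma isEmbedding (hP : S.Good P) (hσ : σ ∈ P.cones) :
    IsEmbedding fun x : σ => S.ι x := by
  have hcont : Continuous fun x : σ => S.ι x := by
    let b := Module.finBasis ℝ N
    have h1 : Continuous fun x : σ => ∑ i, b.coord i (S.ι x) • b i :=
      continuous_finsetSum _ fun i _ =>
        (P.continuous_lin σ hσ _ (hP.restrict_mem hσ (b.coord i))).smul continuous_const
    convert h1 using 2 with x
    exact (b.sum_repr (S.ι x)).symm
  choose L hL using fun u : P.lin σ => (hP.mem_lin_iff hσ).1 u.2
  have hg : Continuous fun (v : N) (u : P.lin σ) => L u v :=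
    continuous_pi fun u => LinearMap.continuous_of_finiteDimensional (L u)
  refine IsEmbedding.of_comp hcont hg ?_
  have := P.isEmbedding σ hσ
  convert this using 1
  ext x u
  exact (hL u x).symm

lemma continuous_ι (hP : S.Good P) : Continuous S.ι := by
  have h : ∀ σ : {σ // σ ∈ P.cones}, IsClosed σ.1 := fun σ => P.isClosed _ σ.2
  refine (locallyFinite_of_finite fun σ : {σ // σ ∈ P.cones} => σ.1).continuous ?_ h ?_
  · have := P.cover
    rw [Set.sUnion_eq_iUnion] at this
    exact this
  · intro σ
    rw [continuousOn_iff_continuous_domRestrict]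
    exact (hP.isEmbedding σ.2).continuous

end Good

/-- The functions on a set that are restrictions of linear functionals on the ambient space. -/
def linOn (S : EuclideanConicalSpace X N) (σ : Set X) : Submodule ℝ (σ → ℝ) :=
  LinearMap.range (LinearMap.pi fun x : σ => Module.Dual.eval ℝ N (S.ι x) :
    Module.Dual ℝ N →ₗ[ℝ] σ → ℝ)

lemma mem_linOn {u : σ → ℝ} :
    u ∈ S.linOn σ ↔ ∃ ℓ : Module.Dual ℝ N, ∀ x : σ, ℓ (S.ι x) = u x := by
  simp only [linOn, LinearMap.mem_range, funext_iff]
  rfl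

lemma isFaceOf_linOn {F : Set X} : IsFaceOf σ (S.linOn σ) F ↔
    ∃ ℓ : Module.Dual ℝ N, (∀ x ∈ σ, 0 ≤ ℓ (S.ι x)) ∧ F = {x ∈ σ | ℓ (S.ι x) = 0} := by
  constructor
  · rintro ⟨u, hu, h0, rfl⟩
    obtain ⟨ℓ, hℓ⟩ := mem_linOn.1 hu
    refine ⟨ℓ, fun x hx => by rw [hℓ ⟨x, hx⟩]; exact h0 _, ?_⟩
    ext x
    constructor
    · rintro ⟨y, hy, rfl⟩; exact ⟨y.2, by rw [hℓ y]; exact hy⟩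
    · rintro ⟨hx, h⟩; exact ⟨⟨x, hx⟩, by rw [Set.mem_ofPred_eq, ← hℓ]; exact h, rfl⟩
  · rintro ⟨ℓ, h0, rfl⟩
    refine ⟨fun x => ℓ (S.ι x), mem_linOn.2 ⟨ℓ, fun x => rfl⟩, fun x => h0 x x.2, ?_⟩
    ext x
    constructor
    · rintro ⟨hx, h⟩; exact ⟨⟨x, hx⟩, h, rfl⟩
    · rintro ⟨y, hy, rfl⟩; exact ⟨y.2, hy⟩

lemma isEmbedding_coneEval_linOn (h : IsEmbedding fun x : σ => S.ι x) :
    IsEmbedding fun (x : σ) (u : S.linOn σ) => coneEval σ (S.linOn σ) x u := by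
  let b := Module.finBasis ℝ N
  have hb : ∀ i, (fun x : σ => b.coord i (S.ι x)) ∈ S.linOn σ := fun i =>
    mem_linOn.2 ⟨b.coord i, fun _ => rfl⟩
  have hcont : Continuous fun (x : σ) (u : S.linOn σ) => coneEval σ (S.linOn σ) x u := by
    refine continuous_pi fun u => ?_
    obtain ⟨ℓ, hℓ⟩ := mem_linOn.1 u.2
    have : Continuous fun x : σ => ℓ (S.ι x) :=
      (LinearMap.continuous_of_finiteDimensional ℓ).comp h.continuous
    convert this using 2 with x
    exact (hℓ x).symm
  have hg : Continuous fun F : S.linOn σ → ℝ => ∑ i, F ⟨_, hb i⟩ • b i :=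
    continuous_finsetSum _ fun i _ => (continuous_apply _).smul continuous_const
  refine IsEmbedding.of_comp hcont hg ?_
  convert h using 1
  ext x
  exact b.sum_repr (S.ι x)

/-- A section `s` of the restriction of functionals has a transpose `T` on N with T ∘ ι equal to
evaluation, so the evaluation cone is the image under `T` of the cone of G. It is full-dimensional
because a functional on the dual is evaluation at a function, and a function vanishing at all points
is zero. -/
lemma polyhedral_linOn {G : Finset N}
    (hG : ∀ v, v ∈ S.ι '' σ ↔ v ∈ PointedCone.hull ℝ (G : Set N))
    (hsal : ∀ x ∈ σ, ∀ y ∈ σ, S.ι x = -S.ι y → S.ι x = 0) :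
    ∃ P : PointedCone ℝ (Module.Dual ℝ (S.linOn σ)),
    Set.range (coneEval σ (S.linOn σ)) = (P : Set (Module.Dual ℝ (S.linOn σ))) ∧
    Submodule.FG P ∧ (∀ v ∈ P, -v ∈ P → v = 0) ∧
    Submodule.span ℝ (P : Set (Module.Dual ℝ (S.linOn σ))) = ⊤ := by
  let R : Module.Dual ℝ N →ₗ[ℝ] S.linOn σ := LinearMap.rangeRestrict _
  have hR : LinearMap.range R = ⊤ := LinearMap.range_rangeRestrict _
  have hRx : ∀ ℓ (x : σ), (R ℓ).1 x = ℓ (S.ι x) := fun ℓ x => rfl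
  obtain ⟨s, hs⟩ := R.exists_rightInverse_of_surjective hR
  have hs' : ∀ u, R (s u) = u := fun u => LinearMap.congr_fun hs u
  let T : N →ₗ[ℝ] Module.Dual ℝ (S.linOn σ) := s.dualMap ∘ₗ Module.Dual.eval ℝ N
  have hT : ∀ x : σ, T (S.ι x) = coneEval σ (S.linOn σ) x := by
    intro x
    ext u
    change s u (S.ι x) = u.1 x
    rw [← hRx, hs']
  have hrange : Set.range (coneEval σ (S.linOn σ)) =
      (((PointedCone.hull ℝ (G : Set N)).map T : PointedCone ℝ _) :
        Set (Module.Dual ℝ (S.linOn σ))) := by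
    ext w
    rw [SetLike.mem_coe, PointedCone.mem_map]
    constructor
    · rintro ⟨x, rfl⟩; exact ⟨S.ι x, (hG _).1 ⟨x, x.2, rfl⟩, hT x⟩
    · rintro ⟨v, hv, rfl⟩
      obtain ⟨x, hx, rfl⟩ := (hG _).2 hv
      exact ⟨⟨x, hx⟩, (hT ⟨x, hx⟩).symm⟩
  refine ⟨_, hrange, Submodule.FG.map _ ⟨G, rfl⟩, fun w h1 h2 => ?_, ?_⟩
  · rw [← SetLike.mem_coe, ← hrange] at h1 h2
    obtain ⟨x, rfl⟩ := h1
    obtain ⟨y, hy⟩ := h2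
    have hval : ∀ ℓ : Module.Dual ℝ N, ℓ (S.ι x) = ℓ (-S.ι y) := by
      intro ℓ
      have := LinearMap.congr_fun hy (R ℓ)
      have h3 : ℓ (S.ι y) = -ℓ (S.ι x) := this
      rw [map_neg, h3, neg_neg]
    have h0 := hsal x x.2 y y.2 ((Module.forall_dual_apply_eq_zero_iff ℝ _).1 (fun ℓ => by
      rw [map_sub, hval ℓ, sub_self]) |> sub_eq_zero.1)
    rw [← hT, h0, map_zero]
  · rw [← hrange]
    by_contra hne
    obtain ⟨f, hf, hle⟩ := Submodule.exists_le_ker_of_lt_top _ (lt_top_iff_ne_top.2 hne)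
    have : FiniteDimensional ℝ (S.linOn σ) := by unfold linOn; infer_instance
    apply hf
    obtain ⟨u, rfl⟩ := (Module.evalEquiv ℝ (S.linOn σ)).surjective f
    have hu : u = 0 := by
      ext x
      exact hle (Submodule.subset_span ⟨x, rfl⟩)
    rw [hu, map_zero]

/-- The closed half-spaces, and the hyperplane, of a linear functional. -/
def halfSpace (S : EuclideanConicalSpace X N) (ℓ : Module.Dual ℝ N) (i : SignType) : Set X :=
  {x | (i ≠ 1 → ℓ (S.ι x) ≤ 0) ∧ (i ≠ -1 → 0 ≤ ℓ (S.ι x))}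

lemma exists_mem_halfSpace (ℓ : Module.Dual ℝ N) (x : X) : ∃ i, x ∈ S.halfSpace ℓ i := by
  rcases le_total 0 (ℓ (S.ι x)) with h | h
  · exact ⟨1, by simp, fun _ => h⟩
  · exact ⟨-1, fun _ => h, by simp⟩

/-- The functionals whose nonnegativity defines `halfSpace`. -/
def halfSpaceIneq (ℓ : Module.Dual ℝ N) (i : SignType) : List (Module.Dual ℝ N) :=
  (if i = 1 then [] else [-ℓ]) ++ (if i = -1 then [] else [ℓ])

lemma mem_halfSpace_iff {ℓ : Module.Dual ℝ N} {i : SignType} {x : X} :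
    x ∈ S.halfSpace ℓ i ↔ ∀ m ∈ halfSpaceIneq ℓ i, 0 ≤ m (S.ι x) := by
  cases i <;> simp [halfSpace, halfSpaceIneq]

namespace Good

/-- A face of the intersection of a cone with a half-space (or hyperplane) is the intersection of
a face of the cone with a half-space (or hyperplane). -/
lemma exists_face_inter_halfSpace (hP : S.Good P) (hσ : σ ∈ P.cones) {ℓ : Module.Dual ℝ N}
    {i : SignType} {m : Module.Dual ℝ N} (hm : ∀ x ∈ σ ∩ S.halfSpace ℓ i, 0 ≤ m (S.ι x)) :
    ∃ F ∈ P.cones, ∃ j, {x ∈ σ ∩ S.halfSpace ℓ i | m (S.ι x) = 0} = F ∩ S.halfSpace ℓ j := by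
  obtain ⟨Λ, hΛ⟩ := hP.exists_ineq hσ
  -- By Farkas, m is a functional nonnegative on σ plus nonnegative multiples of the inequalities of
  -- the half-space (both signs for the hyperplane). The summands are nonnegative on the
  -- intersection, so m vanishes exactly where all of them do.
  have key : ∃ (m' : Module.Dual ℝ N) (a b : ℝ), 0 ≤ a ∧ 0 ≤ b ∧ (i = -1 → a = 0) ∧
      (i = 1 → b = 0) ∧ (∀ v, (∀ l ∈ Λ, 0 ≤ l v) → 0 ≤ m' v) ∧ m = m' + a • ℓ + b • (-ℓ) := by
    have e1 : ∀ v, (∀ l ∈ Λ, 0 ≤ l v) → (i ≠ 1 → ℓ v ≤ 0) → (i ≠ -1 → 0 ≤ ℓ v) → 0 ≤ m v := by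
      intro v hv h1 h2
      obtain ⟨x, hx, rfl⟩ := (hΛ v).2 hv
      exact hm x ⟨hx, h1, h2⟩
    have hs : ∀ i : SignType, i = 1 ∨ i = -1 ∨ i = 0 := by decide
    rcases hs i with rfl | rfl | rfl
    · obtain ⟨m', a, ha, hm', rfl⟩ := exists_nonneg_add_smul (Λ := Λ) (m := m) (ℓ := ℓ)
        fun v hv h => e1 v hv (by simp) (fun _ => h)
      exact ⟨m', a, 0, ha, le_rfl, fun h => absurd h (by decide), fun _ => rfl, hm', by simp⟩
    · obtain ⟨m', a, ha, hm', rfl⟩ := exists_nonneg_add_smul (Λ := Λ) (m := m) (ℓ := -ℓ)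
        fun v hv h => e1 v hv (fun _ => by simpa using h) (by simp)
      exact ⟨m', 0, a, le_rfl, ha, fun _ => rfl, fun h => absurd h (by decide), hm', by simp⟩
    · classical
      obtain ⟨m', a, ha, hm', rfl⟩ := exists_nonneg_add_smul (Λ := insert ℓ Λ) (m := m) (ℓ := -ℓ)
        fun v hv h => e1 v (fun l hl => hv l (Finset.mem_insert_of_mem hl))
          (fun _ => by simpa using h) (fun _ => hv ℓ (Finset.mem_insert_self _ _))
      obtain ⟨m'', b, hb, hm'', rfl⟩ := exists_nonneg_add_smul (Λ := Λ) (m := m') (ℓ := ℓ)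
        fun v hv h => hm' v (by
          intro l hl
          rcases Finset.mem_insert.1 hl with rfl | hl
          · exact h
          · exact hv l hl)
      exact ⟨m'', b, a, hb, ha, fun h => absurd h (by decide), fun h => absurd h (by decide), hm'', rfl⟩
  obtain ⟨m', a, b, ha, hb, hai, hbi, hm', rfl⟩ := key
  have hnn : ∀ x ∈ σ, 0 ≤ m' (S.ι x) := fun x hx => hm' _ ((hΛ _).1 ⟨x, hx, rfl⟩)
  have hF : P.IsFace {x ∈ σ | m' (S.ι x) = 0} σ := (hP.isFace_iff hσ).2 ⟨m', hnn, rfl⟩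
  have hval : ∀ x, (m' + a • ℓ + b • (-ℓ)) (S.ι x) =
      m' (S.ι x) + a * ℓ (S.ι x) + b * (-ℓ (S.ι x)) := fun x => by
    simp [LinearMap.add_apply, LinearMap.smul_apply]
  have h1 : ∀ x ∈ S.halfSpace ℓ i, 0 ≤ a * ℓ (S.ι x) := by
    intro x hx
    by_cases hi : i = -1
    · rw [hai hi]; simp
    · exact mul_nonneg ha (hx.2 hi)
  have h2 : ∀ x ∈ S.halfSpace ℓ i, 0 ≤ b * (-ℓ (S.ι x)) := by
    intro x hx
    by_cases hi : i = 1
    · rw [hbi hi]; simp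
    · exact mul_nonneg hb (by linarith [hx.1 hi])
  have hzero : ∀ x ∈ σ ∩ S.halfSpace ℓ i, ((m' + a • ℓ + b • (-ℓ)) (S.ι x) = 0 ↔
      m' (S.ι x) = 0 ∧ a * ℓ (S.ι x) = 0 ∧ b * (-ℓ (S.ι x)) = 0) := by
    intro x hx
    rw [hval]
    have := hnn x hx.1
    have := h1 x hx.2
    have := h2 x hx.2
    refine ⟨fun h => ⟨by linarith, by linarith, by linarith⟩, fun h => by linarith⟩
  -- If ±ℓ does not occur in m, the zero locus is a face of σ inside the same half-space; if it
  -- occurs, the zero locus lies in the hyperplane.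
  by_cases hab : a = 0 ∧ b = 0
  · refine ⟨_, isFace_mem hσ hF, i, ?_⟩
    ext x
    constructor
    · rintro ⟨hx, h⟩
      exact ⟨⟨hx.1, ((hzero x hx).1 h).1⟩, hx.2⟩
    · rintro ⟨⟨hx, h⟩, hi⟩
      exact ⟨⟨hx, hi⟩, (hzero x ⟨hx, hi⟩).2 ⟨h, by rw [hab.1]; simp, by rw [hab.2]; simp⟩⟩
  · refine ⟨_, isFace_mem hσ hF, 0, ?_⟩
    ext x
    constructor
    · rintro ⟨hx, h⟩
      obtain ⟨z1, z2, z3⟩ := (hzero x hx).1 h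
      have h0 : ℓ (S.ι x) = 0 := by
        by_contra hne
        refine hab ⟨(mul_eq_zero.1 z2).resolve_right hne, (mul_eq_zero.1 z3).resolve_right ?_⟩
        simpa using hne
      exact ⟨⟨hx.1, z1⟩, fun _ => h0.le, fun _ => h0.ge⟩
    · rintro ⟨⟨hx, h⟩, hi⟩
      have h0 : ℓ (S.ι x) = 0 := le_antisymm (hi.1 (by decide)) (hi.2 (by decide))
      have hmem : x ∈ S.halfSpace ℓ i := ⟨fun _ => h0.le, fun _ => h0.ge⟩
      exact ⟨⟨hx, hmem⟩, (hzero x ⟨hx, hmem⟩).2 ⟨h, by rw [h0]; simp, by rw [h0]; simp⟩⟩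

/-- Supplies the common faces for the intersection axiom of `cut`. Two different members of {≤ 0, =
0, ≥ 0} meet in the hyperplane; adding to the functional of F a multiple of ℓ that is nonnegative on
the half-space cuts this out. -/
lemma isFaceOf_inter_halfSpace (hP : S.Good P) {F : Set X} (hσ : σ ∈ P.cones) (hF : P.IsFace F σ)
    (ℓ : Module.Dual ℝ N) (i j : SignType) :
    IsFaceOf (σ ∩ S.halfSpace ℓ i) (S.linOn (σ ∩ S.halfSpace ℓ i))
      (F ∩ (S.halfSpace ℓ i ∩ S.halfSpace ℓ j)) := by
  obtain ⟨m, hm, rfl⟩ := (hP.isFace_iff hσ).1 hF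
  rw [isFaceOf_linOn]
  by_cases hij : i = j
  · subst hij
    refine ⟨m, fun x hx => hm x hx.1, ?_⟩
    ext x
    simp only [Set.inter_self, Set.mem_inter_iff, Set.mem_ofPred_eq]
    tauto
  · -- here the intersection of the two half-spaces is the hyperplane
    have h0 : ∀ x, x ∈ S.halfSpace ℓ i ∩ S.halfSpace ℓ j ↔ ℓ (S.ι x) = 0 := by
      intro x
      have key : ∀ i j : SignType, i ≠ j → (i ≠ 1 ∨ j ≠ 1) ∧ (i ≠ -1 ∨ j ≠ -1) := by decide
      obtain ⟨k1, k2⟩ := key i j hij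
      constructor
      · rintro ⟨h1, h2⟩
        exact le_antisymm (k1.elim h1.1 h2.1) (k2.elim h1.2 h2.2)
      · intro h
        exact ⟨⟨fun _ => h.le, fun _ => h.ge⟩, ⟨fun _ => h.le, fun _ => h.ge⟩⟩
    have hs : ∃ ε : ℝ, ε ≠ 0 ∧ ∀ x ∈ S.halfSpace ℓ i, 0 ≤ ε * ℓ (S.ι x) := by
      by_cases hi : i = 1
      · exact ⟨1, one_ne_zero, fun x hx => by
          rw [one_mul]; exact hx.2 (by rw [hi]; decide)⟩
      · exact ⟨-1, by norm_num, fun x hx => by linarith [hx.1 hi]⟩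
    obtain ⟨ε, hε, hnn⟩ := hs
    refine ⟨m + ε • ℓ, fun x hx => ?_, ?_⟩
    · exact add_nonneg (hm x hx.1) (hnn x hx.2)
    · ext x
      constructor
      · rintro ⟨⟨hx, hmx⟩, h⟩
        refine ⟨⟨hx, h.1⟩, ?_⟩
        rw [LinearMap.add_apply, LinearMap.smul_apply, hmx, (h0 x).1 h]
        simp
      · rintro ⟨⟨hx, hi⟩, h⟩
        have e1 := hm x hx
        have e2 := hnn x hi
        rw [LinearMap.add_apply, LinearMap.smul_apply, smul_eq_mul] at h
        refine ⟨⟨hx, by linarith⟩, (h0 x).2 ?_⟩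
        exact (mul_eq_zero.1 (show ε * ℓ (S.ι x) = 0 by linarith)).resolve_left hε

lemma exists_hull_inter_halfSpace (hP : S.Good P) (hσ : σ ∈ P.cones) (ℓ : Module.Dual ℝ N)
    (i : SignType) : ∃ G : Finset N, ∀ v, v ∈ S.ι '' (σ ∩ S.halfSpace ℓ i) ↔
      v ∈ PointedCone.hull ℝ (G : Set N) := by
  classical
  obtain ⟨Λ, hΛ⟩ := hP.exists_ineq hσ
  obtain ⟨G, hG⟩ := exists_finset_hull_of_dual (Λ ∪ (halfSpaceIneq ℓ i).toFinset)
  refine ⟨G, fun v => ?_⟩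
  rw [← hG]
  constructor
  · rintro ⟨x, ⟨hx, hi⟩, rfl⟩ l hl
    rcases Finset.mem_union.1 hl with hl | hl
    · exact (hΛ _).1 ⟨x, hx, rfl⟩ l hl
    · exact mem_halfSpace_iff.1 hi l (List.mem_toFinset.1 hl)
  · intro h
    obtain ⟨x, hx, rfl⟩ := (hΛ v).2 fun l hl => h l (Finset.mem_union_left _ hl)
    exact ⟨x, ⟨hx, mem_halfSpace_iff.2 fun l hl =>
      h l (Finset.mem_union_right _ (List.mem_toFinset.2 hl))⟩, rfl⟩

open Classical in
/-- The subdivision of a complex by a hyperplane. -/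
def cut (hP : S.Good P) (ℓ : Module.Dual ℝ N) : ConicalComplex X where
  cones := (P.cones ×ˢ Finset.univ).image fun p => p.1 ∩ S.halfSpace ℓ p.2
  lin := S.linOn
  isClosed := by
    intro σ hσ
    simp only [Finset.mem_image, Finset.mem_product, Finset.mem_univ, and_true, Prod.exists] at hσ
    obtain ⟨ρ, i, hρ, rfl⟩ := hσ
    refine (P.isClosed ρ hρ).inter ?_
    have hc : Continuous fun x => ℓ (S.ι x) :=
      (LinearMap.continuous_of_finiteDimensional ℓ).comp hP.continuous_ι
    have : S.halfSpace ℓ i = {x | i ≠ 1 → ℓ (S.ι x) ≤ 0} ∩ {x | i ≠ -1 → 0 ≤ ℓ (S.ι x)} := rfl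
    rw [this]
    refine IsClosed.inter ?_ ?_
    · by_cases h : i = 1
      · simp [h]
      · simpa [h] using isClosed_le hc continuous_const
    · by_cases h : i = -1
      · simp [h]
      · simpa [h] using isClosed_le continuous_const hc
  cover := by
    rw [Set.eq_univ_iff_forall]
    intro x
    have : x ∈ ⋃₀ (P.cones : Set (Set X)) := P.cover ▸ Set.mem_univ x
    obtain ⟨σ, hσ, hx⟩ := this
    obtain ⟨i, hi⟩ := exists_mem_halfSpace (S := S) ℓ x
    exact ⟨σ ∩ S.halfSpace ℓ i, by
      simp only [Finset.coe_image]
      exact ⟨(σ, i), by simpa using hσ, rfl⟩, hx, hi⟩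
  finiteDimensional := by
    intro σ _
    unfold linOn
    infer_instance
  continuous_lin := by
    intro σ hσ u hu
    obtain ⟨l, hl⟩ := mem_linOn.1 hu
    have : Continuous fun x : σ => l (S.ι x) :=
      (LinearMap.continuous_of_finiteDimensional l).comp
        (hP.continuous_ι.comp continuous_subtype_val)
    convert this using 2 with x
    exact (hl x).symm
  isEmbedding := by
    intro σ hσ
    simp only [Finset.mem_image, Finset.mem_product, Finset.mem_univ, and_true, Prod.exists] at hσ
    obtain ⟨ρ, i, hρ, rfl⟩ := hσ
    refine isEmbedding_coneEval_linOn ?_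
    exact (hP.isEmbedding hρ).comp (IsEmbedding.inclusion Set.inter_subset_left)
  polyhedral := by
    intro σ hσ
    simp only [Finset.mem_image, Finset.mem_product, Finset.mem_univ, and_true, Prod.exists] at hσ
    obtain ⟨ρ, i, hρ, rfl⟩ := hσ
    obtain ⟨G, hG⟩ := hP.exists_hull_inter_halfSpace hρ ℓ i
    exact polyhedral_linOn hG fun x hx y hy h => hP.eq_zero_of_eq_neg hρ hx.1 hy.1 h
  face_mem := by
    intro σ hσ F hF
    simp only [Finset.mem_image, Finset.mem_product, Finset.mem_univ, and_true,
      Prod.exists] at hσ ⊢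
    obtain ⟨ρ, i, hρ, rfl⟩ := hσ
    obtain ⟨m, hm, rfl⟩ := isFaceOf_linOn.1 hF
    obtain ⟨F, hF, j, h⟩ := hP.exists_face_inter_halfSpace hρ hm
    exact ⟨F, j, hF, h.symm⟩
  face_lin := by
    intro σ hσ F hF h
    ext u
    rw [mem_linOn, Submodule.mem_map]
    constructor
    · rintro ⟨l, hl⟩
      refine ⟨fun x => l (S.ι x), mem_linOn.2 ⟨l, fun _ => rfl⟩, ?_⟩
      ext x
      exact hl x
    · rintro ⟨w, hw, rfl⟩
      obtain ⟨l, hl⟩ := mem_linOn.1 hw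
      exact ⟨l, fun x => hl ⟨x.1, h x.2⟩⟩
  inter := by
    intro σ hσ σ' hσ'
    simp only [Finset.mem_image, Finset.mem_product, Finset.mem_univ, and_true,
      Prod.exists] at hσ hσ'
    obtain ⟨ρ, i, hρ, rfl⟩ := hσ
    obtain ⟨ρ', i', hρ', rfl⟩ := hσ'
    obtain ⟨𝓕, h𝓕, he⟩ := P.inter ρ hρ ρ' hρ'
    refine ⟨(fun F => F ∩ (S.halfSpace ℓ i ∩ S.halfSpace ℓ i')) '' 𝓕, ?_, ?_⟩
    · rintro _ ⟨F, hF, rfl⟩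
      refine ⟨hP.isFaceOf_inter_halfSpace hρ (h𝓕 F hF).1 ℓ i i', ?_⟩
      dsimp only
      rw [Set.inter_comm (S.halfSpace ℓ i)]
      exact hP.isFaceOf_inter_halfSpace hρ' (h𝓕 F hF).2 ℓ i' i
    · rw [Set.inter_inter_inter_comm, he, Set.sUnion_image, Set.sUnion_eq_biUnion,
        Set.iUnion₂_inter]

lemma mem_cut_cones (hP : S.Good P) (ℓ : Module.Dual ℝ N) : σ ∈ (hP.cut ℓ).cones ↔
    ∃ ρ ∈ P.cones, ∃ i, σ = ρ ∩ S.halfSpace ℓ i := by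
  simp only [cut, Finset.mem_image, Finset.mem_product, Finset.mem_univ, and_true, Prod.exists]
  constructor
  · rintro ⟨ρ, i, hρ, rfl⟩; exact ⟨ρ, hρ, i, rfl⟩
  · rintro ⟨ρ, hρ, i, rfl⟩; exact ⟨ρ, i, hρ, rfl⟩

lemma cut_isSubdivision (hP : S.Good P) (ℓ : Module.Dual ℝ N) :
    (hP.cut ℓ).IsSubdivision P := by
  intro σ hσ
  obtain ⟨ρ, hρ, i, rfl⟩ := (hP.mem_cut_cones ℓ).1 hσ
  refine ⟨ρ, hρ, Set.inter_subset_left, fun u hu => ?_⟩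
  obtain ⟨l, hl⟩ := (hP.mem_lin_iff hρ).1 hu
  exact mem_linOn.2 ⟨l, fun x => (hl ⟨x.1, _⟩).symm⟩

end Good

/-! ### Common subdivisions and piecewise linear functions -/

lemma _root_.ConicalComplex.IsSubdivision.refl (P : ConicalComplex X) : P.IsSubdivision P :=
  fun σ hσ => ⟨σ, hσ, subset_rfl, fun _ hu => hu⟩

lemma _root_.ConicalComplex.IsSubdivision.trans {P Q R : ConicalComplex X}
    (h1 : R.IsSubdivision Q) (h2 : Q.IsSubdivision P) : R.IsSubdivision P := by
  intro σ hσ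
  obtain ⟨τ, hτ, hs, hl⟩ := h1 σ hσ
  obtain ⟨ρ, hρ, hs', hl'⟩ := h2 τ hτ
  exact ⟨ρ, hρ, hs.trans hs', fun u hu => hl _ (hl' u hu)⟩

lemma _root_.ConicalComplex.IsPL.of_isSubdivision {P Q : ConicalComplex X} {φ : X → ℝ}
    (h : P.IsPL φ) (hQ : Q.IsSubdivision P) : Q.IsPL φ := by
  intro σ hσ
  obtain ⟨τ, hτ, hs, hl⟩ := hQ σ hσ
  exact hl _ (h τ hτ)

/-- The functional has constant weak sign on every cone of the complex. -/
def SignConst (S : EuclideanConicalSpace X N) (P : ConicalComplex X) (ℓ : Module.Dual ℝ N) :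
    Prop := ∀ σ ∈ P.cones, (∀ x ∈ σ, 0 ≤ ℓ (S.ι x)) ∨ ∀ x ∈ σ, ℓ (S.ι x) ≤ 0

lemma SignConst.of_isSubdivision {Q : ConicalComplex X} {ℓ : Module.Dual ℝ N}
    (h : S.SignConst P ℓ) (hQ : Q.IsSubdivision P) : S.SignConst Q ℓ := by
  intro σ hσ
  obtain ⟨τ, hτ, hs, -⟩ := hQ σ hσ
  exact (h τ hτ).imp (fun h x hx => h x (hs hx)) (fun h x hx => h x (hs hx))

lemma Good.signConst_cut (hP : S.Good P) (ℓ : Module.Dual ℝ N) : S.SignConst (hP.cut ℓ) ℓ := by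
  intro σ hσ
  obtain ⟨ρ, hρ, i, rfl⟩ := (hP.mem_cut_cones ℓ).1 hσ
  by_cases hi : i = 1
  · exact Or.inl fun x hx => hx.2.2 (by rw [hi]; decide)
  · exact Or.inr fun x hx => hx.2.1 hi

lemma Good.exists_signConst (hP : S.Good P) (Λ : Finset (Module.Dual ℝ N)) :
    ∃ Q : ConicalComplex X, Q.IsSubdivision P ∧ ∀ ℓ ∈ Λ, S.SignConst Q ℓ := by
  classical
  induction Λ using Finset.induction_on with
  | empty => exact ⟨P, .refl P, by simp⟩
  | insert ℓ Λ _ ih =>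
    obtain ⟨Q, hQ, h⟩ := ih
    have hG := hP.of_isSubdivision hQ
    refine ⟨hG.cut ℓ, (hG.cut_isSubdivision ℓ).trans hQ, fun m hm => ?_⟩
    rcases Finset.mem_insert.1 hm with rfl | hm
    · exact hG.signConst_cut m
    · exact (h m hm).of_isSubdivision (hG.cut_isSubdivision ℓ)

/-- Two subdivisions of a complex have a common subdivision. -/
lemma Good.exists_common_subdivision {P₁ P₂ : ConicalComplex X} (hP : S.Good P)
    (h₁ : P₁.IsSubdivision P) (h₂ : P₂.IsSubdivision P) :
    ∃ Q : ConicalComplex X, Q.IsSubdivision P₁ ∧ Q.IsSubdivision P₂ := by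
  classical
  have hP1 := hP.of_isSubdivision h₁
  have hP2 := hP.of_isSubdivision h₂
  choose! Λ hΛ using fun σ (hσ : σ ∈ P₂.cones) => hP2.exists_ineq hσ
  -- Cut P₁ with all inequalities defining cones of P₂. An inequality that holds at a relative
  -- interior point of a resulting cone then holds on the whole cone.
  obtain ⟨Q, hQ, hsign⟩ := hP1.exists_signConst (P₂.cones.biUnion Λ)
  refine ⟨Q, hQ, fun κ hκ => ?_⟩
  have hQG := hP1.of_isSubdivision hQ
  obtain ⟨x, hx⟩ := hQG.exists_inner hκ
  -- ι is injective only on single cones, so κ and σ are compared inside the cone ρ of P that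
  -- contains both.
  obtain ⟨ρ, hρ, hxρ⟩ := hP.exists_carrier x
  obtain ⟨σ, hσ, hxσ⟩ := hP2.exists_carrier x
  have hκρ := hP.subset_of_inner_of_isSubdivision (hQ.trans h₁) hκ hρ hx hxρ.1
  have hσρ := hP.subset_of_inner_of_isSubdivision h₂ hσ hρ hxσ hxρ.1
  have hsub : κ ⊆ σ := by
    intro y hy
    have : S.ι y ∈ S.ι '' σ := by
      refine (hΛ σ hσ _).2 fun ℓ hℓ => ?_
      have hsx : 0 ≤ ℓ (S.ι x) := (hΛ σ hσ _).1 ⟨x, hxσ.1, rfl⟩ ℓ hℓ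
      rcases hsign ℓ (Finset.mem_biUnion.2 ⟨σ, hσ, hℓ⟩) κ hκ with h | h
      · exact h y hy
      · have h0 : ℓ (S.ι x) = 0 := le_antisymm (h x hx.1) hsx
        have := hx.2 (-ℓ) (fun z hz => by simpa using h z hz) (by simp [h0]) y hy
        simp only [LinearMap.neg_apply, neg_eq_zero] at this
        exact this.ge
    obtain ⟨z, hz, hzy⟩ := this
    rw [← hP.2 ρ hρ (hσρ hz) (hκρ hy) hzy]
    exact hz
  refine ⟨σ, hσ, hsub, fun u hu => ?_⟩
  obtain ⟨l, hl⟩ := (hP2.mem_lin_iff hσ).1 hu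
  exact (hQG.mem_lin_iff hκ).2 ⟨l, fun y => hl _⟩

/-- The complexes that subdivide the given one. -/
lemma mem_complexes_of_isSubdivision (h : P.IsSubdivision S.complex) : P ∈ S.complexes :=
  have hG := S.good_complex.of_isSubdivision h
  ⟨⟨P, .refl P, h⟩, hG.1, hG.2⟩

lemma exists_isPL_of_mem_PL {φ : X → ℝ} (h : φ ∈ S.PL) :
    ∃ P : ConicalComplex X, P.IsSubdivision S.complex ∧ P.IsPL φ := by
  obtain ⟨P, ⟨⟨Q, hQ, hQ'⟩, -⟩, hφ⟩ := h
  exact ⟨Q, hQ', hφ.of_isSubdivision hQ⟩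

lemma mem_PL_iff {φ : X → ℝ} :
    φ ∈ S.PL ↔ ∃ P : ConicalComplex X, P.IsSubdivision S.complex ∧ P.IsPL φ :=
  ⟨exists_isPL_of_mem_PL, fun ⟨P, h, hφ⟩ => ⟨P, mem_complexes_of_isSubdivision h, hφ⟩⟩

lemma exists_isPL_of_list {L : List (X → ℝ)} (h : ∀ φ ∈ L, φ ∈ S.PL) :
    ∃ P : ConicalComplex X, P.IsSubdivision S.complex ∧ ∀ φ ∈ L, P.IsPL φ := by
  induction L with
  | nil => exact ⟨S.complex, .refl _, by simp⟩
  | cons φ L ih =>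
    obtain ⟨P, hP, hL⟩ := ih fun φ hφ => h φ (List.mem_cons_of_mem _ hφ)
    obtain ⟨P', hP', hφ⟩ := exists_isPL_of_mem_PL (h φ List.mem_cons_self)
    obtain ⟨Q, hQ, hQ'⟩ := S.good_complex.exists_common_subdivision hP hP'
    refine ⟨Q, hQ.trans hP, fun ψ hψ => ?_⟩
    rcases List.mem_cons.1 hψ with rfl | hψ
    · exact hφ.of_isSubdivision hQ'
    · exact (hL ψ hψ).of_isSubdivision hQ

end EuclideanConicalSpace

/-! ### Normal vectors -/

namespace EuclideanConicalSpace

variable {X N : Type*} [TopologicalSpace X] [NormedAddCommGroup N] [InnerProductSpace ℝ N]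
  [FiniteDimensional ℝ N] {S : EuclideanConicalSpace X N} {P : ConicalComplex X}

local notation "⟪" x ", " y "⟫" => inner ℝ x y

/-- Orthogonal decomposition along a unit normal vector of a subspace of codimension one. -/
lemma _root_.Submodule.sub_inner_smul_mem {A B : Submodule ℝ N} (hAB : A ≤ B)
    (hd : Module.finrank ℝ B = Module.finrank ℝ A + 1) {v : N} (hv : v ∈ B) (h1 : ‖v‖ = 1)
    (horth : ∀ w ∈ A, ⟪v, w⟫ = 0) {w : N} (hw : w ∈ B) : w - ⟪v, w⟫ • v ∈ A := by
  have hvv : ⟪v, v⟫ = 1 := by rw [real_inner_self_eq_norm_sq, h1]; norm_num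
  have hvA : v ∉ A := fun h => by
    have := horth v h
    rw [hvv] at this
    exact one_ne_zero this
  have hlt : A < A ⊔ Submodule.span ℝ {v} := by
    refine lt_of_le_of_ne le_sup_left fun h => hvA ?_
    rw [h]
    exact Submodule.mem_sup_right (Submodule.mem_span_singleton_self v)
  have hle : A ⊔ Submodule.span ℝ {v} ≤ B :=
    sup_le hAB ((Submodule.span_singleton_le_iff_mem v B).2 hv)
  have hfin := Submodule.finrank_lt_finrank_of_lt hlt
  have heq := Submodule.eq_of_le_of_finrank_le hle (by omega)
  rw [← heq, Submodule.mem_sup] at hw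
  obtain ⟨a, ha, b, hb, rfl⟩ := hw
  obtain ⟨c, rfl⟩ := Submodule.mem_span_singleton.1 hb
  rw [inner_add_right, horth a ha, inner_smul_right, hvv]
  simpa using ha

namespace Good

variable {σ τ ρ : Set X}

lemma finrank_spanOf (hP : S.Good P) (hσ : σ ∈ P.cones) (hτ : τ ∈ P.cones)
    (hd : P.dim σ = P.dim τ + 1) :
    Module.finrank ℝ (S.spanOf σ) = Module.finrank ℝ (S.spanOf τ) + 1 := by
  rw [← hP.dim_eq hσ, ← hP.dim_eq hτ, hd]

/-- The orthogonal complement of the span of τ in the span of σ is a line. On σ, the functional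
cutting out τ is a nonzero multiple of the coordinate along this line, and its sign selects the unit
vector. -/
lemma exists_isNormalVector (hP : S.Good P) (hσ : σ ∈ P.cones) (hτ : τ ∈ P.cones) (hs : τ ⊆ σ)
    (hd : P.dim σ = P.dim τ + 1) : ∃ v, S.IsNormalVector σ τ v := by
  have hfin := hP.finrank_spanOf hσ hτ hd
  have hle := spanOf_mono (S := S) hs
  have h1 : Module.finrank ℝ ((S.spanOf τ)ᗮ ⊓ S.spanOf σ : Submodule ℝ N) = 1 := by
    have := Submodule.finrank_add_inf_finrank_orthogonal hle
    omega
  have hne : ((S.spanOf τ)ᗮ ⊓ S.spanOf σ : Submodule ℝ N) ≠ ⊥ := by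
    intro h
    rw [h, finrank_bot] at h1
    exact zero_ne_one h1
  obtain ⟨v₀, hv₀, hne₀⟩ := Submodule.exists_mem_ne_zero_of_ne_bot hne
  have hv₀σ := hv₀.2
  have hv₀τ : ∀ w ∈ S.spanOf τ, ⟪v₀, w⟫ = 0 := fun w hw =>
    Submodule.inner_left_of_mem_orthogonal hw hv₀.1
  set v := (‖v₀‖⁻¹ : ℝ) • v₀ with hv
  have hv1 : ‖v‖ = 1 := by
    rw [hv, norm_smul, norm_inv, norm_norm, inv_mul_cancel₀ (norm_ne_zero_iff.2 hne₀)]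
  have hvσ : v ∈ S.spanOf σ := Submodule.smul_mem _ _ hv₀σ
  have hvτ : ∀ w ∈ S.spanOf τ, ⟪v, w⟫ = 0 := fun w hw => by
    rw [hv, real_inner_smul_left, hv₀τ w hw, mul_zero]
  obtain ⟨ℓ, h0, he⟩ := (hP.isFace_iff hσ).1 ((hP.isFace_iff_subset hσ).2 ⟨hτ, hs⟩)
  have hℓ : ∀ x ∈ σ, ℓ (S.ι x) = ⟪v, S.ι x⟫ * ℓ v := by
    intro x hx
    have := Submodule.sub_inner_smul_mem hle hfin hvσ hv1 hvτ (mem_spanOf hx)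
    have h2 := eq_zero_of_mem_spanOf (σ := τ) (ℓ := ℓ) (fun y hy => by
      rw [he] at hy; exact hy.2) this
    rw [map_sub, map_smul, sub_eq_zero] at h2
    exact h2
  have hne' : ℓ v ≠ 0 := by
    intro h
    have : τ = σ := by
      rw [he]
      ext x
      exact ⟨fun h => h.1, fun hx => ⟨hx, by rw [hℓ x hx, h, mul_zero]⟩⟩
    rw [this] at hd
    omega
  rcases lt_or_gt_of_ne hne' with h | h
  · refine ⟨-v, Submodule.neg_mem _ hvσ, by rw [norm_neg, hv1], fun w hw => by
      rw [inner_neg_left, hvτ w hw, neg_zero], fun x hx => ?_⟩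
    rw [inner_neg_left]
    have := h0 x hx
    rw [hℓ x hx] at this
    nlinarith
  · refine ⟨v, hvσ, hv1, hvτ, fun x hx => ?_⟩
    have := h0 x hx
    rw [hℓ x hx] at this
    nlinarith

end Good

variable {σ τ ρ : Set X}

/-- Two candidates differ by a sign; opposite ones would force the normal coordinate to vanish on σ.
-/
lemma IsNormalVector.unique {v w : N} (hfin : Module.finrank ℝ (S.spanOf σ) =
    Module.finrank ℝ (S.spanOf τ) + 1) (hs : τ ⊆ σ) (hv : S.IsNormalVector σ τ v)
    (hw : S.IsNormalVector σ τ w) : w = v := by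
  obtain ⟨v1, v2, v3, v4⟩ := hv
  obtain ⟨w1, w2, w3, w4⟩ := hw
  have h := Submodule.sub_inner_smul_mem (spanOf_mono hs) hfin v1 v2 v3 w1
  have hz : w - ⟪v, w⟫ • v = 0 := by
    rw [← inner_self_eq_zero (𝕜 := ℝ)]
    conv_lhs => rw [inner_sub_left]
    rw [w3 _ h, real_inner_smul_left, v3 _ h]
    simp
  rw [sub_eq_zero] at hz
  have habs : |⟪v, w⟫| = 1 := by
    have := congrArg norm hz
    rwa [norm_smul, w2, v2, mul_one, Real.norm_eq_abs, eq_comm] at this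
  rcases (abs_eq zero_le_one).1 habs with h1 | h1
  · rw [hz, h1, one_smul]
  · exfalso
    have hzero : ∀ x ∈ σ, innerₛₗ ℝ v (S.ι x) = 0 := by
      intro x hx
      have e1 := v4 x hx
      have e2 := w4 x hx
      rw [hz, h1, neg_one_smul, inner_neg_left] at e2
      exact le_antisymm (by simpa using e2) e1
    have := eq_zero_of_mem_spanOf hzero v1
    rw [innerₛₗ_apply_apply, inner_self_eq_zero] at this
    rw [this, norm_zero] at v2
    exact zero_ne_one v2

namespace Good

lemma normalVector_eq (hP : S.Good P) (hσ : σ ∈ P.cones) (hτ : τ ∈ P.cones) (hs : τ ⊆ σ)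
    (hd : P.dim σ = P.dim τ + 1) {v : N} (hv : S.IsNormalVector σ τ v) :
    S.normalVector σ τ = v :=
  hv.unique (hP.finrank_spanOf hσ hτ hd) hs (Classical.epsilon_spec ⟨v, hv⟩)

lemma isNormalVector (hP : S.Good P) (hσ : σ ∈ P.cones) (hτ : τ ∈ P.cones) (hs : τ ⊆ σ)
    (hd : P.dim σ = P.dim τ + 1) : S.IsNormalVector σ τ (S.normalVector σ τ) :=
  Classical.epsilon_spec (hP.exists_isNormalVector hσ hτ hs hd)

lemma sub_inner_smul_mem (hP : S.Good P) (hσ : σ ∈ P.cones) (hτ : τ ∈ P.cones) (hs : τ ⊆ σ)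
    (hd : P.dim σ = P.dim τ + 1) {w : N} (hw : w ∈ S.spanOf σ) :
    w - ⟪S.normalVector σ τ, w⟫ • S.normalVector σ τ ∈ S.spanOf τ := by
  obtain ⟨h1, h2, h3, -⟩ := hP.isNormalVector hσ hτ hs hd
  exact Submodule.sub_inner_smul_mem (spanOf_mono hs) (hP.finrank_spanOf hσ hτ hd) h1 h2 h3 hw

lemma inner_normalVector_pos (hP : S.Good P) (hσ : σ ∈ P.cones) (hτ : τ ∈ P.cones) (hs : τ ⊆ σ)
    (hd : P.dim σ = P.dim τ + 1) {x : X} (hx : x ∈ σ) (hxτ : x ∉ τ) :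
    0 < ⟪S.normalVector σ τ, S.ι x⟫ := by
  refine lt_of_le_of_ne ((hP.isNormalVector hσ hτ hs hd).2.2.2 x hx) fun h => hxτ ?_
  have hmem := hP.sub_inner_smul_mem hσ hτ hs hd (mem_spanOf hx)
  rw [← h, zero_smul, sub_zero] at hmem
  obtain ⟨ℓ, h0, he⟩ := (hP.isFace_iff hσ).1 ((hP.isFace_iff_subset hσ).2 ⟨hτ, hs⟩)
  have := eq_zero_of_mem_spanOf (σ := τ) (ℓ := ℓ) (fun y hy => by
      rw [he] at hy; exact hy.2) hmem
  rw [he]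
  exact ⟨hx, this⟩

/-- The relation between the normal vectors along two different facets of a cone that share a face
of codimension two. -/
lemma normalVector_relation (hP : S.Good P) {τ₁ τ₂ : Set X} (hσ : σ ∈ P.cones)
    (hρ : ρ ∈ P.cones) (hτ₁ : τ₁ ∈ P.cones) (hτ₂ : τ₂ ∈ P.cones) (h₁ : ρ ⊆ τ₁) (h₂ : ρ ⊆ τ₂)
    (h₁' : τ₁ ⊆ σ) (h₂' : τ₂ ⊆ σ) (hd₁ : P.dim τ₁ = P.dim ρ + 1) (hd₂ : P.dim τ₂ = P.dim ρ + 1)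
    (hd : P.dim σ = P.dim ρ + 2) (hne : τ₁ ≠ τ₂) :
    ∃ β > 0, β ^ 2 = 1 - ⟪S.normalVector τ₁ ρ, S.normalVector τ₂ ρ⟫ ^ 2 ∧
      S.normalVector τ₂ ρ = ⟪S.normalVector τ₁ ρ, S.normalVector τ₂ ρ⟫ • S.normalVector τ₁ ρ +
        β • S.normalVector σ τ₁ := by
  have hdσ : P.dim σ = P.dim τ₁ + 1 := by omega
  obtain ⟨u1a, u1b, u1c, u1d⟩ := hP.isNormalVector hτ₁ hρ h₁ hd₁
  obtain ⟨u2a, u2b, u2c, u2d⟩ := hP.isNormalVector hτ₂ hρ h₂ hd₂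
  obtain ⟨w1a, w1b, w1c, w1d⟩ := hP.isNormalVector hσ hτ₁ h₁' hdσ
  have hm1 := hP.sub_inner_smul_mem hσ hτ₁ h₁' hdσ (spanOf_mono h₂' u2a)
  have hm2 := hP.sub_inner_smul_mem hτ₁ hρ h₁ hd₁ hm1
  have hu1w1 := w1c _ u1a
  have hpos : ∃ x ∈ τ₂, x ∉ τ₁ := by
    by_contra! h
    exact hne (hP.eq_of_subset_of_dim_le hτ₁ hτ₂ h (by omega)).symm
  obtain ⟨x, hx, hx'⟩ := hpos
  have hwx := hP.inner_normalVector_pos hσ hτ₁ h₁' hdσ (h₂' hx) hx'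
  have hxm := hP.sub_inner_smul_mem hτ₂ hρ h₂ hd₂ (mem_spanOf hx)
  have hux := u2d x hx
  set u1 := S.normalVector τ₁ ρ
  set u2 := S.normalVector τ₂ ρ
  set w1 := S.normalVector σ τ₁
  rw [inner_sub_right, real_inner_smul_right, real_inner_comm, real_inner_comm, real_inner_comm]
    at hm2
  have e0 : ⟪u1, w1⟫ = 0 := by rw [real_inner_comm]; exact hu1w1
  -- This vector lies in the span of ρ and is a combination of three vectors orthogonal to that
  -- span.
  have hz : u2 - ⟪w1, u2⟫ • w1 - ⟪u1, u2⟫ • u1 = 0 := by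
    have hm3 : u2 - ⟪w1, u2⟫ • w1 - ⟪u1, u2⟫ • u1 ∈ S.spanOf ρ := by
      convert hm2 using 3
      rw [real_inner_comm, real_inner_comm, real_inner_comm]
      simp [real_inner_comm, e0]
    rw [← inner_self_eq_zero (𝕜 := ℝ)]
    have a1 := u2c _ hm3
    have a2 := u1c _ hm3
    have a3 := w1c _ (spanOf_mono h₁ hm3)
    conv_lhs => rw [inner_sub_left, inner_sub_left, real_inner_smul_left, real_inner_smul_left]
    rw [a1, a2, a3]; simp
  have heq : u2 = ⟪u1, u2⟫ • u1 + ⟪w1, u2⟫ • w1 := by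
    have : u2 = (u2 - ⟪w1, u2⟫ • w1 - ⟪u1, u2⟫ • u1) + (⟪u1, u2⟫ • u1 + ⟪w1, u2⟫ • w1) := by abel
    rw [hz, zero_add] at this
    exact this
  -- A point of τ₂ outside τ₁ has positive w1-coordinate and is, modulo the span of ρ, a nonnegative
  -- multiple of u2.
  have hβ : 0 < ⟪w1, u2⟫ := by
    have h4 := w1c _ (spanOf_mono h₁ hxm)
    rw [inner_sub_right, real_inner_smul_right, sub_eq_zero] at h4
    rw [h4] at hwx
    by_contra hcon
    nlinarith
  refine ⟨⟪w1, u2⟫, hβ, ?_, heq⟩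
  have h1 : ⟪u2, u2⟫ = 1 := by rw [real_inner_self_eq_norm_sq, u2b]; norm_num
  have h2 : ⟪u2, u2⟫ = ⟪u1, u2⟫ * ⟪u1, u2⟫ + ⟪w1, u2⟫ * ⟪w1, u2⟫ := by
    conv_lhs => rw [heq]
    rw [inner_add_left, real_inner_smul_left, real_inner_smul_left, ← heq]
  rw [h1] at h2
  linarith [h2, sq ⟪u1, u2⟫, sq ⟪w1, u2⟫]

end Good

end EuclideanConicalSpace

/-! ### The two facets between a cone and a face of codimension two -/

namespace EuclideanConicalSpace

variable {X N : Type*} [TopologicalSpace X] [NormedAddCommGroup N] [InnerProductSpace ℝ N]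
  [FiniteDimensional ℝ N] {S : EuclideanConicalSpace X N} {P : ConicalComplex X}
  {σ τ ρ : Set X}

local notation "⟪" x ", " y "⟫" => inner ℝ x y

namespace Good

/-- A cone has two different facets containing a given face of codimension two. -/
lemma exists_two_facets (hP : S.Good P) (hσ : σ ∈ P.cones) (hρ : ρ ∈ P.cones) (hs : ρ ⊆ σ)
    (hd : P.dim σ = P.dim ρ + 2) : ∃ τ₁ ∈ P.cones, ∃ τ₂ ∈ P.cones, τ₁ ≠ τ₂ ∧
      (ρ ⊆ τ₁ ∧ τ₁ ⊆ σ ∧ P.dim τ₁ = P.dim ρ + 1) ∧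
      (ρ ⊆ τ₂ ∧ τ₂ ⊆ σ ∧ P.dim τ₂ = P.dim ρ + 1) := by
  classical
  obtain ⟨ℓ, h0, he⟩ := (hP.isFace_iff hσ).1 ((hP.isFace_iff_subset hσ).2 ⟨hρ, hs⟩)
  obtain ⟨G, hG⟩ := hP.exists_hull hσ
  have hGσ : ∀ g ∈ G, ∃ x ∈ σ, S.ι x = g := fun g hg => (hG g).2 (Submodule.subset_span hg)
  have hGnn : ∀ g ∈ G, 0 ≤ ℓ g := by
    intro g hg
    obtain ⟨x, hx, rfl⟩ := hGσ g hg
    exact h0 x hx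
  have hext : ∀ m : Module.Dual ℝ N, (∀ g ∈ G, 0 ≤ m g) → ∀ x ∈ σ, 0 ≤ m (S.ι x) :=
    fun m hm x hx => nonneg_of_mem_hull ((hG _).1 ⟨x, hx, rfl⟩) m hm
  have hzero : ∀ m : Module.Dual ℝ N, (∀ g ∈ G, m g = 0) → ∀ x ∈ σ, m (S.ι x) = 0 :=
    fun m hm x hx => le_antisymm
      (by simpa using hext (-m) (fun g hg => by simp [hm g hg]) x hx)
      (hext m (fun g hg => (hm g hg).ge) x hx)
  have hne : ρ ≠ σ := by rintro rfl; omega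
  set G' := G.filter fun g => 0 < ℓ g with hG'
  have hG'ne : G'.Nonempty := by
    by_contra hcon
    rw [Finset.not_nonempty_iff_eq_empty] at hcon
    apply hne
    rw [he]
    ext x
    refine ⟨fun h => h.1, fun hx => ⟨hx, hzero ℓ (fun g hg => ?_) x hx⟩⟩
    by_contra h
    have : g ∈ G' := Finset.mem_filter.2 ⟨hg, lt_of_le_of_ne (hGnn g hg) (Ne.symm h)⟩
    rw [hcon] at this
    simp at this
  obtain ⟨g₀, hg₀⟩ := hG'ne
  -- Codimension two leaves room for a functional m that vanishes on ρ and on a generator g₀ outside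
  -- ρ but not on σ; it is independent of ℓ on σ.
  have hlt : Module.finrank ℝ (S.spanOf ρ ⊔ Submodule.span ℝ {g₀} : Submodule ℝ N) <
      Module.finrank ℝ (S.spanOf σ) := by
    have h1 := Submodule.finrank_add_le_finrank_add_finrank (S.spanOf ρ) (Submodule.span ℝ {g₀})
    have h2 := finrank_span_le_card (R := ℝ) ({g₀} : Set N)
    rw [Set.toFinset_singleton, Finset.card_singleton] at h2
    rw [← hP.dim_eq hσ]
    rw [← hP.dim_eq hρ] at h1
    omega
  obtain ⟨w, hw, hw'⟩ : ∃ w ∈ S.spanOf σ, w ∉ S.spanOf ρ ⊔ Submodule.span ℝ {g₀} := by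
    by_contra! h
    exact absurd (Submodule.finrank_mono h) (not_le.2 hlt)
  obtain ⟨m, hmw, hker⟩ := Submodule.exists_le_ker_of_notMem hw'
  have hmρ : ∀ x ∈ ρ, m (S.ι x) = 0 := fun x hx =>
    hker (Submodule.mem_sup_left (mem_spanOf hx))
  have hmg₀ : m g₀ = 0 := hker (Submodule.mem_sup_right (Submodule.mem_span_singleton_self _))
  have hmG : ∀ g ∈ G, g ∉ G' → ℓ g = 0 ∧ m g = 0 := by
    intro g hg hg'
    have hz : ℓ g = 0 := by
      by_contra h
      exact hg' (Finset.mem_filter.2 ⟨hg, lt_of_le_of_ne (hGnn g hg) (Ne.symm h)⟩)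
    refine ⟨hz, ?_⟩
    obtain ⟨x, hx, rfl⟩ := hGσ g hg
    exact hmρ x (by rw [he]; exact ⟨hx, hz⟩)
  -- The pencil m - s • ℓ consists of functionals vanishing on ρ. The least and the greatest ratio m
  -- / ℓ on generators outside ρ are the two values of s at which the turning hyperplane supports σ
  -- along a facet.
  obtain ⟨g₁, hg₁, hmin⟩ := Finset.exists_min_image G' (fun g => m g / ℓ g) ⟨g₀, hg₀⟩
  obtain ⟨g₂, hg₂, hmax⟩ := Finset.exists_max_image G' (fun g => m g / ℓ g) ⟨g₀, hg₀⟩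
  have hpos : ∀ g ∈ G', 0 < ℓ g := fun g hg => (Finset.mem_filter.1 hg).2
  have hG'G : ∀ g ∈ G', g ∈ G := fun g hg => (Finset.mem_filter.1 hg).1
  set s₁ := m g₁ / ℓ g₁ with hs₁
  set s₂ := m g₂ / ℓ g₂ with hs₂
  have hs12 : s₁ < s₂ := by
    have a1 : s₁ ≤ 0 := by have := hmin g₀ hg₀; simpa [hmg₀] using this
    have a2 : 0 ≤ s₂ := by have := hmax g₀ hg₀; simpa [hmg₀] using this
    by_contra hcon
    have b1 : s₁ = 0 := by linarith
    have b2 : s₂ = 0 := by linarith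
    apply hmw
    refine eq_zero_of_mem_spanOf (hzero m fun g hg => ?_) hw
    by_cases hg' : g ∈ G'
    · have c1 := hmin g hg'
      have c2 := hmax g hg'
      rw [b1] at c1
      rw [b2] at c2
      exact ((div_eq_zero_iff).1 (le_antisymm c2 c1)).resolve_right (hpos g hg').ne'
    · exact (hmG g hg hg').2
  have hf1 : ∀ g ∈ G, 0 ≤ (m - s₁ • ℓ) g := by
    intro g hg
    rw [LinearMap.sub_apply, LinearMap.smul_apply, smul_eq_mul]
    by_cases hg' : g ∈ G'
    · have := hmin g hg'
      rw [le_div_iff₀ (hpos g hg')] at this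
      linarith
    · rw [(hmG g hg hg').1, (hmG g hg hg').2]; simp
  have hf2 : ∀ g ∈ G, 0 ≤ (s₂ • ℓ - m) g := by
    intro g hg
    rw [LinearMap.sub_apply, LinearMap.smul_apply, smul_eq_mul]
    by_cases hg' : g ∈ G'
    · have := hmax g hg'
      rw [div_le_iff₀ (hpos g hg')] at this
      linarith
    · rw [(hmG g hg hg').1, (hmG g hg hg').2]; simp
  have e1 : m g₁ = s₁ * ℓ g₁ := by rw [hs₁, div_mul_cancel₀ _ (hpos g₁ hg₁).ne']
  have e2 : m g₂ = s₂ * ℓ g₂ := by rw [hs₂, div_mul_cancel₀ _ (hpos g₂ hg₂).ne']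
  have p1 := hpos g₁ hg₁
  have p2 := hpos g₂ hg₂
  -- a nonzero functional that vanishes on `ρ` and on a generator outside `ρ` defines a facet
  have key : ∀ f : Module.Dual ℝ N, (∀ g ∈ G, 0 ≤ f g) → (∀ x ∈ ρ, f (S.ι x) = 0) →
      ∀ g ∈ G', f g = 0 → (∃ g' ∈ G, f g' ≠ 0) →
      {x ∈ σ | f (S.ι x) = 0} ∈ P.cones ∧ ρ ⊆ {x ∈ σ | f (S.ι x) = 0} ∧
        P.dim {x ∈ σ | f (S.ι x) = 0} = P.dim ρ + 1 := by
    intro f hf hfρ g hg hfg ⟨g', hg', hne'⟩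
    have hmem : {x ∈ σ | f (S.ι x) = 0} ∈ P.cones :=
      isFace_mem hσ ((hP.isFace_iff hσ).2 ⟨f, hext f hf, rfl⟩)
    have hsub : ρ ⊆ {x ∈ σ | f (S.ι x) = 0} := fun x hx => ⟨hs hx, hfρ x hx⟩
    refine ⟨hmem, hsub, ?_⟩
    obtain ⟨y, hy, rfl⟩ := hGσ g (hG'G g hg)
    obtain ⟨y', hy', rfl⟩ := hGσ g' hg'
    have n1 : ¬ P.dim {x ∈ σ | f (S.ι x) = 0} ≤ P.dim ρ := by
      intro h
      have := hP.eq_of_subset_of_dim_le hmem hρ hsub h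
      have hyρ : y ∈ ρ := by rw [this]; exact ⟨hy, hfg⟩
      rw [he] at hyρ
      exact (hpos _ hg).ne' hyρ.2
    have n2 : ¬ P.dim σ ≤ P.dim {x ∈ σ | f (S.ι x) = 0} := by
      intro h
      have := hP.eq_of_subset_of_dim_le hσ hmem (fun x hx => hx.1) h
      rw [← this] at hy'
      exact hne' hy'.2
    omega
  have hρℓ : ∀ x ∈ ρ, ℓ (S.ι x) = 0 := fun x hx => by rw [he] at hx; exact hx.2
  obtain ⟨a1, a2, a3⟩ := key (m - s₁ • ℓ) hf1 (fun x hx => by simp [hmρ x hx, hρℓ x hx]) g₁ hg₁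
    (by simp [e1]) ⟨g₂, hG'G _ hg₂, by
      rw [LinearMap.sub_apply, LinearMap.smul_apply, smul_eq_mul, e2, ← sub_mul]
      exact (mul_pos (by linarith) p2).ne'⟩
  obtain ⟨b1, b2, b3⟩ := key (s₂ • ℓ - m) hf2 (fun x hx => by simp [hmρ x hx, hρℓ x hx]) g₂ hg₂
    (by simp [e2]) ⟨g₁, hG'G _ hg₁, by
      rw [LinearMap.sub_apply, LinearMap.smul_apply, smul_eq_mul, e1, ← sub_mul]
      exact (mul_pos (by linarith) p1).ne'⟩
  refine ⟨_, a1, _, b1, fun h => ?_, ⟨a2, fun x hx => hx.1, a3⟩, b2, fun x hx => hx.1, b3⟩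
  obtain ⟨y, hy, hyg⟩ := hGσ g₁ (hG'G _ hg₁)
  have : y ∈ {x ∈ σ | (m - s₁ • ℓ) (S.ι x) = 0} := ⟨hy, by rw [hyg]; simp [e1]⟩
  rw [h] at this
  have h3 := this.2
  rw [hyg, LinearMap.sub_apply, LinearMap.smul_apply, smul_eq_mul, e1, ← sub_mul] at h3
  exact (mul_pos (sub_pos.2 hs12) p1).ne' h3

/-- The facets of a cone that contain a face of codimension two, and the symmetry of the sum over
them of the tensor products of the normal vectors. -/
lemma exists_facets_pair (hP : S.Good P) (hσ : σ ∈ P.cones) (hρ : ρ ∈ P.cones) (hs : ρ ⊆ σ)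
    (hd : P.dim σ = P.dim ρ + 2) : ∃ τ₁ ∈ P.cones, ∃ τ₂ ∈ P.cones, τ₁ ≠ τ₂ ∧
      (∀ τ ∈ P.cones, (ρ ⊆ τ ∧ τ ⊆ σ ∧ P.dim τ = P.dim ρ + 1) ↔ (τ = τ₁ ∨ τ = τ₂)) ∧
      ∀ f g : Module.Dual ℝ N,
        f (S.normalVector τ₁ ρ) * g (S.normalVector σ τ₁) +
          f (S.normalVector τ₂ ρ) * g (S.normalVector σ τ₂) =
        g (S.normalVector τ₁ ρ) * f (S.normalVector σ τ₁) +
          g (S.normalVector τ₂ ρ) * f (S.normalVector σ τ₂) := by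
  obtain ⟨τ₁, hτ₁, τ₂, hτ₂, hne, ⟨h1, h1', hd1⟩, h2, h2', hd2⟩ := hP.exists_two_facets hσ hρ hs hd
  obtain ⟨β, hβ, hβ2, hrel⟩ := hP.normalVector_relation hσ hρ hτ₁ hτ₂ h1 h2 h1' h2' hd1 hd2 hd hne
  obtain ⟨γ, hγ, hγ2, hrel'⟩ :=
    hP.normalVector_relation hσ hρ hτ₂ hτ₁ h2 h1 h2' h1' hd2 hd1 hd hne.symm
  have hcomm : ⟪S.normalVector τ₂ ρ, S.normalVector τ₁ ρ⟫ =
    ⟪S.normalVector τ₁ ρ, S.normalVector τ₂ ρ⟫ := real_inner_comm _ _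
  rw [hcomm] at hγ2 hrel'
  -- Both are the positive sine of the angle between the normal vectors of the two facets relative
  -- to ρ.
  have hγβ : γ = β := by
    have : γ ^ 2 = β ^ 2 := by rw [hβ2, hγ2]
    exact (pow_left_inj₀ hγ.le hβ.le two_ne_zero).1 this
  rw [hγβ] at hrel'
  have hdσ1 : P.dim σ = P.dim τ₁ + 1 := by omega
  have hdσ2 : P.dim σ = P.dim τ₂ + 1 := by omega
  refine ⟨τ₁, hτ₁, τ₂, hτ₂, hne, fun τ hτ => ⟨fun ⟨hρτ, hτσ, hdτ⟩ => ?_, ?_⟩, fun f g => ?_⟩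
  · obtain ⟨t, ht⟩ := hP.exists_inner hτ
    have htσ := hτσ ht.1
    obtain ⟨u1a, u1b, u1c, u1d⟩ := hP.isNormalVector hτ₁ hρ h1 hd1
    obtain ⟨u2a, u2b, u2c, u2d⟩ := hP.isNormalVector hτ₂ hρ h2 hd2
    obtain ⟨w1a, w1b, w1c, w1d⟩ := hP.isNormalVector hσ hτ₁ h1' hdσ1
    obtain ⟨w2a, w2b, w2c, w2d⟩ := hP.isNormalVector hσ hτ₂ h2' hdσ2
    -- For a third facet, the functional f cutting it out is on σ a nonnegative combination of the
    -- two facet coordinates. At the relative interior point t of τ both coordinates are positive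
    -- while f vanishes, so f would vanish on all of σ.
    by_contra! hcon
    have main : ∀ τ' ∈ P.cones, τ' ⊆ σ → P.dim τ' = P.dim ρ + 1 → τ ≠ τ' → t ∉ τ' := by
      intro τ' hτ' _ hdτ' hne' htτ'
      exact hne' (hP.eq_of_subset_of_dim_le hτ' hτ (hP.subset_of_inner hτ' hτ ht htτ') (by omega))
    have ht1 := hP.inner_normalVector_pos hσ hτ₁ h1' hdσ1 htσ (main τ₁ hτ₁ h1' hd1 hcon.1)
    have ht2 := hP.inner_normalVector_pos hσ hτ₂ h2' hdσ2 htσ (main τ₂ hτ₂ h2' hd2 hcon.2)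
    obtain ⟨f, hf0, hfe⟩ := (hP.isFace_iff hσ).1 ((hP.isFace_iff_subset hσ).2 ⟨hτ, hτσ⟩)
    have hfρ : ∀ v ∈ S.spanOf ρ, f v = 0 := fun v hv =>
      eq_zero_of_mem_spanOf (fun x hx => by
        have := hρτ hx
        rw [hfe] at this
        exact this.2) hv
    -- decomposition of the points of the cone
    have hdec : ∀ x ∈ σ, β * f (S.ι x) =
        ⟪S.normalVector σ τ₂, S.ι x⟫ * f (S.normalVector τ₁ ρ) +
        ⟪S.normalVector σ τ₁, S.ι x⟫ * f (S.normalVector τ₂ ρ) := by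
      intro x hx
      have d1 := hP.sub_inner_smul_mem hσ hτ₁ h1' hdσ1 (mem_spanOf hx)
      have d2 := hP.sub_inner_smul_mem hτ₁ hρ h1 hd1 d1
      have d3 := w2c _ (spanOf_mono h2 d2)
      have d4 := hfρ _ d2
      have e1 : ⟪S.normalVector σ τ₂, S.normalVector τ₂ ρ⟫ = 0 := w2c _ u2a
      have e2 : ⟪S.normalVector σ τ₂, S.normalVector τ₁ ρ⟫ = β := by
        have hw : ⟪S.normalVector σ τ₂, S.normalVector σ τ₂⟫ = 1 := by
          rw [real_inner_self_eq_norm_sq, w2b]; norm_num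
        rw [hrel', inner_add_right, real_inner_smul_right, real_inner_smul_right, e1, hw]
        ring
      set A := S.normalVector τ₁ ρ
      set B := S.normalVector τ₂ ρ
      set W := S.normalVector σ τ₁
      set W' := S.normalVector σ τ₂
      set y := S.ι x
      set a := ⟪A, y - ⟪W, y⟫ • W⟫
      have hfB := congrArg f hrel
      rw [map_add, map_smul, map_smul, smul_eq_mul, smul_eq_mul] at hfB
      have hWB := congrArg (fun v => ⟪W', v⟫) hrel
      rw [inner_add_right, real_inner_smul_right, real_inner_smul_right, e1, e2] at hWB
      rw [inner_sub_right, inner_sub_right, real_inner_smul_right, real_inner_smul_right, e2]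
        at d3
      rw [map_sub, map_sub, map_smul, map_smul, smul_eq_mul, smul_eq_mul] at d4
      set c := ⟪A, B⟫
      -- the coefficients in terms of the two normal coordinates
      have hfW : β * f W = f B - c * f A := by linarith
      have hW'W : β * ⟪W', W⟫ = -(c * β) := by linarith
      have hW'W' : ⟪W', W⟫ = -c := by
        have : β * (⟪W', W⟫ + c) = 0 := by linarith
        linarith [(mul_eq_zero.1 this).resolve_left hβ.ne']
      rw [hW'W'] at d3
      have d4' : β * f y = ⟪W, y⟫ * (β * f W) + a * β * f A := by linear_combination β * d4
      rw [d4', hfW]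
      linear_combination (-f A) * d3
    have q1 : 0 ≤ f (S.normalVector τ₁ ρ) := by
      obtain ⟨y, hy, hy'⟩ : ∃ y ∈ τ₁, y ∉ τ₂ := by
        by_contra! h
        exact hne (hP.eq_of_subset_of_dim_le hτ₂ hτ₁ h (by omega))
      have r1 := hP.inner_normalVector_pos hσ hτ₂ h2' hdσ2 (h1' hy) hy'
      have r2 := hdec y (h1' hy)
      rw [w1c _ (mem_spanOf hy), zero_mul, add_zero] at r2
      have r3 : 0 ≤ β * f (S.ι y) := mul_nonneg hβ.le (hf0 y (h1' hy))
      rw [r2] at r3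
      exact nonneg_of_mul_nonneg_right r3 r1
    have q2 : 0 ≤ f (S.normalVector τ₂ ρ) := by
      obtain ⟨y, hy, hy'⟩ : ∃ y ∈ τ₂, y ∉ τ₁ := by
        by_contra! h
        exact hne (hP.eq_of_subset_of_dim_le hτ₁ hτ₂ h (by omega)).symm
      have r1 := hP.inner_normalVector_pos hσ hτ₁ h1' hdσ1 (h2' hy) hy'
      have r2 := hdec y (h2' hy)
      rw [w2c _ (mem_spanOf hy), zero_mul, zero_add] at r2
      have r3 : 0 ≤ β * f (S.ι y) := mul_nonneg hβ.le (hf0 y (h2' hy))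
      rw [r2] at r3
      exact nonneg_of_mul_nonneg_right r3 r1
    have hft : f (S.ι t) = 0 := by
      have := ht.1
      rw [hfe] at this
      exact this.2
    have ht := hdec t htσ
    rw [hft, mul_zero] at ht
    have z1 : f (S.normalVector τ₁ ρ) = 0 := by nlinarith [mul_nonneg ht1.le q2]
    have z2 : f (S.normalVector τ₂ ρ) = 0 := by nlinarith [mul_nonneg ht2.le q1]
    have : τ = σ := by
      rw [hfe]
      ext x
      refine ⟨fun h => h.1, fun hx => ⟨hx, ?_⟩⟩
      have := hdec x hx
      rw [z1, z2, mul_zero, mul_zero, add_zero] at this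
      exact (mul_eq_zero.1 this).resolve_left hβ.ne'
    rw [this] at hdτ
    omega
  · rintro (rfl | rfl)
    · exact ⟨h1, h1', hd1⟩
    · exact ⟨h2, h2', hd2⟩
  · have f1 := congrArg f hrel
    have f2 := congrArg f hrel'
    have g1 := congrArg g hrel
    have g2 := congrArg g hrel'
    rw [map_add, map_smul, map_smul, smul_eq_mul, smul_eq_mul] at f1 f2 g1 g2
    -- With u₂ = c u₁ + β w₁ and u₁ = c u₂ + β w₂, β times the left side is f(u₁)g(u₂) + f(u₂)g(u₁)
    -- - c (f(u₁)g(u₁) + f(u₂)g(u₂)), which is symmetric in f and g.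
    refine mul_left_cancel₀ hβ.ne' ?_
    linear_combination (-f (S.normalVector τ₁ ρ)) * g1 - f (S.normalVector τ₂ ρ) * g2 +
      g (S.normalVector τ₁ ρ) * f1 + g (S.normalVector τ₂ ρ) * f2

end Good

end EuclideanConicalSpace

/-! ### Commutativity of intersection products and balancing -/

namespace EuclideanConicalSpace

variable {X N : Type*} [TopologicalSpace X] [NormedAddCommGroup N] [InnerProductSpace ℝ N]
  [FiniteDimensional ℝ N] {S : EuclideanConicalSpace X N} {P : ConicalComplex X}
  {σ τ ρ : Set X} {φ ψ : X → ℝ}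

local notation "⟪" x ", " y "⟫" => inner ℝ x y

lemma linearExtension_eq {ℓ : Module.Dual ℝ N} (h : ∀ x ∈ σ, φ x = ℓ (S.ι x)) {v : N}
    (hv : v ∈ S.spanOf σ) : S.linearExtension φ σ v = ℓ v := by
  have hs : ∀ x ∈ σ, φ x = S.linearExtension φ σ (S.ι x) :=
    Classical.epsilon_spec (p := fun ℓ : Module.Dual ℝ N => ∀ x ∈ σ, φ x = ℓ (S.ι x)) ⟨ℓ, h⟩
  have := eq_zero_of_mem_spanOf (ℓ := S.linearExtension φ σ - ℓ) (σ := σ) (fun x hx => by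
    rw [LinearMap.sub_apply, ← hs x hx, ← h x hx, sub_self]) hv
  rwa [LinearMap.sub_apply, sub_eq_zero] at this

namespace Good

lemma linearExtension_apply (hP : S.Good P) (hφ : P.IsPL φ) (hσ : σ ∈ P.cones) {x : X}
    (hx : x ∈ σ) : S.linearExtension φ σ (S.ι x) = φ x := by
  obtain ⟨ℓ, hℓ⟩ := hP.isPL_iff.1 hφ σ hσ
  rw [linearExtension_eq hℓ (mem_spanOf hx), hℓ x hx]

/-- On a face, the linear extension from a bigger cone can be used. -/
lemma linearExtension_mono (hP : S.Good P) (hφ : P.IsPL φ) (hσ : σ ∈ P.cones) (hs : τ ⊆ σ)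
    {v : N} (hv : v ∈ S.spanOf τ) : S.linearExtension φ τ v = S.linearExtension φ σ v :=
  linearExtension_eq (fun _ hx => (hP.linearExtension_apply hφ hσ (hs hx)).symm) hv

open Classical in
lemma intersect_apply (hP : S.Good P) (φ : X → ℝ) (c : P.Weight) (τ : {τ // τ ∈ P.cones}) :
    S.intersect P φ c τ = ∑ σ with P.dim σ.1 = P.dim τ.1 + 1 ∧ τ.1 ⊆ σ.1,
      -(S.linearExtension φ σ.1 (S.normalVector σ.1 τ.1)) * c σ := by
  rw [intersect]
  refine Finset.sum_congr (Finset.filter_congr fun σ _ => ?_) fun _ _ => rfl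
  rw [hP.isFace_iff_subset σ.2]
  simp [τ.2]

lemma mem_spanOf_normalVector (hP : S.Good P) (hσ : σ ∈ P.cones) (hτ : τ ∈ P.cones) (hs : τ ⊆ σ)
    (hd : P.dim σ = P.dim τ + 1) : S.normalVector σ τ ∈ S.spanOf σ :=
  (hP.isNormalVector hσ hτ hs hd).1

/-- The intersection products with two piecewise linear functions commute. -/
theorem intersect_comm (hP : S.Good P) (hφ : P.IsPL φ) (hψ : P.IsPL ψ) (c : P.Weight) :
    S.intersect P φ (S.intersect P ψ c) = S.intersect P ψ (S.intersect P φ c) := by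
  classical
  -- The iterated product as a sum over flags ρ ⊂ τ ⊂ σ, with both functions extended from σ. For
  -- fixed ρ and σ only two τ occur, and their contribution is symmetric in φ and ψ.
  have main : ∀ (φ ψ : X → ℝ), P.IsPL φ → P.IsPL ψ → ∀ ρ : {ρ // ρ ∈ P.cones},
      S.intersect P φ (S.intersect P ψ c) ρ =
        ∑ σ : {σ // σ ∈ P.cones} with P.dim σ.1 = P.dim ρ.1 + 2 ∧ ρ.1 ⊆ σ.1,
          c σ * ∑ τ : {τ // τ ∈ P.cones} with ρ.1 ⊆ τ.1 ∧ τ.1 ⊆ σ.1 ∧ P.dim τ.1 = P.dim ρ.1 + 1,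
            S.linearExtension φ σ.1 (S.normalVector τ.1 ρ.1) *
              S.linearExtension ψ σ.1 (S.normalVector σ.1 τ.1) := by
    intro φ ψ hφ hψ ρ
    rw [hP.intersect_apply]
    simp_rw [hP.intersect_apply, Finset.mul_sum]
    rw [Finset.sum_comm' (t' := Finset.univ.filter fun σ : {σ // σ ∈ P.cones} =>
        P.dim σ.1 = P.dim ρ.1 + 2 ∧ ρ.1 ⊆ σ.1) (s' := fun σ => Finset.univ.filter
        fun τ : {τ // τ ∈ P.cones} => ρ.1 ⊆ τ.1 ∧ τ.1 ⊆ σ.1 ∧ P.dim τ.1 = P.dim ρ.1 + 1)]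
    · refine Finset.sum_congr rfl fun σ hσ => Finset.sum_congr rfl fun τ hτ => ?_
      simp only [Finset.mem_filter, Finset.mem_univ, true_and] at hσ hτ
      rw [hP.linearExtension_mono hφ σ.2 hτ.2.1
        (hP.mem_spanOf_normalVector τ.2 ρ.2 hτ.1 hτ.2.2)]
      ring
    · intro τ σ
      simp only [Finset.mem_filter, Finset.mem_univ, true_and]
      constructor
      · rintro ⟨⟨h1, h2⟩, h3, h4⟩
        exact ⟨⟨h2, h4, h1⟩, by omega, h2.trans h4⟩
      · rintro ⟨⟨h2, h4, h1⟩, h5, h6⟩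
        exact ⟨⟨h1, h2⟩, by omega, h4⟩
  funext ρ
  rw [main φ ψ hφ hψ, main ψ φ hψ hφ]
  refine Finset.sum_congr rfl fun σ hσ => ?_
  simp only [Finset.mem_filter, Finset.mem_univ, true_and] at hσ
  obtain ⟨τ₁, h₁, τ₂, h₂, hne, hiff, hsym⟩ := hP.exists_facets_pair σ.2 ρ.2 hσ.2 hσ.1
  have hset : (Finset.univ.filter fun τ : {τ // τ ∈ P.cones} =>
      ρ.1 ⊆ τ.1 ∧ τ.1 ⊆ σ.1 ∧ P.dim τ.1 = P.dim ρ.1 + 1) = {⟨τ₁, h₁⟩, ⟨τ₂, h₂⟩} := by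
    ext τ
    simp only [Finset.mem_filter, Finset.mem_univ, true_and, Finset.mem_insert,
      Finset.mem_singleton, hiff τ.1 τ.2, Subtype.ext_iff]
  have hne' : (⟨τ₁, h₁⟩ : {τ // τ ∈ P.cones}) ≠ ⟨τ₂, h₂⟩ := fun h => hne (congrArg Subtype.val h)
  rw [hset, Finset.sum_pair hne', Finset.sum_pair hne', hsym]

lemma intersect_sub (hP : S.Good P) (hφ : P.IsPL φ) (hψ : P.IsPL ψ) (c : P.Weight) :
    S.intersect P (φ - ψ) c = S.intersect P φ c - S.intersect P ψ c := by
  classical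
  funext τ
  rw [Pi.sub_apply, hP.intersect_apply, hP.intersect_apply, hP.intersect_apply,
    ← Finset.sum_sub_distrib]
  refine Finset.sum_congr rfl fun σ hσ => ?_
  simp only [Finset.mem_filter, Finset.mem_univ, true_and] at hσ
  rw [linearExtension_eq (ℓ := S.linearExtension φ σ.1 - S.linearExtension ψ σ.1) (fun x hx => by
    rw [LinearMap.sub_apply, hP.linearExtension_apply hφ σ.2 hx,
      hP.linearExtension_apply hψ σ.2 hx]; rfl)
    (hP.mem_spanOf_normalVector σ.2 τ.2 hσ.2 hσ.1), LinearMap.sub_apply]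
  ring

lemma intersect_zero (φ : X → ℝ) : S.intersect P φ 0 = 0 := by
  funext τ
  simp [intersect]

end Good

/-- A weight is balanced if its product with every linear function is zero. -/
def Balanced (S : EuclideanConicalSpace X N) (P : ConicalComplex X) (c : P.Weight) : Prop :=
  ∀ ℓ : Module.Dual ℝ N, S.intersect P (fun x => ℓ (S.ι x)) c = 0

namespace Good

/-- Apply ℓ to the balancing relation at τ; in other dimensions the weight itself vanishes. -/
lemma balanced_of_isMinkowskiWeight (hP : S.Good P) {k : ℕ} {c : P.Weight}
    (hc : S.IsMinkowskiWeight P k c) : S.Balanced P c := by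
  classical
  intro ℓ
  funext τ
  rw [hP.intersect_apply, Pi.zero_apply]
  by_cases hk : P.dim τ.1 + 1 = k
  · have h := congrArg ℓ (hc.2 τ.1 τ.2 hk)
    rw [map_sum, map_zero] at h
    have : ∀ σ : {σ // σ ∈ P.cones}, (P.dim σ.1 = P.dim τ.1 + 1 ∧ τ.1 ⊆ σ.1) ↔
        (P.dim σ.1 = k ∧ P.IsFace τ.1 σ.1) := fun σ => by
      rw [hP.isFace_iff_subset σ.2, hk]; simp [τ.2]
    have h2 : -∑ σ : {σ // σ ∈ P.cones} with P.dim σ.1 = k ∧ P.IsFace τ.1 σ.1,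
      ℓ (c σ • S.normalVector σ.1 τ.1) = 0 := by rw [h, neg_zero]
    rw [← h2, ← Finset.sum_neg_distrib]
    refine Finset.sum_congr (Finset.filter_congr fun σ _ => this σ) fun σ hσ => ?_
    simp only [Finset.mem_filter, Finset.mem_univ, true_and] at hσ
    have hs := (this σ).2 hσ
    rw [linearExtension_eq (ℓ := ℓ) (fun _ _ => rfl)
      (hP.mem_spanOf_normalVector σ.2 τ.2 hs.2 hs.1), map_smul, smul_eq_mul]
    ring
  · refine Finset.sum_eq_zero fun σ hσ => ?_
    simp only [Finset.mem_filter, Finset.mem_univ, true_and] at hσ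
    rw [hc.1 σ (by omega), mul_zero]

/-- ℓ · (φ · c) = φ · (ℓ · c) = 0 by commutativity. -/
lemma balanced_intersect (hP : S.Good P) (hφ : P.IsPL φ) {c : P.Weight} (hc : S.Balanced P c) :
    S.Balanced P (S.intersect P φ c) := by
  intro ℓ
  rw [hP.intersect_comm (hP.1 ℓ) hφ, hc ℓ, intersect_zero]

end Good

end EuclideanConicalSpace

/-! ### Intersection products and subdivisions -/

namespace EuclideanConicalSpace

variable {X N : Type*} [TopologicalSpace X] [NormedAddCommGroup N] [InnerProductSpace ℝ N]
  [FiniteDimensional ℝ N] {S : EuclideanConicalSpace X N} {P Q : ConicalComplex X}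
  {σ τ ρ : Set X} {φ ψ : X → ℝ}

local notation "⟪" x ", " y "⟫" => inner ℝ x y

namespace Good

/-- Moving from a point `x` of a cone of `P` in the direction of another point of this cone, one
enters a unique cone of the subdivision `Q`. -/
lemma exists_cone_toward (hP : S.Good P) (hQ : Q.IsSubdivision P) (hσ : σ ∈ P.cones) {x y : X}
    (hx : x ∈ σ) (hy : y ∈ σ) : ∃ σ' ∈ Q.cones, σ' ⊆ σ ∧ x ∈ σ' ∧
      ∃ t : ℝ, 0 < t ∧ ∃ z, S.Inner σ' z ∧ S.ι z = S.ι x + t • S.ι y := by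
  classical
  have hQG := hP.of_isSubdivision hQ
  -- There are finitely many cones, so one of them carries x + t y for arbitrarily small t; being
  -- closed, it contains x.
  have hex : ∃ σ' ∈ Q.cones, ∃ᶠ t in 𝓝[>] (0 : ℝ), ∃ z ∈ σ, S.Inner σ' z ∧
      S.ι z = S.ι x + t • S.ι y := by
    by_contra! hcon
    obtain ⟨t, ht, ht0⟩ := (((Filter.eventually_all_finset Q.cones).2 hcon).and
      self_mem_nhdsWithin).exists
    obtain ⟨z, hz, hzι⟩ := hP.exists_comb hσ hx hy zero_le_one (le_of_lt ht0)
    rw [one_smul] at hzι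
    obtain ⟨κ, hκ, hzκ⟩ := hQG.exists_carrier z
    exact ht κ hκ z hz hzκ hzι
  obtain ⟨σ', hσ', hfreq⟩ := hex
  obtain ⟨t, ⟨z, hzσ, hz, hzι⟩, ht⟩ := (hfreq.and_eventually self_mem_nhdsWithin).exists
  have hsub := hP.subset_of_inner_of_isSubdivision hQ hσ' hσ hz hzσ
  refine ⟨σ', hσ', hsub, ?_, t, ht, z, hz, hzι⟩
  obtain ⟨Λ, hΛ⟩ := hQG.exists_ineq hσ'
  have hmem : S.ι x ∈ S.ι '' σ' := by
    refine (hΛ _).2 fun ℓ hℓ => ?_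
    by_contra! hneg
    have hc : Tendsto (fun t : ℝ => ℓ (S.ι x) + t * ℓ (S.ι y)) (𝓝[>] 0)
        (𝓝 (ℓ (S.ι x) + 0 * ℓ (S.ι y))) :=
      ((continuous_const.add (continuous_id.mul continuous_const)).tendsto 0).mono_left
        nhdsWithin_le_nhds
    rw [zero_mul, add_zero] at hc
    obtain ⟨s, ⟨w, -, hw, hwι⟩, hs⟩ :=
      (hfreq.and_eventually (hc.eventually (gt_mem_nhds hneg))).exists
    have := (hΛ _).1 ⟨w, hw.1, rfl⟩ ℓ hℓ
    rw [hwι, map_add, map_smul, smul_eq_mul] at this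
    linarith
  obtain ⟨x', hx', he⟩ := hmem
  rwa [← hP.2 σ hσ (hsub hx') hx he]

/-- Two cones of a subdivision inside the same cone, with a common facet and the same normal vector
along it, coincide. -/
lemma eq_of_normalVector_eq (hP : S.Good P) (hQ : Q.IsSubdivision P) (hσ : σ ∈ P.cones)
    {σ₁ σ₂ τ' : Set X} (h₁ : σ₁ ∈ Q.cones) (h₂ : σ₂ ∈ Q.cones) (hτ' : τ' ∈ Q.cones)
    (hs₁ : σ₁ ⊆ σ) (hs₂ : σ₂ ⊆ σ) (ht₁ : τ' ⊆ σ₁) (ht₂ : τ' ⊆ σ₂)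
    (hd₁ : Q.dim σ₁ = Q.dim τ' + 1) (hd₂ : Q.dim σ₂ = Q.dim τ' + 1)
    (hv : S.normalVector σ₁ τ' = S.normalVector σ₂ τ') : σ₁ = σ₂ := by
  have hQG := hP.of_isSubdivision hQ
  obtain ⟨x, hx⟩ := hQG.exists_inner hτ'
  obtain ⟨y₁, hy₁⟩ := hQG.exists_inner h₁
  have hnot : ∀ σ', σ' ∈ Q.cones → τ' ⊆ σ' → Q.dim σ' = Q.dim τ' + 1 → ∀ y, S.Inner σ' y →
      y ∉ τ' := by
    intro σ' hσ' _ hd y hy hyτ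
    have := hQG.dim_le hτ' hσ' (hQG.subset_of_inner hτ' hσ' hy hyτ)
    omega
  obtain ⟨y₂, hy₂⟩ := hQG.exists_inner h₂
  have p1 := hQG.inner_normalVector_pos h₁ hτ' ht₁ hd₁ hy₁.1 (hnot _ h₁ ht₁ hd₁ _ hy₁)
  have p2 := hQG.inner_normalVector_pos h₂ hτ' ht₂ hd₂ hy₂.1 (hnot _ h₂ ht₂ hd₂ _ hy₂)
  have m1 := hQG.sub_inner_smul_mem h₁ hτ' ht₁ hd₁ (mem_spanOf hy₁.1)
  have m2 := hQG.sub_inner_smul_mem h₂ hτ' ht₂ hd₂ (mem_spanOf hy₂.1)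
  rw [← hv] at p2 m2
  set v := S.normalVector σ₁ τ'
  set b₁ := ⟪v, S.ι y₁⟫
  set b₂ := ⟪v, S.ι y₂⟫
  -- The point x + ε y₁, interior to σ₁, is also reached from σ₂: correct x within τ' to x', then
  -- add the multiple ε b₁ / b₂ of y₂, which has the same component along v. A point of σ₂ interior
  -- to σ₁ forces σ₁ ⊆ σ₂.
  obtain ⟨ε, hε, hmove⟩ := hQG.exists_move hτ' hx
    (Submodule.sub_mem _ m1 (Submodule.smul_mem _ (b₁ / b₂) m2))
  obtain ⟨x', hx', hx'ι⟩ := hmove ε (abs_of_pos hε).le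
  obtain ⟨z, hz, hzι⟩ := hQG.exists_comb h₂ (ht₂ hx') hy₂.1 zero_le_one
    (mul_nonneg hε.le (div_pos p1 p2).le)
  obtain ⟨z', hz', hz'ι⟩ := hQG.exists_comb h₁ (ht₁ hx.1) hy₁.1 zero_le_one hε.le
  have heq : S.ι z = S.ι z' := by
    have hr : b₁ = b₁ / b₂ * b₂ := (div_mul_cancel₀ _ p2.ne').symm
    generalize b₁ / b₂ = r at hr hx'ι hzι
    rw [hzι, hz'ι, hx'ι, hr]
    module
  have hzz := hP.2 σ hσ (hs₂ hz) (hs₁ hz') heq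
  have hin : S.Inner σ₁ z' := Inner.of_comb hy₁ (ht₁ hx.1) hz' hε zero_le_one
    (by rw [hz'ι]; abel)
  rw [← hzz] at hin
  have := hQG.subset_of_inner h₂ h₁ hin hz
  exact hQG.eq_of_subset_of_dim_le h₂ h₁ this (by omega)

lemma normalVector_eq_or_eq_neg (hQ : S.Good Q) {σ₁ σ₂ τ' : Set X} (h₁ : σ₁ ∈ Q.cones)
    (h₂ : σ₂ ∈ Q.cones) (hτ' : τ' ∈ Q.cones) (ht₁ : τ' ⊆ σ₁) (ht₂ : τ' ⊆ σ₂)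
    (hd₁ : Q.dim σ₁ = Q.dim τ' + 1) (hd₂ : Q.dim σ₂ = Q.dim τ' + 1)
    (hle : S.spanOf σ₂ ≤ S.spanOf σ₁) :
    S.normalVector σ₂ τ' = S.normalVector σ₁ τ' ∨ S.normalVector σ₂ τ' = -S.normalVector σ₁ τ' := by
  obtain ⟨v1, v2, v3, v4⟩ := hQ.isNormalVector h₁ hτ' ht₁ hd₁
  obtain ⟨w1, w2, w3, w4⟩ := hQ.isNormalVector h₂ hτ' ht₂ hd₂
  have h := hQ.sub_inner_smul_mem h₁ hτ' ht₁ hd₁ (hle w1)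
  set v := S.normalVector σ₁ τ'
  set w := S.normalVector σ₂ τ'
  have hz : w - ⟪v, w⟫ • v = 0 := by
    rw [← inner_self_eq_zero (𝕜 := ℝ)]
    conv_lhs => rw [inner_sub_left]
    rw [w3 _ h, real_inner_smul_left, v3 _ h]
    simp
  rw [sub_eq_zero] at hz
  have habs : |⟪v, w⟫| = 1 := by
    have := congrArg norm hz
    rwa [norm_smul, w2, v2, mul_one, Real.norm_eq_abs, eq_comm] at this
  rcases (abs_eq zero_le_one).1 habs with h1 | h1
  · left; rw [hz, h1, one_smul]
  · right; rw [hz, h1, neg_one_smul]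

lemma spanOf_eq_of_dim_eq (hP : S.Good P) (hQ : S.Good Q) (hσ : σ ∈ P.cones) {σ' : Set X}
    (hσ' : σ' ∈ Q.cones) (hs : σ' ⊆ σ) (hd : Q.dim σ' = P.dim σ) : S.spanOf σ' = S.spanOf σ := by
  refine Submodule.eq_of_le_of_finrank_le (spanOf_mono hs) ?_
  rw [← hP.dim_eq hσ, ← hQ.dim_eq hσ', hd]

lemma dim_le_of_isSubdivision (hP : S.Good P) (hQ : S.Good Q) (hσ : σ ∈ P.cones) {σ' : Set X}
    (hσ' : σ' ∈ Q.cones) (hs : σ' ⊆ σ) : Q.dim σ' ≤ P.dim σ := by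
  rw [hP.dim_eq hσ, hQ.dim_eq hσ']
  exact Submodule.finrank_mono (spanOf_mono hs)

/-- The carrier of x in P lies between σ' and σ, so it is σ by dimension. -/
lemma inner_of_dim_eq (hP : S.Good P) (hQ : Q.IsSubdivision P) (hσ : σ ∈ P.cones) {σ' : Set X}
    (hσ' : σ' ∈ Q.cones) (hs : σ' ⊆ σ) (hd : Q.dim σ' = P.dim σ) {x : X} (hx : S.Inner σ' x) :
    S.Inner σ x := by
  have hQG := hP.of_isSubdivision hQ
  obtain ⟨κ, hκ, hxκ⟩ := hP.exists_carrier x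
  have h1 := hP.subset_of_inner hσ hκ hxκ (hs hx.1)
  have h2 := hP.subset_of_inner_of_isSubdivision hQ hσ' hκ hx hxκ.1
  have h3 := hP.dim_le_of_isSubdivision hQG hκ hσ' h2
  rwa [← hP.eq_of_subset_of_dim_le hσ hκ h1 (by omega)]

lemma normalVector_subdivision (hP : S.Good P) (hQ : Q.IsSubdivision P) (hσ : σ ∈ P.cones)
    (hτ : τ ∈ P.cones) {σ' τ' : Set X} (hσ' : σ' ∈ Q.cones) (hτ' : τ' ∈ Q.cones) (hsσ : σ' ⊆ σ)
    (hsτ : τ' ⊆ τ) (hs : τ ⊆ σ) (hs' : τ' ⊆ σ') (hdσ : Q.dim σ' = P.dim σ)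
    (hdτ : Q.dim τ' = P.dim τ) (hd : P.dim σ = P.dim τ + 1) :
    S.normalVector σ' τ' = S.normalVector σ τ := by
  have hQG := hP.of_isSubdivision hQ
  obtain ⟨h1, h2, h3, h4⟩ := hP.isNormalVector hσ hτ hs hd
  refine hQG.normalVector_eq hσ' hτ' hs' (by omega) ⟨?_, h2, fun w hw => ?_, fun x hx => ?_⟩
  · rwa [hP.spanOf_eq_of_dim_eq hQG hσ hσ' hsσ hdσ]
  · exact h3 w (spanOf_mono hsτ hw)
  · exact h4 x (hsσ hx)

/-- In the interior of a cone, the cones of a subdivision that meet along a wall have opposite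
normal vectors. -/
lemma exists_opposite_pair (hP : S.Good P) (hQ : Q.IsSubdivision P) (hσ : σ ∈ P.cones)
    {τ' : Set X} (hτ' : τ' ∈ Q.cones) {x : X} (hx : S.Inner τ' x) (hxσ : S.Inner σ x)
    (hd : P.dim σ = Q.dim τ' + 1) : ∃ σ₁ ∈ Q.cones, ∃ σ₂ ∈ Q.cones, σ₁ ≠ σ₂ ∧
      (∀ κ ∈ Q.cones, (Q.dim κ = Q.dim τ' + 1 ∧ τ' ⊆ κ ∧ κ ⊆ σ) ↔ (κ = σ₁ ∨ κ = σ₂)) ∧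
      S.normalVector σ₂ τ' = -S.normalVector σ₁ τ' := by
  have hQG := hP.of_isSubdivision hQ
  have hτσ := hP.subset_of_inner_of_isSubdivision hQ hτ' hσ hx hxσ.1
  obtain ⟨y, hy, hyτ⟩ : ∃ y ∈ σ, S.ι y ∉ S.spanOf τ' := by
    by_contra! h
    have : S.spanOf σ ≤ S.spanOf τ' := by
      refine Submodule.span_le.2 ?_
      rintro _ ⟨y, hy, rfl⟩
      exact h y hy
    have := Submodule.finrank_mono this
    rw [← hP.dim_eq hσ, ← hQG.dim_eq hτ'] at this
    omega
  -- Starting at x on the wall and moving towards y one enters a cone on the side of y. The other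
  -- side is reached with y' = x - ε y, which lies in σ because x is interior to σ.
  have main : ∀ y ∈ σ, S.ι y ∉ S.spanOf τ' → ∃ σ' ∈ Q.cones, Q.dim σ' = Q.dim τ' + 1 ∧
      τ' ⊆ σ' ∧ σ' ⊆ σ ∧ 0 < ⟪S.normalVector σ' τ', S.ι y⟫ := by
    intro y hy hyτ
    obtain ⟨σ', hσ', hsub, hxσ', t, ht, z, hz, hzι⟩ := hP.exists_cone_toward hQ hσ hxσ.1 hy
    have hs := hQG.subset_of_inner hσ' hτ' hx hxσ'
    have hzτ : z ∉ τ' := by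
      intro h
      apply hyτ
      have h2 := Submodule.sub_mem _ (mem_spanOf (S := S) h) (mem_spanOf (S := S) hx.1)
      rw [hzι, add_sub_cancel_left] at h2
      exact (Submodule.smul_mem_iff _ ht.ne').1 h2
    have hd' : Q.dim σ' = Q.dim τ' + 1 := by
      have h1 := hP.dim_le_of_isSubdivision hQG hσ hσ' hsub
      by_contra hcon
      apply hzτ
      rw [hQG.eq_of_subset_of_dim_le hσ' hτ' hs (by omega)]
      exact hz.1
    refine ⟨σ', hσ', hd', hs, hsub, ?_⟩
    have := hQG.inner_normalVector_pos hσ' hτ' hs hd' hz.1 hzτ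
    rw [hzι, inner_add_right, real_inner_smul_right,
      (hQG.isNormalVector hσ' hτ' hs hd').2.2.1 _ (mem_spanOf hx.1), zero_add] at this
    exact pos_of_mul_pos_right this ht.le
  obtain ⟨σ₁, h1, hd1, hs1, hsub1, hp1⟩ := main y hy hyτ
  obtain ⟨ε, hε, hmove⟩ := hP.exists_move hσ hxσ (mem_spanOf hy)
  obtain ⟨y', hy', hy'ι⟩ := hmove (-ε) (by rw [abs_neg, abs_of_pos hε])
  obtain ⟨σ₂, h2, hd2, hs2, hsub2, hp2⟩ := main y' hy' (by
    intro h
    apply hyτ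
    have h2 := Submodule.sub_mem _ h (mem_spanOf (S := S) hx.1)
    rw [hy'ι, add_sub_cancel_left] at h2
    exact (Submodule.smul_mem_iff _ (neg_ne_zero.2 hε.ne')).1 h2)
  rw [hy'ι, inner_add_right, real_inner_smul_right,
      (hQG.isNormalVector h2 hτ' hs2 hd2).2.2.1 _ (mem_spanOf hx.1), zero_add] at hp2
  have hspan : ∀ κ ∈ Q.cones, Q.dim κ = Q.dim τ' + 1 → κ ⊆ σ → S.spanOf κ = S.spanOf σ :=
    fun κ hκ hdκ hsκ => hP.spanOf_eq_of_dim_eq hQG hσ hκ hsκ (by omega)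
  have hopp : S.normalVector σ₂ τ' = -S.normalVector σ₁ τ' := by
    refine (hQG.normalVector_eq_or_eq_neg h1 h2 hτ' hs1 hs2 hd1 hd2
      (by rw [hspan σ₁ h1 hd1 hsub1, hspan σ₂ h2 hd2 hsub2])).resolve_left fun h => ?_
    rw [h] at hp2
    nlinarith
  refine ⟨σ₁, h1, σ₂, h2, ?_, fun κ hκ => ⟨fun ⟨hdκ, hsκ, hsubκ⟩ => ?_, ?_⟩, hopp⟩
  · rintro rfl
    have := hopp
    rw [eq_neg_iff_add_eq_zero, ← two_smul ℝ, smul_eq_zero] at this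
    have h0 := this.resolve_left two_ne_zero
    rw [h0, inner_zero_left] at hp1
    exact lt_irrefl _ hp1
  · rcases hQG.normalVector_eq_or_eq_neg h1 hκ hτ' hs1 hsκ hd1 hdκ
      (by rw [hspan σ₁ h1 hd1 hsub1, hspan κ hκ hdκ hsubκ]) with h | h
    · left
      exact hP.eq_of_normalVector_eq hQ hσ hκ h1 hτ' hsubκ hsub1 hsκ hs1 hdκ hd1 h
    · right
      rw [← hopp] at h
      exact hP.eq_of_normalVector_eq hQ hσ hκ h2 hτ' hsubκ hsub2 hsκ hs2 hdκ hd2 h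
  · rintro (rfl | rfl)
    · exact ⟨hd1, hs1, hsub1⟩
    · exact ⟨hd2, hs2, hsub2⟩

/-- Every cone of `P` with a given facet contains a cone of the subdivision `Q` with a given facet
inside this facet. -/
lemma exists_cone_above (hP : S.Good P) (hQ : Q.IsSubdivision P) (hσ : σ ∈ P.cones)
    (hτ : τ ∈ P.cones) (hs : τ ⊆ σ) (hd : P.dim σ = P.dim τ + 1) {τ' : Set X}
    (hτ' : τ' ∈ Q.cones) (hs' : τ' ⊆ τ) (hd' : Q.dim τ' = P.dim τ) :
    ∃ σ' ∈ Q.cones, τ' ⊆ σ' ∧ σ' ⊆ σ ∧ Q.dim σ' = P.dim σ := by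
  have hQG := hP.of_isSubdivision hQ
  obtain ⟨x, hx⟩ := hQG.exists_inner hτ'
  obtain ⟨y, hy⟩ := hP.exists_inner hσ
  obtain ⟨σ', hσ', hsub, hxσ', t, ht, z, hz, hzι⟩ :=
    hP.exists_cone_toward hQ hσ (hs (hs' hx.1)) hy.1
  have hsσ := hQG.subset_of_inner hσ' hτ' hx hxσ'
  refine ⟨σ', hσ', hsσ, hsub, ?_⟩
  have h1 := hP.dim_le_of_isSubdivision hQG hσ hσ' hsub
  by_contra hcon
  have heq := hQG.eq_of_subset_of_dim_le hσ' hτ' hsσ (by omega)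
  have hzσ : S.Inner σ z := Inner.of_comb hy (hs (hs' hx.1)) (hsub hz.1) ht zero_le_one
    (by rw [hzι, one_smul]; abel)
  have hzτ : z ∈ τ := hs' (heq ▸ hz.1)
  have := hP.dim_le hτ hσ (hP.subset_of_inner hτ hσ hzσ hzτ)
  omega

/-- The intersection product commutes with the pull-back to a subdivision. -/
theorem intersect_pullback (hP : S.Good P) (hQ : Q.IsSubdivision P) (hφ : P.IsPL φ)
    (c : P.Weight) :
    S.intersect Q φ (P.pullback Q c) = P.pullback Q (S.intersect P φ c) := by
  classical
  have hQG := hP.of_isSubdivision hQ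
  funext ⟨τ', hτ'⟩
  obtain ⟨x, hx⟩ := hQG.exists_inner hτ'
  obtain ⟨τ, hτ, hxτ⟩ := hP.exists_carrier x
  rw [hP.pullback_apply hQ _ (σ' := ⟨τ', hτ'⟩) (σ := ⟨τ, hτ⟩) hx hxτ, hQG.intersect_apply]
  have hττ := hP.subset_of_inner_of_isSubdivision hQ hτ' hτ hx hxτ.1
  -- the cones above `τ'` whose pulled back weight is nonzero
  have hcar : ∀ σ' : {s // s ∈ Q.cones}, τ' ⊆ σ'.1 → P.pullback Q c σ' ≠ 0 →
      ∃ κ : {s // s ∈ P.cones}, τ ⊆ κ.1 ∧ σ'.1 ⊆ κ.1 ∧ P.dim κ.1 = Q.dim σ'.1 := by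
    intro σ' hs hne
    obtain ⟨z, hz⟩ := hQG.exists_inner σ'.2
    obtain ⟨κ, hκ, hzκ⟩ := hP.exists_carrier z
    rw [hP.pullback_apply hQ c (σ := ⟨κ, hκ⟩) hz hzκ] at hne
    have hdim : P.dim κ = Q.dim σ'.1 := by
      by_contra h
      exact hne (if_neg h)
    have hsub := hP.subset_of_inner_of_isSubdivision hQ σ'.2 hκ hz hzκ.1
    exact ⟨⟨κ, hκ⟩, hP.subset_of_inner hκ hτ hxτ (hsub (hs hx.1)), hsub, hdim⟩
  have hval : ∀ (σ' : {s // s ∈ Q.cones}) (κ : {s // s ∈ P.cones}), σ'.1 ⊆ κ.1 →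
      P.dim κ.1 = Q.dim σ'.1 → P.pullback Q c σ' = c κ := by
    intro σ' κ hs hd
    obtain ⟨z, hz⟩ := hQG.exists_inner σ'.2
    rw [hP.pullback_apply hQ c hz (hP.inner_of_dim_eq hQ κ.2 σ'.2 hs hd.symm hz), if_pos hd]
  have hlin : ∀ (σ' : {s // s ∈ Q.cones}) (κ : {s // s ∈ P.cones}), σ'.1 ⊆ κ.1 → τ' ⊆ σ'.1 →
      Q.dim σ'.1 = Q.dim τ' + 1 → S.linearExtension φ σ'.1 (S.normalVector σ'.1 τ') =
        S.linearExtension φ κ.1 (S.normalVector σ'.1 τ') := by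
    intro σ' κ hs hs' hd
    exact linearExtension_eq (fun x hx => (hP.linearExtension_apply hφ κ.2 (hs hx)).symm)
      (hQG.mem_spanOf_normalVector σ'.2 hτ' hs' hd)
  -- If τ' has the dimension of its carrier τ, the cones above τ correspond to the cones above τ' of
  -- nonzero pulled-back weight, with equal weights and normal vectors.
  split_ifs with hdim
  · rw [hP.intersect_apply]
    have hex : ∀ σ : {s // s ∈ P.cones}, P.dim σ.1 = P.dim τ + 1 ∧ τ ⊆ σ.1 →
        ∃ σ' : {s // s ∈ Q.cones}, τ' ⊆ σ'.1 ∧ σ'.1 ⊆ σ.1 ∧ Q.dim σ'.1 = P.dim σ.1 := by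
      intro σ ⟨hd, hs⟩
      obtain ⟨σ', h1, h2⟩ := hP.exists_cone_above hQ σ.2 hτ hs hd hτ' hττ hdim.symm
      exact ⟨⟨σ', h1⟩, h2⟩
    have hQne : Nonempty {s // s ∈ Q.cones} := ⟨⟨τ', hτ'⟩⟩
    choose! e he using hex
    symm
    refine Finset.sum_of_injOn e ?_ ?_ ?_ ?_
    · intro σ₁ h₁ σ₂ h₂ heq
      simp only [Finset.coe_filter, Finset.mem_univ, true_and, Set.mem_ofPred_eq] at h₁ h₂
      obtain ⟨z, hz⟩ := hQG.exists_inner (e σ₁).2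
      have z1 := hP.inner_of_dim_eq hQ σ₁.2 (e σ₁).2 (he σ₁ h₁).2.1 (he σ₁ h₁).2.2 hz
      rw [heq] at hz
      have z2 := hP.inner_of_dim_eq hQ σ₂.2 (e σ₂).2 (he σ₂ h₂).2.1 (he σ₂ h₂).2.2 hz
      exact Subtype.ext (hP.carrier_unique σ₁.2 σ₂.2 z1 z2)
    · intro σ hσ
      simp only [Finset.coe_filter, Finset.mem_univ, true_and, Set.mem_ofPred_eq] at hσ ⊢
      exact ⟨by rw [(he σ hσ).2.2, hσ.1, hdim], (he σ hσ).1⟩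
    · intro σ' hσ' hnot
      simp only [Finset.mem_filter, Finset.mem_univ, true_and] at hσ'
      by_contra hne
      obtain ⟨κ, hκ1, hκ2, hκ3⟩ := hcar σ' hσ'.2 (right_ne_zero_of_mul hne)
      have hκ : P.dim κ.1 = P.dim τ + 1 ∧ τ ⊆ κ.1 := ⟨by rw [hκ3, hσ'.1, hdim], hκ1⟩
      apply hnot
      refine ⟨κ, by simpa using hκ, Subtype.ext ?_⟩
      obtain ⟨e1, e2, e3⟩ := he κ hκ
      refine hP.eq_of_normalVector_eq hQ κ.2 (e κ).2 σ'.2 hτ' e2 hκ2 e1 hσ'.2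
        (by rw [e3, hκ.1, hdim]) hσ'.1 ?_
      rw [hP.normalVector_subdivision hQ κ.2 hτ (e κ).2 hτ' e2 hττ hκ1 e1 e3 hdim.symm hκ.1,
        hP.normalVector_subdivision hQ κ.2 hτ σ'.2 hτ' hκ2 hττ hκ1 hσ'.2 hκ3.symm hdim.symm hκ.1]
    · intro σ hσ
      simp only [Finset.mem_filter, Finset.mem_univ, true_and] at hσ
      obtain ⟨e1, e2, e3⟩ := he σ hσ
      have hd' : Q.dim (e σ).1 = Q.dim τ' + 1 := by rw [e3, hσ.1, hdim]
      rw [hval (e σ) σ e2 e3.symm, hlin (e σ) σ e2 e1 hd',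
        hP.normalVector_subdivision hQ σ.2 hτ (e σ).2 hτ' e2 hττ hσ.2 e1 e3 hdim.symm hσ.1]
  -- Otherwise the product must vanish at τ'. Nonzero weights above τ' occur only if τ' is a wall
  -- inside τ, and then exactly on its two sides, with equal weights and opposite normal vectors.
  · have hlt : Q.dim τ' < P.dim τ :=
      lt_of_le_of_ne (hP.dim_le_of_isSubdivision hQG hτ hτ' hττ) (Ne.symm hdim)
    have hz : ∀ σ' : {s // s ∈ Q.cones}, Q.dim σ'.1 = Q.dim τ' + 1 → τ' ⊆ σ'.1 →
        P.pullback Q c σ' ≠ 0 → P.dim τ = Q.dim τ' + 1 ∧ σ'.1 ⊆ τ := by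
      intro σ' hd hs hne
      obtain ⟨κ, hκ1, hκ2, hκ3⟩ := hcar σ' hs hne
      have := hP.dim_le κ.2 hτ hκ1
      have heq := hP.eq_of_subset_of_dim_le κ.2 hτ hκ1 (by omega)
      rw [heq]
      exact ⟨by omega, hκ2⟩
    by_cases hd : P.dim τ = Q.dim τ' + 1
    · obtain ⟨σ₁, h1, σ₂, h2, hne, hiff, hopp⟩ :=
        hP.exists_opposite_pair hQ hτ hτ' hx hxτ hd
      have hne' : (⟨σ₁, h1⟩ : {s // s ∈ Q.cones}) ≠ ⟨σ₂, h2⟩ :=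
        fun h => hne (congrArg Subtype.val h)
      have i1 := (hiff σ₁ h1).2 (Or.inl rfl)
      have i2 := (hiff σ₂ h2).2 (Or.inr rfl)
      rw [← Finset.sum_subset (s₁ := {⟨σ₁, h1⟩, ⟨σ₂, h2⟩}), Finset.sum_pair hne',
        hval ⟨σ₁, h1⟩ ⟨τ, hτ⟩ i1.2.2 (by rw [i1.1, hd]),
        hval ⟨σ₂, h2⟩ ⟨τ, hτ⟩ i2.2.2 (by rw [i2.1, hd]),
        hlin ⟨σ₁, h1⟩ ⟨τ, hτ⟩ i1.2.2 i1.2.1 i1.1, hlin ⟨σ₂, h2⟩ ⟨τ, hτ⟩ i2.2.2 i2.2.1 i2.1]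
      · dsimp only
        rw [hopp, map_neg]; ring
      · intro κ hκ
        simp only [Finset.mem_insert, Finset.mem_singleton] at hκ
        simp only [Finset.mem_filter, Finset.mem_univ, true_and]
        rcases hκ with rfl | rfl
        · exact ⟨i1.1, i1.2.1⟩
        · exact ⟨i2.1, i2.2.1⟩
      · intro κ hκ hnot
        simp only [Finset.mem_filter, Finset.mem_univ, true_and] at hκ
        by_contra hcon
        have := hz κ hκ.1 hκ.2 (right_ne_zero_of_mul hcon)
        apply hnot
        simpa [Subtype.ext_iff] using (hiff κ.1 κ.2).1 ⟨hκ.1, hκ.2, this.2⟩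
    · refine Finset.sum_eq_zero fun σ' hσ' => ?_
      simp only [Finset.mem_filter, Finset.mem_univ, true_and] at hσ'
      by_contra hcon
      exact hd (hz σ' hσ'.1 hσ'.2 (right_ne_zero_of_mul hcon)).1

/-- Dimensions of carriers only increase towards the coarser complex, so equality at the two ends
means equality at both steps. -/
lemma pullback_pullback {R : ConicalComplex X} (hP : S.Good P) (hQ : Q.IsSubdivision P)
    (hR : R.IsSubdivision Q) (c : P.Weight) :
    Q.pullback R (P.pullback Q c) = P.pullback R c := by
  have hQG := hP.of_isSubdivision hQ
  have hRG := hQG.of_isSubdivision hR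
  funext σ''
  obtain ⟨x, hx⟩ := hRG.exists_inner σ''.2
  obtain ⟨σ', hσ', hxσ'⟩ := hQG.exists_carrier x
  obtain ⟨σ, hσ, hxσ⟩ := hP.exists_carrier x
  rw [hQG.pullback_apply hR _ (σ := ⟨σ', hσ'⟩) hx hxσ',
    hP.pullback_apply (hR.trans hQ) c (σ := ⟨σ, hσ⟩) hx hxσ,
    hP.pullback_apply hQ c (σ' := ⟨σ', hσ'⟩) (σ := ⟨σ, hσ⟩) hxσ' hxσ]
  have h1 := hQG.dim_le_of_isSubdivision hRG hσ' σ''.2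
    (hQG.subset_of_inner_of_isSubdivision hR σ''.2 hσ' hx hxσ'.1)
  have h2 := hP.dim_le_of_isSubdivision hQG hσ hσ'
    (hP.subset_of_inner_of_isSubdivision hQ hσ' hσ hxσ' hxσ.1)
  dsimp only
  split_ifs <;> first | rfl | omega

end Good

end EuclideanConicalSpace

/-! ### Discrete measures and degrees -/

namespace EuclideanConicalSpace

variable {X N : Type*} [TopologicalSpace X] [NormedAddCommGroup N] [InnerProductSpace ℝ N]
  [FiniteDimensional ℝ N] {S : EuclideanConicalSpace X N} {P Q : ConicalComplex X}
  {σ τ ρ : Set X} {φ ψ : X → ℝ}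

local notation "⟪" x ", " y "⟫" => inner ℝ x y

namespace Good

/-- If the apex is a relative interior point, the cone contains a negative multiple of each of its
points, against strict convexity. -/
lemma eq_zero_of_inner_zero (hP : S.Good P) (hσ : σ ∈ P.cones) {z : X} (hz : S.Inner σ z)
    (hz0 : S.ι z = 0) {w : X} (hw : w ∈ σ) : S.ι w = 0 := by
  obtain ⟨ε, hε, hmove⟩ := hP.exists_move hσ hz (mem_spanOf hw)
  obtain ⟨y, hy, hyι⟩ := hmove (-ε) (by rw [abs_neg, abs_of_pos hε])
  obtain ⟨w', hw', hw'ι⟩ := hP.exists_smul hσ hw hε.le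
  have := hP.eq_zero_of_eq_neg hσ hw' hy (by rw [hyι, hw'ι, hz0]; simp)
  rw [hw'ι] at this
  exact (smul_eq_zero.1 this).resolve_left hε.ne'

/-- A one-dimensional cone is the ray through a unit vector. -/
lemma exists_unit (hP : S.Good P) (hτ : τ ∈ P.cones) (hd : P.dim τ = 1) :
    ∃ x, S.Inner τ x ∧ ‖S.ι x‖ = 1 ∧ ∀ y ∈ τ, ∃ a : ℝ, 0 ≤ a ∧ S.ι y = a • S.ι x := by
  obtain ⟨y, hy⟩ := hP.exists_inner hτ
  have hy0 : S.ι y ≠ 0 := by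
    intro h0
    have : S.spanOf τ = ⊥ := by
      rw [spanOf, Submodule.span_eq_bot]
      rintro _ ⟨w, hw, rfl⟩
      exact hP.eq_zero_of_inner_zero hτ hy h0 hw
    rw [hP.dim_eq hτ, this, finrank_bot] at hd
    exact zero_ne_one hd
  have hpos : 0 < ‖S.ι y‖⁻¹ := inv_pos.2 (norm_pos_iff.2 hy0)
  obtain ⟨x, hx, hxι⟩ := hP.exists_smul hτ hy.1 hpos.le
  have hx0 : S.ι x ≠ 0 := by
    rw [hxι]; exact smul_ne_zero hpos.ne' hy0
  refine ⟨x, Inner.of_comb hy hy.1 hx hpos le_rfl (by rw [hxι]; simp), ?_, fun z hz => ?_⟩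
  · rw [hxι, norm_smul, norm_inv, norm_norm, inv_mul_cancel₀ (norm_ne_zero_iff.2 hy0)]
  · rw [hP.dim_eq hτ] at hd
    obtain ⟨a, ha⟩ := (finrank_eq_one_iff_of_nonzero' (⟨S.ι x, mem_spanOf hx⟩ : S.spanOf τ)
      (by simpa using hx0)).1 hd ⟨S.ι z, mem_spanOf hz⟩
    have ha' : a • S.ι x = S.ι z := congrArg Subtype.val ha
    refine ⟨a, ?_, ha'.symm⟩
    by_contra! hneg
    obtain ⟨x', hx', hx'ι⟩ := hP.exists_smul hτ hx (neg_pos.2 hneg).le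
    have := hP.eq_zero_of_eq_neg hτ hz hx' (by rw [hx'ι, ← ha', neg_smul, neg_neg])
    rw [← ha'] at this
    exact (smul_ne_zero hneg.ne hx0) this

lemma eq_of_unit (hP : S.Good P) (hτ : τ ∈ P.cones) (hd : P.dim τ = 1) {x y : X}
    (hx : x ∈ τ) (hy : y ∈ τ) (hx1 : ‖S.ι x‖ = 1) (hy1 : ‖S.ι y‖ = 1) : x = y := by
  obtain ⟨u, hu, hu1, hray⟩ := hP.exists_unit hτ hd
  have key : ∀ z ∈ τ, ‖S.ι z‖ = 1 → S.ι z = S.ι u := by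
    intro z hz hz1
    obtain ⟨a, ha, hza⟩ := hray z hz
    rw [hza, norm_smul, hu1, mul_one, Real.norm_of_nonneg ha] at hz1
    rw [hza, hz1, one_smul]
  exact hP.2 τ hτ hx hy ((key x hx hx1).trans (key y hy hy1).symm)

lemma diracRay_apply (hP : S.Good P) (hτ : τ ∈ P.cones) (hd : P.dim τ = 1) (x : S.sphere)
    (hx : x.1 ∈ τ) (G : C(S.sphere, ℝ)) : S.diracRay τ G = G x := by
  have h : ∃ x : S.sphere, x.1 ∈ τ := ⟨x, hx⟩
  rw [diracRay, dif_pos h]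
  have : h.choose = x := Subtype.ext
    (hP.eq_of_unit hτ hd h.choose_spec hx h.choose.2 x.2)
  rw [this]
  rfl

end Good

open Classical in
lemma discreteMeasure_apply (c : P.Weight) (G : C(S.sphere, ℝ)) :
    S.discreteMeasure P c G = ∑ τ with P.dim τ.1 = 1, c τ * S.diracRay τ.1 G := by
  have h : ∀ s : Finset {τ // τ ∈ P.cones}, (∑ τ ∈ s, c τ • S.diracRay τ.1 : S.RadonMeasure) G =
      ∑ τ ∈ s, c τ * S.diracRay τ.1 G := by
    intro s
    induction s using Finset.induction_on with
    | empty => rfl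
    | insert τ s hτ ih =>
      rw [Finset.sum_insert hτ, Finset.sum_insert hτ, ← ih]
      rfl
  exact h _

/-- A discrete measure is the evaluation of a functional that is continuous for pointwise
convergence. -/
lemma exists_continuous_discreteMeasure (c : P.Weight) :
    ∃ D : (X → ℝ) → ℝ, Continuous D ∧ ∀ (g : X → ℝ) (G : C(S.sphere, ℝ)),
      (∀ x : S.sphere, G x = g x) → S.discreteMeasure P c G = D g := by
  classical
  refine ⟨fun g => ∑ τ : {τ // τ ∈ P.cones} with P.dim τ.1 = 1,
    c τ * if h : ∃ x : S.sphere, x.1 ∈ τ.1 then g h.choose else 0, ?_, fun g G hG => ?_⟩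
  · refine continuous_finsetSum _ fun τ _ => continuous_const.mul ?_
    split_ifs with h
    · exact continuous_apply _
    · exact continuous_const
  · rw [discreteMeasure_apply]
    refine Finset.sum_congr rfl fun τ _ => ?_
    rw [diracRay]
    split_ifs with h
    · rw [← hG]; rfl
    · rfl

namespace Good

/-- The discrete measure of a weight does not change under pull-back. -/
lemma discreteMeasure_pullback (hP : S.Good P) (hQ : Q.IsSubdivision P) (c : P.Weight) :
    S.discreteMeasure Q (P.pullback Q c) = S.discreteMeasure P c := by
  classical
  have hQG := hP.of_isSubdivision hQ
  refine DFunLike.ext _ _ fun G => ?_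
  rw [discreteMeasure_apply, discreteMeasure_apply]
  -- A ray of P corresponds to the ray of Q carrying its unit vector; all other rays of Q have
  -- pulled-back weight zero.
  have hex : ∀ τ : {s // s ∈ P.cones}, P.dim τ.1 = 1 → ∃ τ' : {s // s ∈ Q.cones},
      ∃ x : S.sphere, S.Inner τ.1 x ∧ S.Inner τ'.1 x ∧ Q.dim τ'.1 = 1 := by
    intro τ hτ
    obtain ⟨x, hx, hx1, -⟩ := hP.exists_unit τ.2 hτ
    obtain ⟨τ', hτ', hxτ'⟩ := hQG.exists_carrier x
    refine ⟨⟨τ', hτ'⟩, ⟨x, hx1⟩, hx, hxτ', ?_⟩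
    have hle := hP.dim_le_of_isSubdivision hQG τ.2 hτ'
      (hP.subset_of_inner_of_isSubdivision hQ hτ' τ.2 hxτ' hx.1)
    have hne : Q.dim τ' ≠ 0 := by
      intro h0
      rw [hQG.dim_eq hτ', Submodule.finrank_eq_zero] at h0
      have := mem_spanOf (S := S) hxτ'.1
      rw [h0, Submodule.mem_bot] at this
      rw [this, norm_zero] at hx1
      exact zero_ne_one hx1
    change Q.dim τ' = 1
    omega
  rcases isEmpty_or_nonempty {s // s ∈ Q.cones} with hemp | hne
  · have : IsEmpty {s // s ∈ P.cones} := by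
      refine ⟨fun τ => ?_⟩
      obtain ⟨x, hx⟩ := hP.exists_inner τ.2
      obtain ⟨κ, hκ, -⟩ := hQG.exists_carrier x
      exact hemp.false ⟨κ, hκ⟩
    simp
  choose! e he using hex
  symm
  refine Finset.sum_of_injOn e ?_ ?_ ?_ ?_
  · intro τ₁ h₁ τ₂ h₂ heq
    simp only [Finset.coe_filter, Finset.mem_univ, true_and, Set.mem_ofPred_eq] at h₁ h₂
    obtain ⟨x, x1, x2, x3⟩ := he τ₁ h₁
    obtain ⟨y, y1, y2, y3⟩ := he τ₂ h₂
    rw [heq] at x2 x3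
    have hxy := hQG.eq_of_unit (e τ₂).2 y3 x2.1 y2.1 x.2 y.2
    rw [hxy] at x1
    exact Subtype.ext (hP.carrier_unique τ₁.2 τ₂.2 x1 y1)
  · intro τ hτ
    simp only [Finset.coe_filter, Finset.mem_univ, true_and, Set.mem_ofPred_eq] at hτ ⊢
    obtain ⟨x, x1, x2, x3⟩ := he τ hτ
    exact x3
  · intro τ' hτ' hnot
    simp only [Finset.mem_filter, Finset.mem_univ, true_and] at hτ'
    obtain ⟨x, hx, hx1, -⟩ := hQG.exists_unit τ'.2 hτ'
    obtain ⟨τ, hτ, hxτ⟩ := hP.exists_carrier x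
    rw [hP.pullback_apply hQ c (σ := ⟨τ, hτ⟩) hx hxτ, if_neg, zero_mul]
    intro hd
    rw [hτ'] at hd
    apply hnot
    obtain ⟨y, y1, y2, y3⟩ := he ⟨τ, hτ⟩ hd
    have hyx := hP.eq_of_unit hτ hd y1.1 hxτ.1 y.2 hx1
    rw [hyx] at y2
    exact ⟨⟨τ, hτ⟩, by simpa using hd, Subtype.ext (hQG.carrier_unique (e _).2 τ'.2 y2 hx)⟩
  · intro τ hτ
    simp only [Finset.mem_filter, Finset.mem_univ, true_and] at hτ
    obtain ⟨x, x1, x2, x3⟩ := he τ hτ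
    rw [hP.pullback_apply hQ c x2 x1, if_pos (hτ.trans x3.symm),
      hP.diracRay_apply τ.2 hτ x x1.1, hQG.diracRay_apply (e τ).2 x3 x x2.1]

/-- The integral of a piecewise linear function is minus the degree of the intersection product,
that is, the sum of its weights at the zero-dimensional cones. -/
lemma discreteMeasure_eq_neg_sum (hP : S.Good P) (hφ : P.IsPL φ) (c : P.Weight)
    (G : C(S.sphere, ℝ)) (hG : ∀ x : S.sphere, G x = φ x) [DecidablePred fun o :
      {s // s ∈ P.cones} => P.dim o.1 = 0] :
    S.discreteMeasure P c G = -∑ o with P.dim o.1 = 0, S.intersect P φ c o := by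
  classical
  rw [discreteMeasure_apply]
  simp_rw [hP.intersect_apply]
  rw [Finset.sum_comm' (t' := Finset.univ.filter fun τ : {s // s ∈ P.cones} => P.dim τ.1 = 1)
    (s' := fun τ => Finset.univ.filter fun o : {s // s ∈ P.cones} =>
      P.dim o.1 = 0 ∧ o.1 ⊆ τ.1), ← Finset.sum_neg_distrib]
  · refine Finset.sum_congr rfl fun τ hτ => ?_
    simp only [Finset.mem_filter, Finset.mem_univ, true_and] at hτ
    -- Every ray has exactly one apex, and its normal vector there is its unit vector. Apexes of
    -- different rays need not coincide, hence the sum over all zero-dimensional cones.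
    obtain ⟨z, hz, hz0⟩ := hP.exists_zero τ.2
    obtain ⟨o, ho, hzo⟩ := hP.exists_carrier z
    have hspan : ∀ κ ∈ P.cones, P.dim κ = 0 → S.spanOf κ = ⊥ := by
      intro κ hκ hd
      rwa [hP.dim_eq hκ, Submodule.finrank_eq_zero] at hd
    have hod : P.dim o = 0 := by
      have : S.spanOf o = ⊥ := by
        rw [spanOf, Submodule.span_eq_bot]
        rintro _ ⟨w, hw, rfl⟩
        exact hP.eq_zero_of_inner_zero ho hzo hz0 hw
      rw [hP.dim_eq ho, this, finrank_bot]
    have hoτ := hP.subset_of_inner τ.2 ho hzo hz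
    have huniq : (Finset.univ.filter fun o : {s // s ∈ P.cones} => P.dim o.1 = 0 ∧ o.1 ⊆ τ.1) =
        {⟨o, ho⟩} := by
      ext κ
      simp only [Finset.mem_filter, Finset.mem_univ, true_and, Finset.mem_singleton]
      constructor
      · rintro ⟨hd, hs⟩
        obtain ⟨w, hw⟩ := hP.exists_inner κ.2
        have hw0 : S.ι w = 0 := by
          have := mem_spanOf (S := S) hw.1
          rwa [hspan κ.1 κ.2 hd, Submodule.mem_bot] at this
        have hwz : w = z := hP.2 τ.1 τ.2 (hs hw.1) hz (hw0.trans hz0.symm)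
        rw [hwz] at hw
        exact Subtype.ext (hP.carrier_unique κ.2 ho hw hzo)
      · rintro rfl
        exact ⟨hod, hoτ⟩
    rw [huniq, Finset.sum_singleton]
    obtain ⟨x, hx, hx1, hray⟩ := hP.exists_unit τ.2 hτ
    have hnv : S.normalVector τ.1 o = S.ι x := by
      refine hP.normalVector_eq τ.2 ho hoτ (by omega) ⟨mem_spanOf hx.1, hx1, fun w hw => ?_,
        fun y hy => ?_⟩
      · rw [hspan o ho hod, Submodule.mem_bot] at hw
        rw [hw, inner_zero_right]
      · obtain ⟨a, ha, hya⟩ := hray y hy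
        rw [hya, real_inner_smul_right, real_inner_self_eq_norm_sq, hx1]
        simpa using ha
    rw [hP.diracRay_apply τ.2 hτ ⟨x, hx1⟩ hx.1, hG, hnv, hP.linearExtension_apply hφ τ.2 hx.1]
    ring
  · intro o τ
    simp only [Finset.mem_filter, Finset.mem_univ, true_and]
    constructor
    · rintro ⟨h1, h2, h3⟩; exact ⟨⟨h1, h3⟩, by omega⟩
    · rintro ⟨⟨h1, h3⟩, h2⟩; exact ⟨h1, by omega, h3⟩

lemma discreteMeasure_nonneg (hP : S.Good P) {c : P.Weight} (hc : ∀ σ, 0 ≤ c σ)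
    {G : C(S.sphere, ℝ)} (hG : ∀ x, 0 ≤ G x) : 0 ≤ S.discreteMeasure P c G := by
  classical
  rw [discreteMeasure_apply]
  refine Finset.sum_nonneg fun τ hτ => mul_nonneg (hc τ) ?_
  simp only [Finset.mem_filter, Finset.mem_univ, true_and] at hτ
  obtain ⟨x, hx, hx1, -⟩ := hP.exists_unit τ.2 hτ
  rw [hP.diracRay_apply τ.2 hτ ⟨x, hx1⟩ hx.1]
  exact hG _

end Good

end EuclideanConicalSpace

/-! ### Measures of products: independence, symmetry, linearity -/

namespace BalancedSpace

open EuclideanConicalSpace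

variable {X N : Type*} [TopologicalSpace X] [NormedAddCommGroup N] [InnerProductSpace ℝ N]
  [FiniteDimensional ℝ N] {n : ℕ} {S : BalancedSpace X N n} {P Q : ConicalComplex X}
  {L : List (X → ℝ)}

lemma productWeight_cons (P : ConicalComplex X) (φ : X → ℝ) (L : List (X → ℝ)) :
    S.productWeight P (φ :: L) = S.intersect P φ (S.productWeight P L) := rfl

lemma productWeight_subdivision (hP : P.IsSubdivision S.complex) (hQ : Q.IsSubdivision P)
    (hL : ∀ φ ∈ L, P.IsPL φ) : S.productWeight Q L = P.pullback Q (S.productWeight P L) := by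
  have hPG := S.good_complex.of_isSubdivision hP
  induction L with
  | nil => exact (S.good_complex.pullback_pullback hP hQ S.weight).symm
  | cons φ L ih =>
    rw [productWeight_cons, productWeight_cons,
      ih fun φ hφ => hL φ (List.mem_cons_of_mem _ hφ),
      hPG.intersect_pullback hQ (hL φ List.mem_cons_self)]

lemma exists_isDefinedOn (hL : ∀ φ ∈ L, φ ∈ S.PL) : ∃ P, S.IsDefinedOn L P := by
  obtain ⟨P, hP, h⟩ := exists_isPL_of_list hL
  exact ⟨P, mem_complexes_of_isSubdivision hP, hP, h⟩

/-- The measure of a product can be computed on any complex on which it is defined. -/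
theorem cycleMeasure_eq (hP : S.IsDefinedOn L P) :
    S.cycleMeasure L = S.discreteMeasure P (S.productWeight P L) := by
  have key : ∀ P Q, S.IsDefinedOn L P → Q.IsSubdivision P →
      S.discreteMeasure Q (S.productWeight Q L) = S.discreteMeasure P (S.productWeight P L) := by
    intro P Q hP hQ
    rw [productWeight_subdivision hP.2.1 hQ hP.2.2,
      (S.good_complex.of_isSubdivision hP.2.1).discreteMeasure_pullback hQ]
  have h : ∃ P, S.IsDefinedOn L P := ⟨P, hP⟩
  rw [cycleMeasure, dif_pos h]
  obtain ⟨Q, hQ1, hQ2⟩ := S.good_complex.exists_common_subdivision h.choose_spec.2.1 hP.2.1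
  rw [← key _ Q h.choose_spec hQ1, ← key _ Q hP hQ2]

lemma productWeight_perm (hP : P.IsSubdivision S.complex) {L' : List (X → ℝ)}
    (hL : ∀ φ ∈ L, P.IsPL φ) (h : L.Perm L') :
    S.productWeight P L = S.productWeight P L' :=
  h.foldr_eq' (fun x hx y hy z =>
    (S.good_complex.of_isSubdivision hP).intersect_comm (hL y hy) (hL x hx) z) _

lemma cycleMeasure_perm (hL : ∀ φ ∈ L, φ ∈ S.PL) {L' : List (X → ℝ)} (h : L.Perm L') :
    S.cycleMeasure L = S.cycleMeasure L' := by
  obtain ⟨P, hP⟩ := exists_isDefinedOn hL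
  rw [cycleMeasure_eq hP, cycleMeasure_eq (L := L') (P := P)
    ⟨hP.1, hP.2.1, fun φ hφ => hP.2.2 φ (h.mem_iff.2 hφ)⟩, productWeight_perm hP.2.1 hP.2.2 h]

/-- Both sides are minus the degree of f · g · L · [X]. This integration by parts underlies
positivity, mass bounds and the Lipschitz estimate. -/
lemma cycleMeasure_swap {f g : X → ℝ} (hf : f ∈ S.PL) (hg : g ∈ S.PL) (hL : ∀ φ ∈ L, φ ∈ S.PL)
    {F G : C(S.sphere, ℝ)} (hF : ∀ x : S.sphere, F x = f x) (hG : ∀ x : S.sphere, G x = g x) :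
    S.cycleMeasure (f :: L) G = S.cycleMeasure (g :: L) F := by
  classical
  obtain ⟨P, hP⟩ := exists_isDefinedOn (S := S) (L := f :: g :: L) (by
    simp only [List.mem_cons]
    rintro φ (rfl | rfl | h)
    exacts [hf, hg, hL φ h])
  have hPG := S.good_complex.of_isSubdivision hP.2.1
  have hfP := hP.2.2 f (by simp)
  have hgP := hP.2.2 g (by simp)
  rw [cycleMeasure_eq (L := f :: L) (P := P) ⟨hP.1, hP.2.1, fun φ hφ => hP.2.2 φ (by
      rcases List.mem_cons.1 hφ with rfl | h <;> simp [*])⟩,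
    cycleMeasure_eq (L := g :: L) (P := P) ⟨hP.1, hP.2.1, fun φ hφ => hP.2.2 φ (by
      rcases List.mem_cons.1 hφ with rfl | h <;> simp [*])⟩,
    hPG.discreteMeasure_eq_neg_sum hgP _ G hG, hPG.discreteMeasure_eq_neg_sum hfP _ F hF,
    productWeight_cons, productWeight_cons, hPG.intersect_comm hgP hfP]

lemma cycleMeasure_sub {f g : X → ℝ} (hf : f ∈ S.PL) (hg : g ∈ S.PL) (hL : ∀ φ ∈ L, φ ∈ S.PL)
    (G : C(S.sphere, ℝ)) :
    S.cycleMeasure ((f - g) :: L) G = S.cycleMeasure (f :: L) G - S.cycleMeasure (g :: L) G := by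
  classical
  obtain ⟨P, hP⟩ := exists_isDefinedOn (S := S) (L := f :: g :: L) (by
    simp only [List.mem_cons]
    rintro φ (rfl | rfl | h)
    exacts [hf, hg, hL φ h])
  have hPG := S.good_complex.of_isSubdivision hP.2.1
  have hfP := hP.2.2 f (by simp)
  have hgP := hP.2.2 g (by simp)
  have hfg : P.IsPL (f - g) := fun σ hσ => (P.lin σ).sub_mem (hfP σ hσ) (hgP σ hσ)
  rw [cycleMeasure_eq (L := f :: L) (P := P) ⟨hP.1, hP.2.1, fun φ hφ => hP.2.2 φ (by
      rcases List.mem_cons.1 hφ with rfl | h <;> simp [*])⟩,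
    cycleMeasure_eq (L := g :: L) (P := P) ⟨hP.1, hP.2.1, fun φ hφ => hP.2.2 φ (by
      rcases List.mem_cons.1 hφ with rfl | h <;> simp [*])⟩,
    cycleMeasure_eq (L := (f - g) :: L) (P := P) ⟨hP.1, hP.2.1, fun φ hφ => by
      rcases List.mem_cons.1 hφ with rfl | h
      · exact hfg
      · exact hP.2.2 φ (by simp [h])⟩,
    productWeight_cons, productWeight_cons, productWeight_cons, hPG.intersect_sub hfP hgP,
    discreteMeasure_apply, discreteMeasure_apply, discreteMeasure_apply,
    ← Finset.sum_sub_distrib]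
  exact Finset.sum_congr rfl fun τ _ => by rw [Pi.sub_apply, sub_mul]

/-- The measure has finite support, so its integrals pass to pointwise limits of the integrand. -/
lemma exists_continuous_cycleMeasure (hL : ∀ φ ∈ L, φ ∈ S.PL) :
    ∃ D : (X → ℝ) → ℝ, Continuous D ∧ ∀ (g : X → ℝ) (G : C(S.sphere, ℝ)),
      (∀ x : S.sphere, G x = g x) → S.cycleMeasure L G = D g := by
  obtain ⟨P, hP⟩ := exists_isDefinedOn hL
  rw [cycleMeasure_eq hP]
  exact exists_continuous_discreteMeasure _

lemma cycleMeasure_nonneg (hL : S.IsPositiveProduct L) {G : C(S.sphere, ℝ)}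
    (hG : ∀ x, 0 ≤ G x) : 0 ≤ S.cycleMeasure L G := by
  obtain ⟨P, hP, hpos⟩ := hL
  rw [cycleMeasure_eq hP]
  exact (S.good_complex.of_isSubdivision hP.2.1).discreteMeasure_nonneg hpos hG

/-- The weight of a positive product is nonnegative on all sufficiently fine complexes. -/
lemma exists_productWeight_nonneg (hL : S.IsPositiveProduct L) : ∃ P, S.IsDefinedOn L P ∧
    ∀ Q : ConicalComplex X, Q.IsSubdivision P → ∀ σ, 0 ≤ S.productWeight Q L σ := by
  classical
  obtain ⟨P, hP, hpos⟩ := hL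
  refine ⟨P, hP, fun Q hQ σ => ?_⟩
  rw [productWeight_subdivision hP.2.1 hQ hP.2.2, ConicalComplex.pullback]
  exact Finset.sum_nonneg fun τ _ => hpos τ

end BalancedSpace

/-! ### Multiplication by min(ℓ, 0) -/

namespace EuclideanConicalSpace

variable {X N : Type*} [TopologicalSpace X] [NormedAddCommGroup N] [InnerProductSpace ℝ N]
  {S : EuclideanConicalSpace X N} {P Q : ConicalComplex X}
  {σ τ ρ : Set X} {φ ψ : X → ℝ}

local notation "⟪" x ", " y "⟫" => inner ℝ x y

/-- The tropical polynomial `min(ℓ, 0)`. -/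
def trop (S : EuclideanConicalSpace X N) (ℓ : Module.Dual ℝ N) : X → ℝ :=
  fun x => min (ℓ (S.ι x)) 0

variable [FiniteDimensional ℝ N]

namespace Good

lemma isPL_trop (hP : S.Good P) {ℓ : Module.Dual ℝ N} (h : S.SignConst P ℓ) :
    P.IsPL (S.trop ℓ) := by
  refine hP.isPL_iff.2 fun σ hσ => ?_
  rcases h σ hσ with h | h
  · exact ⟨0, fun x hx => by simp [trop, h x hx]⟩
  · exact ⟨ℓ, fun x hx => by simp [trop, h x hx]⟩

/-- The normal vector in terms of a point of the cone off the face. -/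
lemma exists_normalVector_eq (hP : S.Good P) (hσ : σ ∈ P.cones) (hτ : τ ∈ P.cones) (hs : τ ⊆ σ)
    (hd : P.dim σ = P.dim τ + 1) {x : X} (hx : x ∈ σ) (hxτ : x ∉ τ) :
    ∃ a : ℝ, 0 < a ∧ ∃ w ∈ S.spanOf τ, S.ι x = a • S.normalVector σ τ + w :=
  ⟨_, hP.inner_normalVector_pos hσ hτ hs hd hx hxτ, _,
    hP.sub_inner_smul_mem hσ hτ hs hd (mem_spanOf hx), by abel⟩

lemma exists_mem_notMem (hP : S.Good P) (hσ : σ ∈ P.cones) (hτ : τ ∈ P.cones)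
    (hd : P.dim σ = P.dim τ + 1) : ∃ x ∈ σ, x ∉ τ := by
  by_contra! h
  have := hP.dim_le hτ hσ h
  omega

lemma apply_normalVector_nonpos (hP : S.Good P) (hσ : σ ∈ P.cones) (hτ : τ ∈ P.cones)
    (hs : τ ⊆ σ) (hd : P.dim σ = P.dim τ + 1) {ℓ : Module.Dual ℝ N}
    (h0 : ∀ x ∈ τ, ℓ (S.ι x) = 0) (h : ∀ x ∈ σ, ℓ (S.ι x) ≤ 0) :
    ℓ (S.normalVector σ τ) ≤ 0 ∧
      ((∃ x ∈ σ, ℓ (S.ι x) < 0) → ℓ (S.normalVector σ τ) < 0) := by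
  have key : ∀ x ∈ σ, x ∉ τ → ∃ a : ℝ, 0 < a ∧ ℓ (S.ι x) = a * ℓ (S.normalVector σ τ) := by
    intro x hx hxτ
    obtain ⟨a, ha, w, hw, he⟩ := hP.exists_normalVector_eq hσ hτ hs hd hx hxτ
    exact ⟨a, ha, by rw [he]; simp [eq_zero_of_mem_spanOf h0 hw]⟩
  constructor
  · obtain ⟨x, hx, hxτ⟩ := hP.exists_mem_notMem hσ hτ hd
    obtain ⟨a, ha, he⟩ := key x hx hxτ
    have := h x hx
    by_contra! hc
    nlinarith [mul_pos ha hc]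
  · rintro ⟨x, hx, hlt⟩
    obtain ⟨a, ha, he⟩ := key x hx fun hxτ => by rw [h0 x hxτ] at hlt; exact lt_irrefl _ hlt
    by_contra! hc
    nlinarith [mul_nonneg ha.le hc]

lemma intersect_trop_term_nonneg (hP : S.Good P) {ℓ : Module.Dual ℝ N} (hℓ : S.SignConst P ℓ)
    {c : P.Weight} (hc : ∀ σ, 0 ≤ c σ) {τ : {τ // τ ∈ P.cones}} (h0 : ∀ x ∈ τ.1, ℓ (S.ι x) = 0)
    (σ : {σ // σ ∈ P.cones}) (hd : P.dim σ.1 = P.dim τ.1 + 1) (hs : τ.1 ⊆ σ.1) :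
    0 ≤ -(S.linearExtension (S.trop ℓ) σ.1 (S.normalVector σ.1 τ.1)) * c σ := by
  have hv := hP.mem_spanOf_normalVector σ.2 τ.2 hs hd
  refine mul_nonneg ?_ (hc σ)
  rcases hℓ σ.1 σ.2 with h | h
  · rw [linearExtension_eq (ℓ := 0) (fun x hx => by simp [trop, h x hx]) hv]; simp
  · rw [linearExtension_eq (ℓ := ℓ) (fun x hx => by simp [trop, h x hx]) hv]
    have := (hP.apply_normalVector_nonpos σ.2 τ.2 hs hd h0 h).1
    linarith

/-- Where ℓ vanishes on τ, the slope of min(ℓ, 0) into each adjacent cone is nonpositive, so every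
term is nonnegative. Elsewhere min(ℓ, 0) is one linear function, ℓ or 0, on all cones around τ, and
balancing makes the product zero. -/
lemma intersect_trop_nonneg (hP : S.Good P) {ℓ : Module.Dual ℝ N} (hℓ : S.SignConst P ℓ)
    {c : P.Weight} (hc : ∀ σ, 0 ≤ c σ) (hb : S.Balanced P c) (τ : {τ // τ ∈ P.cones}) :
    0 ≤ S.intersect P (S.trop ℓ) c τ := by
  classical
  by_cases h0 : ∀ x ∈ τ.1, ℓ (S.ι x) = 0
  · rw [hP.intersect_apply]
    refine Finset.sum_nonneg fun σ hσ => ?_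
    rw [Finset.mem_filter] at hσ
    exact hP.intersect_trop_term_nonneg hℓ hc h0 σ hσ.2.1 hσ.2.2
  push Not at h0
  obtain ⟨x, hx, hx0⟩ := h0
  have key : ∀ m : Module.Dual ℝ N, (∀ σ ∈ P.cones, τ.1 ⊆ σ → ∀ y ∈ σ,
      S.trop ℓ y = m (S.ι y)) → S.intersect P (S.trop ℓ) c τ = 0 := by
    intro m hm
    have := congrFun (hb m) τ
    rw [hP.intersect_apply] at this ⊢
    rw [Pi.zero_apply] at this
    rw [← this]
    refine Finset.sum_congr rfl fun σ hσ => ?_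
    rw [Finset.mem_filter] at hσ
    have hv := hP.mem_spanOf_normalVector σ.2 τ.2 hσ.2.2 hσ.2.1
    rw [linearExtension_eq (hm σ.1 σ.2 hσ.2.2) hv, linearExtension_eq (ℓ := m) (fun _ _ => rfl) hv]
  refine (key (if ℓ (S.ι x) < 0 then ℓ else 0) fun σ hσ hs y hy => ?_).ge
  rcases hℓ σ hσ with h | h
  · rw [if_neg (not_lt.2 (h x (hs hx)))]; simp [trop, h y hy]
  · rw [if_pos (lt_of_le_of_ne (h x (hs hx)) hx0)]; simp [trop, h y hy]

/-- The term of σ is strictly positive and the others are nonnegative. This keeps the weight alive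
on the slice when the dimension is lowered. -/
lemma intersect_trop_pos (hP : S.Good P) {ℓ : Module.Dual ℝ N} (hℓ : S.SignConst P ℓ)
    {c : P.Weight} (hc : ∀ σ, 0 ≤ c σ) {τ σ : {τ // τ ∈ P.cones}}
    (h0 : ∀ x ∈ τ.1, ℓ (S.ι x) = 0) (hd : P.dim σ.1 = P.dim τ.1 + 1) (hs : τ.1 ⊆ σ.1)
    (hσ : 0 < c σ) (h : ∀ x ∈ σ.1, ℓ (S.ι x) ≤ 0) (hlt : ∃ x ∈ σ.1, ℓ (S.ι x) < 0) :
    0 < S.intersect P (S.trop ℓ) c τ := by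
  classical
  rw [hP.intersect_apply]
  refine Finset.sum_pos' (fun κ hκ => ?_) ⟨σ, by simpa [hd] using hs, ?_⟩
  · rw [Finset.mem_filter] at hκ
    exact hP.intersect_trop_term_nonneg hℓ hc h0 κ hκ.2.1 hκ.2.2
  · have hv := hP.mem_spanOf_normalVector σ.2 τ.2 hs hd
    rw [linearExtension_eq (ℓ := ℓ) (fun x hx => by simp [trop, h x hx]) hv]
    have := (hP.apply_normalVector_nonpos σ.2 τ.2 hs hd h0 h).2 hlt
    exact mul_pos (by linarith) hσ

lemma intersect_eq_zero_of_dim_ne (hP : S.Good P) {k : ℕ} {c : P.Weight}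
    (hc : ∀ σ, P.dim σ.1 ≠ k → c σ = 0) (φ : X → ℝ) {τ : {τ // τ ∈ P.cones}}
    (hτ : P.dim τ.1 + 1 ≠ k) : S.intersect P φ c τ = 0 := by
  classical
  rw [hP.intersect_apply]
  refine Finset.sum_eq_zero fun σ hσ => ?_
  rw [Finset.mem_filter] at hσ
  rw [hc σ (by omega), mul_zero]

/-! ### Cutting a cone with a hyperplane through an interior point -/

/-- A nonzero sign of ℓ at q persists under small moves; if ℓ vanishes at q, the move stays in the
hyperplane. -/
lemma exists_move_halfSpace (hP : S.Good P) (hσ : σ ∈ P.cones) {ℓ : Module.Dual ℝ N}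
    {i : SignType} {q : X} (hq : S.Inner σ q) (hi : SignType.sign (ℓ (S.ι q)) = i) {w : N}
    (hw : w ∈ S.spanOf σ) (hw0 : i = 0 → ℓ w = 0) :
    ∃ ε : ℝ, 0 < ε ∧ ∃ z ∈ σ ∩ S.halfSpace ℓ i, S.ι z = S.ι q + ε • w := by
  obtain ⟨ε, hε, h⟩ := hP.exists_move hσ hq hw
  have hlim : Tendsto (fun t : ℝ => ℓ (S.ι q) + t * ℓ w) (𝓝[>] 0) (𝓝 (ℓ (S.ι q))) := by
    have : Continuous fun t : ℝ => ℓ (S.ι q) + t * ℓ w := by fun_prop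
    exact (this.tendsto' 0 _ (by simp)).mono_left nhdsWithin_le_nhds
  have hev : ∀ᶠ t in 𝓝[>] (0 : ℝ), (i ≠ 1 → ℓ (S.ι q) + t * ℓ w ≤ 0) ∧
      (i ≠ -1 → 0 ≤ ℓ (S.ι q) + t * ℓ w) := by
    rcases lt_trichotomy (ℓ (S.ι q)) 0 with h0 | h0 | h0
    · rw [sign_neg h0] at hi
      filter_upwards [hlim.eventually_lt_const h0] with t ht
      exact ⟨fun _ => ht.le, fun h => absurd hi.symm h⟩
    · rw [h0, sign_zero] at hi
      simp [h0, hw0 hi.symm]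
    · rw [sign_pos h0] at hi
      filter_upwards [hlim.eventually_const_lt h0] with t ht
      exact ⟨fun h => absurd hi.symm h, fun _ => ht.le⟩
  obtain ⟨t, ht, ht0, hti⟩ := (hev.and (Ioc_mem_nhdsGT hε)).exists
  obtain ⟨z, hz, hzι⟩ := h t (by rwa [abs_of_pos ht0])
  exact ⟨t, ht0, z, ⟨hz, by simpa [halfSpace, hzι] using ht⟩, hzι⟩

lemma inner_halfSpace (hP : S.Good P) (hσ : σ ∈ P.cones) {ℓ : Module.Dual ℝ N} {i : SignType}
    {q : X} (hq : S.Inner σ q) (hi : SignType.sign (ℓ (S.ι q)) = i) :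
    S.Inner (σ ∩ S.halfSpace ℓ i) q := by
  have hqi : q ∈ S.halfSpace ℓ i := by
    subst hi
    constructor
    · intro h; by_contra! hc; exact h (sign_pos hc)
    · intro h; by_contra! hc; exact h (sign_neg hc)
  refine ⟨⟨hq.1, hqi⟩, fun m hm hmq y hy => le_antisymm ?_ (hm y hy)⟩
  obtain ⟨ε, hε, z, hz, hzι⟩ := hP.exists_move_halfSpace hσ hq hi
    (neg_mem (mem_spanOf hy.1)) (fun h => by
      have := hy.2
      simp only [halfSpace, h, Set.mem_ofPred_eq] at this
      rw [map_neg, neg_eq_zero]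
      exact le_antisymm (this.1 (by decide)) (this.2 (by decide)))
  have := hm z hz
  rw [hzι] at this
  simp only [smul_neg, map_add, hmq, map_neg, map_smul, smul_eq_mul, zero_add] at this
  by_contra! hc
  nlinarith [mul_pos hε hc]

lemma mem_spanOf_halfSpace (hP : S.Good P) (hσ : σ ∈ P.cones) {ℓ : Module.Dual ℝ N}
    {i : SignType} {q : X} (hq : S.Inner σ q) (hi : SignType.sign (ℓ (S.ι q)) = i) {w : N}
    (hw : w ∈ S.spanOf σ) (hw0 : i = 0 → ℓ w = 0) : w ∈ S.spanOf (σ ∩ S.halfSpace ℓ i) := by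
  obtain ⟨ε, hε, z, hz, hzι⟩ := hP.exists_move_halfSpace hσ hq hi hw hw0
  have h1 := sub_mem (mem_spanOf (S := S) hz) (mem_spanOf (hP.inner_halfSpace hσ hq hi).1)
  rw [hzι, add_sub_cancel_left] at h1
  simpa [hε.ne'] using Submodule.smul_mem _ ε⁻¹ h1

lemma halfSpace_mem_cut (hP : S.Good P) (hσ : σ ∈ P.cones) (ℓ : Module.Dual ℝ N) (i : SignType) :
    σ ∩ S.halfSpace ℓ i ∈ (hP.cut ℓ).cones := (hP.mem_cut_cones ℓ).2 ⟨σ, hσ, i, rfl⟩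

lemma good_cut (hP : S.Good P) (ℓ : Module.Dual ℝ N) : S.Good (hP.cut ℓ) :=
  hP.of_isSubdivision (hP.cut_isSubdivision ℓ)

lemma dim_halfSpace (hP : S.Good P) (hσ : σ ∈ P.cones) {ℓ : Module.Dual ℝ N} {i : SignType}
    {q : X} (hq : S.Inner σ q) (hi : SignType.sign (ℓ (S.ι q)) = i) (h0 : i ≠ 0) :
    (hP.cut ℓ).dim (σ ∩ S.halfSpace ℓ i) = P.dim σ := by
  rw [(hP.good_cut ℓ).dim_eq (hP.halfSpace_mem_cut hσ ℓ i), hP.dim_eq hσ]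
  have : S.spanOf (σ ∩ S.halfSpace ℓ i) = S.spanOf σ :=
    le_antisymm (spanOf_mono Set.inter_subset_left)
      fun w hw => hP.mem_spanOf_halfSpace hσ hq hi hw fun h => absurd h h0
  rw [this]

lemma pullback_halfSpace (hP : S.Good P) (hσ : σ ∈ P.cones) {ℓ : Module.Dual ℝ N} {i : SignType}
    {q : X} (hq : S.Inner σ q) (hi : SignType.sign (ℓ (S.ι q)) = i) (h0 : i ≠ 0)
    (c : P.Weight) :
    P.pullback (hP.cut ℓ) c ⟨_, hP.halfSpace_mem_cut hσ ℓ i⟩ = c ⟨σ, hσ⟩ := by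
  rw [hP.pullback_apply (hP.cut_isSubdivision ℓ) c (σ := ⟨σ, hσ⟩)
    (hP.inner_halfSpace hσ hq hi) hq, if_pos (hP.dim_halfSpace hσ hq hi h0).symm]

lemma dim_hyperplane (hP : S.Good P) (hσ : σ ∈ P.cones) {ℓ : Module.Dual ℝ N} {q : X}
    (hq : S.Inner σ q) (hi : ℓ (S.ι q) = 0) {y : X} (hy : y ∈ σ) (hy0 : ℓ (S.ι y) ≠ 0) :
    P.dim σ = (hP.cut ℓ).dim (σ ∩ S.halfSpace ℓ 0) + 1 := by
  rw [(hP.good_cut ℓ).dim_eq (hP.halfSpace_mem_cut hσ ℓ 0), hP.dim_eq hσ]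
  have hsp : S.spanOf (σ ∩ S.halfSpace ℓ 0) =
      (LinearMap.ker (ℓ ∘ₗ (S.spanOf σ).subtype)).map (S.spanOf σ).subtype := by
    ext w
    simp only [Submodule.mem_map, LinearMap.mem_ker, LinearMap.comp_apply, Submodule.subtype_apply,
      Subtype.exists, exists_and_left, exists_prop, exists_eq_right_right]
    constructor
    · intro hw
      refine ⟨eq_zero_of_mem_spanOf (fun x hx => ?_) hw, spanOf_mono Set.inter_subset_left hw⟩
      exact le_antisymm (hx.2.1 (by decide)) (hx.2.2 (by decide))
    · rintro ⟨h1, h2⟩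
      exact hP.mem_spanOf_halfSpace hσ hq (by rw [hi, sign_zero]) h2 fun _ => h1
  rw [hsp, Submodule.finrank_map_subtype_eq,
    ← LinearMap.finrank_range_add_finrank_ker (ℓ ∘ₗ (S.spanOf σ).subtype), add_comm]
  congr 1
  have : LinearMap.range (ℓ ∘ₗ (S.spanOf σ).subtype) = ⊤ := by
    refine LinearMap.range_eq_top.2 (LinearMap.surjective ?_)
    intro h
    exact hy0 (LinearMap.congr_fun h ⟨_, mem_spanOf hy⟩)
  rw [this, finrank_top, Module.finrank_self]

end Good

/-! ### Test weights -/

/-- A balanced nonnegative weight of dimension `k` on which the functions in `C` act as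
superharmonic functions. -/
structure IsTest (S : EuclideanConicalSpace X N) (C : Set (X → ℝ)) (P : ConicalComplex X) (k : ℕ)
    (c : P.Weight) : Prop where
  balanced : S.Balanced P c
  nonneg : ∀ σ, 0 ≤ c σ
  eq_zero : ∀ σ, P.dim σ.1 ≠ k → c σ = 0
  pos : ∀ φ ∈ C, ∃ Q : ConicalComplex X, Q.IsSubdivision P ∧ Q.IsPL φ ∧
    ∀ R : ConicalComplex X, R.IsSubdivision Q → ∀ τ, 0 ≤ S.intersect R φ (P.pullback R c) τ

lemma pullback_nonneg {c : P.Weight} (hc : ∀ σ, 0 ≤ c σ) (σ : {σ // σ ∈ Q.cones}) :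
    0 ≤ P.pullback Q c σ := by
  classical
  exact Finset.sum_nonneg fun _ _ => hc _

lemma pullback_eq_zero {c : P.Weight} {k : ℕ} (hc : ∀ σ, P.dim σ.1 ≠ k → c σ = 0)
    {σ : {σ // σ ∈ Q.cones}} (hσ : Q.dim σ.1 ≠ k) : P.pullback Q c σ = 0 := by
  classical
  refine Finset.sum_eq_zero fun κ hκ => hc κ ?_
  rw [Finset.mem_filter] at hκ
  omega

lemma Good.balanced_pullback (hP : S.Good P) (hQ : Q.IsSubdivision P) {c : P.Weight}
    (hc : S.Balanced P c) : S.Balanced Q (P.pullback Q c) := by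
  classical
  intro ℓ
  rw [hP.intersect_pullback hQ (hP.1 ℓ), hc ℓ]
  ext σ
  exact Finset.sum_eq_zero fun _ _ => rfl

variable {C : Set (X → ℝ)} {k : ℕ} {c : P.Weight}

lemma IsTest.pullback (hP : S.Good P) (h : S.IsTest C P k c) (hQ : Q.IsSubdivision P) :
    S.IsTest C Q k (P.pullback Q c) where
  balanced := hP.balanced_pullback hQ h.balanced
  nonneg := pullback_nonneg h.nonneg
  eq_zero _ hσ := pullback_eq_zero h.eq_zero hσ
  pos φ hφ := by
    obtain ⟨Q₀, hQ₀, hPL, hpos⟩ := h.pos φ hφ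
    obtain ⟨Q₁, h₁, h₂⟩ := hP.exists_common_subdivision hQ₀ hQ
    refine ⟨Q₁, h₂, hPL.of_isSubdivision h₁, fun R hR τ => ?_⟩
    rw [hP.pullback_pullback hQ (hR.trans h₂)]
    exact hpos R (hR.trans h₁) τ

/-- By commutativity φ · (min(ℓ, 0) · c) = min(ℓ, 0) · (φ · c), and φ · c is again nonnegative and
balanced. Truncated subtraction is harmless: for k = 0 the product is zero. -/
lemma IsTest.intersect_trop (hP : S.Good P) (h : S.IsTest C P k c) {ℓ : Module.Dual ℝ N}
    (hℓ : S.SignConst P ℓ) : S.IsTest C P (k - 1) (S.intersect P (S.trop ℓ) c) where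
  balanced := hP.balanced_intersect (hP.isPL_trop hℓ) h.balanced
  nonneg := hP.intersect_trop_nonneg hℓ h.nonneg h.balanced
  eq_zero σ hσ := hP.intersect_eq_zero_of_dim_ne h.eq_zero _ (by omega)
  pos φ hφ := by
    obtain ⟨Q₀, hQ₀, hPL, hpos⟩ := h.pos φ hφ
    refine ⟨Q₀, hQ₀, hPL, fun R hR τ => ?_⟩
    have hRP := hR.trans hQ₀
    have hRG := hP.of_isSubdivision hRP
    have hR' := hℓ.of_isSubdivision hRP
    rw [← hP.intersect_pullback hRP (hP.isPL_trop hℓ), hRG.intersect_comm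
      (hPL.of_isSubdivision hR) (hRG.isPL_trop hR')]
    exact hRG.intersect_trop_nonneg hR' (hpos R hR)
      (hRG.balanced_intersect (hPL.of_isSubdivision hR) (hP.balanced_pullback hRP h.balanced)) τ

end EuclideanConicalSpace

/-- A continuous function on an interval that is locally piecewise linear with decreasing slopes
satisfies the midpoint inequality. -/
lemma add_le_two_mul_of_local_slopes {f : ℝ → ℝ} (hf : ContinuousOn f (Set.Icc 0 1))
    (h : ∀ t ∈ Set.Ioo (0 : ℝ) 1, ∃ ε : ℝ, 0 < ε ∧ ∃ r l : ℝ, r ≤ l ∧ ∀ s ∈ Set.Icc 0 ε,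
      (t + s ∈ Set.Icc (0 : ℝ) 1 → f (t + s) = f t + s * r) ∧
      (t - s ∈ Set.Icc (0 : ℝ) 1 → f (t - s) = f t - s * l)) : f 0 + f 1 ≤ 2 * f (1 / 2) := by
  by_contra! hcon
  set d := f 1 - f 0 with hd
  set g : ℝ → ℝ := fun t => f t - f 0 - t * d with hg
  have hgc : ContinuousOn g (Set.Icc 0 1) := by fun_prop
  have hhalf : (1 / 2 : ℝ) ∈ Set.Icc (0 : ℝ) 1 := by norm_num
  obtain ⟨t₀, ht₀, hmin⟩ := isCompact_Icc.exists_isMinOn ⟨_, hhalf⟩ hgc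
  have hneg : g t₀ < 0 := by
    have : g (1 / 2) < 0 := by simp only [hg, hd]; linarith
    exact (hmin hhalf).trans_lt this
  -- g is f minus its chord. At the last point where it takes its negative minimum, r ≥ d ≥ l ≥ r,
  -- so g stays minimal a little further to the right, a contradiction.
  have hK : IsCompact (Set.Icc (0 : ℝ) 1 ∩ g ⁻¹' {g t₀}) :=
    isCompact_Icc.of_isClosed_subset (hgc.preimage_isClosed_of_isClosed isClosed_Icc
      isClosed_singleton) Set.inter_subset_left
  obtain ⟨t, ⟨⟨ht0, ht1⟩, hgt⟩, hub⟩ := hK.exists_isGreatest ⟨t₀, ht₀, rfl⟩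
  have hgt : g t = g t₀ := hgt
  have e0 : t ≠ 0 := by rintro rfl; simp only [hg] at hgt hneg; linarith
  have e1 : t ≠ 1 := by rintro rfl; simp only [hg, hd] at hgt hneg; linarith
  have ht0' := lt_of_le_of_ne ht0 e0.symm
  have ht1' := lt_of_le_of_ne ht1 e1
  obtain ⟨ε, hε, r, l, hrl, hs⟩ := h t ⟨ht0', ht1'⟩
  set s := min ε (min t (1 - t)) with hs'
  have hs0 : 0 < s := lt_min hε (lt_min ht0' (by linarith))
  have hs1 : s ≤ t := (min_le_right _ _).trans (min_le_left _ _)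
  have hs2 : s ≤ 1 - t := (min_le_right _ _).trans (min_le_right _ _)
  have m1 : t + s ∈ Set.Icc (0 : ℝ) 1 := ⟨by linarith, by linarith⟩
  have m2 : t - s ∈ Set.Icc (0 : ℝ) 1 := ⟨by linarith, by linarith⟩
  have f1 := (hs s ⟨hs0.le, min_le_left _ _⟩).1 m1
  have f2 := (hs s ⟨hs0.le, min_le_left _ _⟩).2 m2
  have g1 : g t₀ ≤ g (t + s) := hmin m1
  have g2 : g t₀ ≤ g (t - s) := hmin m2
  have e1 : g (t + s) = g t₀ + s * (r - d) := by rw [← hgt]; simp only [hg, f1]; ring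
  have e2 : g (t - s) = g t₀ - s * (l - d) := by rw [← hgt]; simp only [hg, f2]; ring
  have h1 : d ≤ r := by by_contra! hc; nlinarith
  have h2 : l ≤ d := by by_contra! hc; nlinarith
  have h3 : g (t + s) = g t₀ := by rw [e1, le_antisymm (hrl.trans h2) h1]; ring
  have := hub ⟨m1, h3⟩
  linarith

lemma ConicalComplex.IsPL.continuous {X : Type*} [TopologicalSpace X] {P : ConicalComplex X}
    {φ : X → ℝ} (hφ : P.IsPL φ) : Continuous φ := by
  refine (locallyFinite_of_finite fun σ : {σ // σ ∈ P.cones} => σ.1).continuous ?_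
    (fun σ => P.isClosed σ.1 σ.2) ?_
  · have := P.cover
    rw [Set.sUnion_eq_iUnion] at this
    exact this
  · intro σ
    rw [continuousOn_iff_continuous_domRestrict]
    exact P.continuous_lin σ.1 σ.2 _ (hφ σ.1 σ.2)

/-! ### Slicing down to dimension two -/

namespace EuclideanConicalSpace

variable {X N : Type*} [TopologicalSpace X] [NormedAddCommGroup N] [InnerProductSpace ℝ N]
  [FiniteDimensional ℝ N] {S : EuclideanConicalSpace X N} {P Q : ConicalComplex X}
  {σ τ ρ : Set X} {φ ψ : X → ℝ} {C : Set (X → ℝ)} {k : ℕ}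

local notation "⟪" x ", " y "⟫" => inner ℝ x y

namespace Good

lemma exists_inner_move (hP : S.Good P) (hσ : σ ∈ P.cones) {x : X} (hx : S.Inner σ x) {w : N}
    (hw : w ∈ S.spanOf σ) : ∃ ε : ℝ, 0 < ε ∧ ∃ z, S.Inner σ z ∧ S.ι z = S.ι x + ε • w := by
  obtain ⟨ε, hε, h⟩ := hP.exists_move hσ hx hw
  obtain ⟨y, hy, hyι⟩ := h ε (abs_of_pos hε).le
  obtain ⟨z, hz, hzι⟩ := hP.exists_comb hσ hx.1 hy (a := 1 / 2) (b := 1 / 2) (by norm_num)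
    (by norm_num)
  refine ⟨ε / 2, by positivity, z, hx.of_comb hy hz (by norm_num) (by norm_num) hzι, ?_⟩
  rw [hzι, hyι]
  module

end Good

/-- Lower the dimension by one repeatedly: take ℓ vanishing at x and p but not on σ, cut with its
hyperplane and multiply by min(ℓ, 0). The slice of σ keeps a positive weight, because σ ∩ {ℓ ≤ 0}
has one. Questions about φ at x in the direction of p are thus reduced to a two-dimensional weight.
-/
theorem IsTest.exists_slice {x p : X} (j : ℕ) : ∀ {P : ConicalComplex X} {c : P.Weight},
    S.Good P → S.IsTest C P (j + 2) c → ∀ {σ : Set X} (hσ : σ ∈ P.cones), P.dim σ = j + 2 →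
    0 < c ⟨σ, hσ⟩ → S.Inner σ p → x ∈ σ → ∃ Q : ConicalComplex X, Q.IsSubdivision P ∧
      ∃ d : Q.Weight, S.IsTest C Q 2 d ∧ ∃ (κ : Set X) (hκ : κ ∈ Q.cones), Q.dim κ = 2 ∧
        0 < d ⟨κ, hκ⟩ ∧ S.Inner κ p ∧ x ∈ κ ∧ κ ⊆ σ ∧ (S.Inner σ x → S.Inner κ x) := by
  induction j with
  | zero =>
    intro P c hP hc σ hσ hd hpos hp hx
    exact ⟨P, .refl P, c, hc, σ, hσ, hd, hpos, hp, hx, subset_rfl, id⟩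
  | succ j ih =>
    intro P c hP hc σ hσ hd hpos hp hx
    obtain ⟨y, hy, hyn⟩ : ∃ y ∈ σ, S.ι y ∉ Submodule.span ℝ {S.ι x, S.ι p} := by
      by_contra! hcon
      have h1 : S.spanOf σ ≤ Submodule.span ℝ {S.ι x, S.ι p} := by
        refine Submodule.span_le.2 ?_
        rintro _ ⟨y, hy, rfl⟩
        exact hcon y hy
      have h2 := Submodule.finrank_mono h1
      rw [← hP.dim_eq hσ, hd] at h2
      have h3 : Module.finrank ℝ (Submodule.span ℝ {S.ι x, S.ι p}) ≤ 2 := by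
        classical
        have := finrank_span_finset_le_card (R := ℝ) ({S.ι x, S.ι p} : Finset N)
        rw [Finset.coe_pair] at this
        exact this.trans Finset.card_le_two
      omega
    obtain ⟨ℓ, hℓy, hℓ⟩ := Submodule.exists_dual_map_eq_bot_of_notMem hyn inferInstance
    have hker : ∀ v ∈ Submodule.span ℝ {S.ι x, S.ι p}, ℓ v = 0 := fun v hv =>
      (Submodule.map_le_iff_le_comap.1 hℓ.le) hv
    have hℓx : ℓ (S.ι x) = 0 := hker _ (Submodule.subset_span (by simp))
    have hℓp : ℓ (S.ι p) = 0 := hker _ (Submodule.subset_span (by simp))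
    -- With q = p - ε ℓ(y) y one has ℓ(q) = -ε ℓ(y)² < 0, so the part of σ where ℓ ≤ 0 is
    -- full-dimensional.
    obtain ⟨ε, hε, q, hq, hqι⟩ := hP.exists_inner_move hσ hp
      (Submodule.smul_mem _ (-ℓ (S.ι y)) (mem_spanOf hy))
    have hq0 : ℓ (S.ι q) < 0 := by
      rw [hqι, map_add, hℓp, map_smul, map_smul]
      simp only [smul_eq_mul, zero_add]
      have := mul_pos hε (mul_self_pos.2 hℓy)
      linarith
    have hQ := hP.cut_isSubdivision ℓ
    have hQG := hP.good_cut ℓ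
    have hsign := hP.signConst_cut ℓ
    have hneg : SignType.sign (ℓ (S.ι q)) = -1 := sign_neg hq0
    have hdim0 := hP.dim_hyperplane hσ hp hℓp hy hℓy
    have hdim1 := hP.dim_halfSpace hσ hq hneg (by decide)
    have hinner := hP.inner_halfSpace hσ hq hneg
    have hmem0 := hP.halfSpace_mem_cut hσ ℓ 0
    have hpos' : 0 < S.intersect (hP.cut ℓ) (S.trop ℓ) (P.pullback (hP.cut ℓ) c) ⟨_, hmem0⟩ := by
      refine hQG.intersect_trop_pos hsign (hc.pullback hP hQ).nonneg
        (σ := ⟨_, hP.halfSpace_mem_cut hσ ℓ (-1)⟩) ?_ ?_ ?_ ?_ ?_ ?_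
      · intro z hz
        exact le_antisymm (hz.2.1 (by decide)) (hz.2.2 (by decide))
      · rw [hdim1]; exact hdim0
      · intro z hz
        exact ⟨hz.1, fun _ => hz.2.1 (by decide), fun h => absurd rfl h⟩
      · rw [hP.pullback_halfSpace hσ hq hneg (by decide)]; exact hpos
      · intro z hz; exact hz.2.1 (by decide)
      · exact ⟨q, hinner.1, hq0⟩
    have hx0 : x ∈ σ ∩ S.halfSpace ℓ 0 := ⟨hx, fun _ => hℓx.le, fun _ => hℓx.ge⟩
    obtain ⟨R, hR, d, hd', κ, hκ, h1, h2, h3, h4, h5, h6⟩ := ih hQG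
      ((hc.pullback hP hQ).intersect_trop hQG hsign) hmem0 (by omega) hpos'
      (hP.inner_halfSpace hσ hp (by rw [hℓp, sign_zero])) hx0
    exact ⟨R, hR.trans hQ, d, hd', κ, hκ, h1, h2, h3, h4, h5.trans Set.inter_subset_left,
      fun h => h6 (hP.inner_halfSpace hσ h (by rw [hℓx, sign_zero]))⟩

namespace Good

/-- A linear functional on a plane that vanishes exactly on the line through `x`. -/
lemma exists_functional_of_dim_eq_two (hP : S.Good P) (hσ : σ ∈ P.cones) (hd : P.dim σ = 2)
    {x p : X} (hx : x ∈ σ) (hp : p ∈ σ) (hx0 : S.ι x ≠ 0) (hpx : S.ι p ∉ Submodule.span ℝ {S.ι x}) :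
    ∃ m : Module.Dual ℝ N, m (S.ι x) = 0 ∧ 0 < m (S.ι p) ∧
      ∀ v ∈ S.spanOf σ, m v = 0 → v ∈ Submodule.span ℝ {S.ι x} := by
  obtain ⟨m, hmp, hm⟩ := Submodule.exists_dual_map_eq_bot_of_notMem hpx inferInstance
  have hmx : m (S.ι x) = 0 :=
    (Submodule.map_le_iff_le_comap.1 hm.le) (Submodule.mem_span_singleton_self _)
  have key : ∀ v ∈ S.spanOf σ, m v = 0 → v ∈ Submodule.span ℝ {S.ι x} := by
    have h1 : Submodule.span ℝ {S.ι x} ≤ S.spanOf σ ⊓ LinearMap.ker m := by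
      rw [Submodule.span_singleton_le_iff_mem]
      exact ⟨mem_spanOf hx, hmx⟩
    have h2 : S.spanOf σ ⊓ LinearMap.ker m < S.spanOf σ :=
      lt_of_le_of_ne inf_le_left fun h => hmp (inf_eq_left.1 h (mem_spanOf hp))
    have h3 := Submodule.finrank_lt_finrank_of_lt h2
    rw [← hP.dim_eq hσ, hd] at h3
    have h4 := Submodule.eq_of_le_of_finrank_le h1 (by rw [finrank_span_singleton hx0]; omega)
    intro v hv hmv
    rw [h4]
    exact ⟨hv, hmv⟩
  rcases hmp.lt_or_gt with h | h
  · exact ⟨-m, by simp [hmx], by simpa using h, fun v hv h => key v hv (by simpa using h)⟩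
  · exact ⟨m, hmx, h, key⟩

lemma dim_eq_one_of_inner (hP : S.Good P) (hρ : ρ ∈ P.cones) {x : X} (hx : x ∈ ρ)
    (hx0 : S.ι x ≠ 0) (h : ∀ y ∈ ρ, S.ι y ∈ Submodule.span ℝ {S.ι x}) :
    P.dim ρ = 1 ∧ S.spanOf ρ = Submodule.span ℝ {S.ι x} := by
  have : S.spanOf ρ = Submodule.span ℝ {S.ι x} := by
    refine le_antisymm (Submodule.span_le.2 ?_) ?_
    · rintro _ ⟨y, hy, rfl⟩; exact h y hy
    · rw [Submodule.span_singleton_le_iff_mem]; exact mem_spanOf hx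
  exact ⟨by rw [hP.dim_eq hρ, this, finrank_span_singleton hx0], this⟩

/-- Moving from an interior point of a face into the cone. -/
lemma exists_move_normalVector (hP : S.Good P) (hσ : σ ∈ P.cones) (hτ : τ ∈ P.cones)
    (hs : τ ⊆ σ) (hd : P.dim σ = P.dim τ + 1) {x : X} (hx : S.Inner τ x) {u : N}
    (hu : u ∈ S.spanOf τ) {β : ℝ} (hβ : 0 ≤ β) : ∃ ε : ℝ, 0 < ε ∧ ∀ s ∈ Set.Icc 0 ε,
      ∃ z ∈ σ, S.ι z = S.ι x + s • (u + β • S.normalVector σ τ) := by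
  obtain ⟨y, hy, hyτ⟩ := hP.exists_mem_notMem hσ hτ hd
  obtain ⟨a, ha, w, hw, he⟩ := hP.exists_normalVector_eq hσ hτ hs hd hy hyτ
  obtain ⟨ε, hε, h⟩ := hP.exists_move hτ hx
    (sub_mem hu (Submodule.smul_mem _ (β / a) hw))
  refine ⟨ε, hε, fun s hs' => ?_⟩
  obtain ⟨z₁, hz₁, hz₁ι⟩ := h s (by rw [abs_of_nonneg hs'.1]; exact hs'.2)
  obtain ⟨z, hz, hzι⟩ := hP.exists_comb hσ (hs hz₁) hy zero_le_one
    (mul_nonneg hs'.1 (div_nonneg hβ ha.le))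
  refine ⟨z, hz, ?_⟩
  have : S.normalVector σ τ = a⁻¹ • (S.ι y - w) := by
    rw [he, add_sub_cancel_right, smul_smul, inv_mul_cancel₀ ha.ne', one_smul]
  rw [hzι, hz₁ι, this]
  module

lemma apply_smul_of_isPL (hP : S.Good P) (hQ : Q.IsSubdivision P) (hφ : Q.IsPL φ)
    (hσ : σ ∈ P.cones) {x y : X} (hx : x ∈ σ) (hy : y ∈ σ) {t : ℝ} (ht : 0 ≤ t)
    (h : S.ι y = t • S.ι x) : φ y = t * φ x := by
  have hQG := hP.of_isSubdivision hQ
  obtain ⟨κ, hκ, hxκ⟩ := hQG.exists_carrier x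
  have hsub := hP.subset_of_inner_of_isSubdivision hQ hκ hσ hxκ hx
  obtain ⟨z, hz, hzι⟩ := hQG.exists_smul hκ hxκ.1 ht
  obtain rfl : z = y := hP.2 σ hσ (hsub hz) hy (by rw [hzι, h])
  rw [← hQG.linearExtension_apply hφ hκ hz, ← hQG.linearExtension_apply hφ hκ hxκ.1, hzι,
    map_smul, smul_eq_mul]

lemma nhdsWithin_eq_comap (hP : S.Good P) (hσ : σ ∈ P.cones) {x : X} (hx : x ∈ σ) :
    𝓝[σ] x = comap S.ι (𝓝 (S.ι x)) ⊓ 𝓟 σ := by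
  rw [nhdsWithin_eq_map_subtype_coe hx, (hP.isEmbedding hσ).nhds_eq_comap]
  have : (fun x : σ => S.ι x) = S.ι ∘ Subtype.val := rfl
  rw [this, ← comap_comap, subtype_coe_map_comap]

lemma tendsto_of_tendsto_ι (hP : S.Good P) (hσ : σ ∈ P.cones) {x : X} (hx : x ∈ σ)
    {α : Type*} {l : Filter α} {u : α → X} (hu : ∀ᶠ a in l, u a ∈ σ)
    (h : Tendsto (fun a => S.ι (u a)) l (𝓝 (S.ι x))) : Tendsto u l (𝓝 x) := by
  refine Tendsto.mono_right ?_ (nhdsWithin_le_nhds (s := σ))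
  rw [hP.nhdsWithin_eq_comap hσ hx, tendsto_inf, tendsto_principal, tendsto_comap_iff]
  exact ⟨h, hu⟩

end Good

end EuclideanConicalSpace

/-! ### Concavity on maximal cones -/

namespace EuclideanConicalSpace

variable {X N : Type*} [TopologicalSpace X] [NormedAddCommGroup N] [InnerProductSpace ℝ N]
  [FiniteDimensional ℝ N] {S : EuclideanConicalSpace X N} {P Q R : ConicalComplex X}
  {σ τ ρ : Set X} {φ ψ : X → ℝ} {C : Set (X → ℝ)} {k : ℕ}

local notation "⟪" x ", " y "⟫" => inner ℝ x y

namespace Good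

/-- After cutting with a suitable hyperplane through `x`, the point `x` of a two-dimensional cone
spans a ray of every subdivision. -/
lemma dim_carrier_eq_one (hP : S.Good P) (hσ : σ ∈ P.cones) {x : X} (hxσ : x ∈ σ)
    (hx0 : S.ι x ≠ 0) {m : Module.Dual ℝ N} (hmx : m (S.ι x) = 0)
    (hm : ∀ v ∈ S.spanOf σ, m v = 0 → v ∈ Submodule.span ℝ {S.ι x})
    (hR : R.IsSubdivision (hP.cut m)) (hρ : ρ ∈ R.cones) (hx : S.Inner ρ x) :
    R.dim ρ = 1 ∧ S.spanOf ρ = Submodule.span ℝ {S.ι x} := by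
  have hRG := (hP.good_cut m).of_isSubdivision hR
  refine hRG.dim_eq_one_of_inner hρ hx.1 hx0 fun y hy => ?_
  have hsub := (hP.good_cut m).subset_of_inner_of_isSubdivision hR hρ (hP.halfSpace_mem_cut hσ m 0)
    hx ⟨hxσ, fun _ => hmx.le, fun _ => hmx.ge⟩ hy
  exact hm _ (mem_spanOf hsub.1) (le_antisymm (hsub.2.1 (by decide)) (hsub.2.2 (by decide)))

end Good

/-- After slicing along x and e and cutting through x, the point x spans a ray inside a
two-dimensional cone κ of positive weight d(κ). Only the two sides of the ray in κ contribute to φ ·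
d there, with equal weights and normal vectors v and -v. Nonnegativity says that the slope of φ
along v is at most as large on the side of v as on the other side. -/
theorem IsTest.exists_local_slopes {c : P.Weight} (hP : S.Good P) {n : ℕ} (hn : 2 ≤ n)
    (hc : S.IsTest C P n c) (hσ : σ ∈ P.cones) (hd : P.dim σ = n) (hpos : 0 < c ⟨σ, hσ⟩)
    {x : X} (hx : S.Inner σ x) {e : N} (he : e ∈ S.spanOf σ) (hφ : φ ∈ C) :
    ∃ ε : ℝ, 0 < ε ∧ ∃ r l : ℝ, r ≤ l ∧ ∀ s ∈ Set.Icc 0 ε,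
      (∀ z ∈ σ, S.ι z = S.ι x + s • e → φ z = φ x + s * r) ∧
      (∀ z ∈ σ, S.ι z = S.ι x - s • e → φ z = φ x - s * l) := by
  classical
  have hx0 : S.ι x ≠ 0 := by
    intro h
    have h1 : S.spanOf σ = ⊥ := by
      refine (Submodule.span_eq_bot).2 ?_
      rintro _ ⟨y, hy, rfl⟩
      exact hP.eq_zero_of_inner_zero hσ hx h hy
    rw [hP.dim_eq hσ, h1, finrank_bot] at hd
    omega
  by_cases hex : e ∈ Submodule.span ℝ {S.ι x}
  -- In the radial direction φ is affine by homogeneity; ε keeps the factor 1 ± s a nonnegative.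
  · obtain ⟨a, rfl⟩ := Submodule.mem_span_singleton.1 hex
    obtain ⟨Q, hQ, hPL, -⟩ := hc.pos φ hφ
    refine ⟨(|a| + 1)⁻¹, by positivity, φ x * a, φ x * a, le_rfl, fun s hs => ?_⟩
    have hsa : |s * a| ≤ 1 := by
      rw [abs_mul, abs_of_nonneg hs.1]
      calc s * |a| ≤ (|a| + 1)⁻¹ * (|a| + 1) :=
            mul_le_mul hs.2 (by linarith) (abs_nonneg _) (by positivity)
        _ = 1 := inv_mul_cancel₀ (by positivity)
    obtain ⟨h1, h2⟩ := abs_le.1 hsa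
    constructor
    · intro z hz hzι
      rw [hP.apply_smul_of_isPL hQ hPL hσ hx.1 hz (t := 1 + s * a) (by linarith)
        (by rw [hzι]; module)]
      ring
    · intro z hz hzι
      rw [hP.apply_smul_of_isPL hQ hPL hσ hx.1 hz (t := 1 - s * a) (by linarith)
        (by rw [hzι]; module)]
      ring
  obtain ⟨ε₁, hε₁, p, hp, hpι⟩ := hP.exists_inner_move hσ hx he
  have hpx : S.ι p ∉ Submodule.span ℝ {S.ι x} := by
    intro h
    rw [hpι] at h
    have h' := (Submodule.add_mem_iff_right _ (Submodule.mem_span_singleton_self (S.ι x))).1 h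
    have := Submodule.smul_mem _ ε₁⁻¹ h'
    rw [smul_smul, inv_mul_cancel₀ hε₁.ne', one_smul] at this
    exact hex this
  obtain ⟨j, rfl⟩ : ∃ j, n = j + 2 := ⟨n - 2, by omega⟩
  obtain ⟨Q, hQ, d, hdt, κ, hκ, hκd, hκpos, hpκ, -, hκσ, hxκ⟩ :=
    IsTest.exists_slice j hP hc hσ hd hpos hp hx.1
  have hxκ := hxκ hx
  have hQG := hP.of_isSubdivision hQ
  obtain ⟨m, hmx, hmp, hm⟩ := hQG.exists_functional_of_dim_eq_two hκ hκd hxκ.1 hpκ.1 hx0 hpx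
  obtain ⟨Q₀, hQ₀, hPL, hint⟩ := hdt.pos φ hφ
  obtain ⟨R, hR₀, hRm⟩ := hQG.exists_common_subdivision hQ₀ (hQG.cut_isSubdivision m)
  have hRQ := hR₀.trans hQ₀
  have hRG := hQG.of_isSubdivision hRQ
  have hRPL := hPL.of_isSubdivision hR₀
  obtain ⟨ρ, hρ, hxρ⟩ := hRG.exists_carrier x
  obtain ⟨hρd, hρs⟩ := hQG.dim_carrier_eq_one hκ hxκ.1 hx0 hmx hm hRm hρ hxρ
  obtain ⟨σ₁, h₁, σ₂, h₂, hne, hiff, hv⟩ := hQG.exists_opposite_pair hRQ hκ hρ hxρ hxκ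
    (by rw [hκd, hρd])
  obtain ⟨hd₁, hρ₁, hs₁⟩ := (hiff σ₁ h₁).2 (Or.inl rfl)
  obtain ⟨hd₂, hρ₂, hs₂⟩ := (hiff σ₂ h₂).2 (Or.inr rfl)
  have hweight : ∀ {σ'} (hσ' : σ' ∈ R.cones), σ' ⊆ κ → R.dim σ' = R.dim ρ + 1 →
      Q.pullback R d ⟨σ', hσ'⟩ = d ⟨κ, hκ⟩ := by
    intro σ' hσ' hs' hd'
    obtain ⟨y, hy⟩ := hRG.exists_inner hσ'
    have he' : R.dim σ' = Q.dim κ := by omega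
    rw [hQG.pullback_apply hRQ d (σ := ⟨κ, hκ⟩) hy
      (hQG.inner_of_dim_eq hRQ hκ hσ' hs' he' hy), if_pos he'.symm]
  have hineq := hint R hR₀ ⟨ρ, hρ⟩
  rw [hRG.intersect_apply, Finset.sum_eq_add (⟨σ₁, h₁⟩ : {s // s ∈ R.cones}) ⟨σ₂, h₂⟩
    (fun h => hne (congrArg Subtype.val h)) ?_ (fun h => absurd (by simp [hd₁]; exact hρ₁) h)
    (fun h => absurd (by simp [hd₂]; exact hρ₂) h), hweight h₁ hs₁ hd₁, hweight h₂ hs₂ hd₂, hv] at hineq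
  swap
  -- A further cone above the ray has weight zero: a two-dimensional carrier in Q would contain κ,
  -- hence equal it.
  · rintro ⟨σ', hσ'⟩ hmem ⟨hn1, hn2⟩
    rw [Finset.mem_filter] at hmem
    obtain ⟨-, hd', hs'⟩ := hmem
    obtain ⟨y, hy⟩ := hRG.exists_inner hσ'
    obtain ⟨κ', hκ', hyκ'⟩ := hQG.exists_carrier y
    rw [hQG.pullback_apply hRQ d (σ := ⟨κ', hκ'⟩) hy hyκ']
    have hsub := hQG.subset_of_inner_of_isSubdivision hRQ hσ' hκ' hy hyκ'.1
    split_ifs with hdim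
    · exfalso
      have h1 := hQG.subset_of_inner hκ' hκ hxκ (hsub (hs' hxρ.1))
      have h2 := hQG.eq_of_subset_of_dim_le hκ' hκ h1 (by simp only at hdim hd'; omega)
      rcases (hiff σ' hσ').1 ⟨hd', hs', h2 ▸ hsub⟩ with h | h
      · exact hn1 (Subtype.ext h)
      · exact hn2 (Subtype.ext h)
    · rw [mul_zero]
  set v := S.normalVector σ₁ ρ with hvdef
  have hL : S.linearExtension φ σ₁ v ≤ S.linearExtension φ σ₂ v := by
    rw [map_neg, neg_neg] at hineq
    by_contra! hc
    nlinarith [mul_pos hκpos (sub_pos.2 hc)]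
  have heκ : e ∈ S.spanOf σ₁ := by
    rw [hQG.spanOf_eq_of_dim_eq hRG hκ h₁ hs₁ (by omega)]
    have h := sub_mem (mem_spanOf (S := S) hpκ.1) (mem_spanOf hxκ.1)
    rw [hpι, add_sub_cancel_left] at h
    have := Submodule.smul_mem _ ε₁⁻¹ h
    rwa [smul_smul, inv_mul_cancel₀ hε₁.ne', one_smul] at this
  have hu := hRG.sub_inner_smul_mem h₁ hρ hρ₁ hd₁ heκ
  set β := ⟪v, e⟫ with hβ
  set u := e - β • v with hudef
  have heq : e = u + β • v := by rw [hudef]; abel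
  have hLu : S.linearExtension φ σ₁ u = S.linearExtension φ σ₂ u := by
    rw [← hRG.linearExtension_mono hRPL h₁ hρ₁ hu, ← hRG.linearExtension_mono hRPL h₂ hρ₂ hu]
  -- moving from `x` along the two cones
  have hmove : ∀ {σ'} (_ : σ' ∈ R.cones) (_ : σ' ⊆ κ) {w : N} {ε : ℝ},
      (∀ s ∈ Set.Icc 0 ε, ∃ z ∈ σ', S.ι z = S.ι x + s • w) → x ∈ σ' → ∀ s ∈ Set.Icc 0 ε,
      ∀ z ∈ σ, S.ι z = S.ι x + s • w → φ z = φ x + s * S.linearExtension φ σ' w := by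
    intro σ' hσ' hs' w ε hw hxσ' s hs z hz hzι
    obtain ⟨z', hz', hzι'⟩ := hw s hs
    obtain rfl : z' = z := hP.2 σ hσ (hκσ (hs' hz')) hz (hzι'.trans hzι.symm)
    rw [← hRG.linearExtension_apply hRPL hσ' hz', ← hRG.linearExtension_apply hRPL hσ' hxσ', hzι,
      map_add, map_smul, smul_eq_mul]
  -- The sign of the normal component of e decides which of the two cones is entered along e and
  -- which along -e.
  rcases le_total 0 β with h0 | h0
  · obtain ⟨ε₂, hε₂, hmv₁⟩ := hRG.exists_move_normalVector h₁ hρ hρ₁ hd₁ hxρ hu h0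
    obtain ⟨ε₃, hε₃, hmv₂⟩ := hRG.exists_move_normalVector h₂ hρ hρ₂ hd₂ hxρ (neg_mem hu) h0
    rw [← hvdef, ← heq] at hmv₁
    rw [hv, show -u + β • -v = -e by rw [heq]; module] at hmv₂
    refine ⟨min ε₂ ε₃, lt_min hε₂ hε₃, S.linearExtension φ σ₁ e, S.linearExtension φ σ₂ e, ?_,
      fun s hs => ⟨fun z hz hzι => ?_, fun z hz hzι => ?_⟩⟩
    · rw [heq]
      simp only [map_add, map_smul, smul_eq_mul, hLu]
      nlinarith
    · exact hmove h₁ hs₁ hmv₁ (hρ₁ hxρ.1) s ⟨hs.1, hs.2.trans (min_le_left _ _)⟩ z hz hzι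
    · rw [hmove h₂ hs₂ hmv₂ (hρ₂ hxρ.1) s ⟨hs.1, hs.2.trans (min_le_right _ _)⟩ z hz
        (by rw [hzι, smul_neg, sub_eq_add_neg]), map_neg]
      ring
  · obtain ⟨ε₂, hε₂, hmv₂⟩ := hRG.exists_move_normalVector h₂ hρ hρ₂ hd₂ hxρ hu (neg_nonneg.2 h0)
    obtain ⟨ε₃, hε₃, hmv₁⟩ := hRG.exists_move_normalVector h₁ hρ hρ₁ hd₁ hxρ (neg_mem hu)
      (neg_nonneg.2 h0)
    rw [hv, show u + -β • -v = e by rw [heq]; module] at hmv₂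
    rw [← hvdef, show -u + -β • v = -e by rw [heq]; module] at hmv₁
    refine ⟨min ε₂ ε₃, lt_min hε₂ hε₃, S.linearExtension φ σ₂ e, S.linearExtension φ σ₁ e, ?_,
      fun s hs => ⟨fun z hz hzι => ?_, fun z hz hzι => ?_⟩⟩
    · rw [heq]
      simp only [map_add, map_smul, smul_eq_mul, hLu]
      nlinarith
    · exact hmove h₂ hs₂ hmv₂ (hρ₂ hxρ.1) s ⟨hs.1, hs.2.trans (min_le_left _ _)⟩ z hz hzι
    · rw [hmove h₁ hs₁ hmv₁ (hρ₁ hxρ.1) s ⟨hs.1, hs.2.trans (min_le_right _ _)⟩ z hz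
        (by rw [hzι, smul_neg, sub_eq_add_neg]), map_neg]
      ring

/-- Superharmonic functions are concave on cones of maximal dimension. -/
theorem IsTest.add_le {c : P.Weight} (hP : S.Good P) {n : ℕ} (hn : 2 ≤ n)
    (hc : S.IsTest C P n c) (hσ : σ ∈ P.cones) (hd : P.dim σ = n) (hpos : 0 < c ⟨σ, hσ⟩)
    (hφ : φ ∈ C) {x y z : X} (hx : x ∈ σ) (hy : y ∈ σ) (hz : z ∈ σ)
    (h : S.ι z = S.ι x + S.ι y) : φ x + φ y ≤ φ z := by
  obtain ⟨Q, hQ, hPL, -⟩ := hc.pos φ hφ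
  have hcont := hPL.continuous
  -- For interior points the midpoint inequality on the segment from x to y, whose midpoint is half
  -- of z, gives superadditivity by homogeneity.
  have hinner : ∀ x y z : X, S.Inner σ x → S.Inner σ y → z ∈ σ → S.ι z = S.ι x + S.ι y →
      φ x + φ y ≤ φ z := by
    intro x y z hx hy hz h
    have hseg : ∀ t : ℝ, ∃ w, t ∈ Set.Icc (0 : ℝ) 1 → w ∈ σ ∧
        S.ι w = (1 - t) • S.ι x + t • S.ι y := by
      intro t
      by_cases ht : t ∈ Set.Icc (0 : ℝ) 1
      · obtain ⟨w, hw, hwι⟩ := hP.exists_comb hσ hx.1 hy.1 (sub_nonneg.2 ht.2) ht.1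
        exact ⟨w, fun _ => ⟨hw, hwι⟩⟩
      · exact ⟨x, fun h => absurd h ht⟩
    choose w hw using hseg
    have hinj : ∀ t ∈ Set.Icc (0 : ℝ) 1, ∀ v ∈ σ, S.ι v = (1 - t) • S.ι x + t • S.ι y →
        w t = v := fun t ht v hv hvι => hP.2 σ hσ (hw t ht).1 hv ((hw t ht).2.trans hvι.symm)
    have hwcont : ContinuousOn (fun t => φ (w t)) (Set.Icc 0 1) := by
      intro t ht
      refine (hcont.tendsto _).comp (hP.tendsto_of_tendsto_ι hσ (hw t ht).1
        (eventually_nhdsWithin_of_forall fun s hs => (hw s hs).1) ?_)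
      have h1 : Tendsto (fun s : ℝ => (1 - s) • S.ι x + s • S.ι y) (𝓝[Set.Icc 0 1] t)
          (𝓝 ((1 - t) • S.ι x + t • S.ι y)) := by
        have : Continuous fun s : ℝ => (1 - s) • S.ι x + s • S.ι y := by fun_prop
        exact (this.tendsto t).mono_left nhdsWithin_le_nhds
      rw [(hw t ht).2]
      refine h1.congr' ?_
      filter_upwards [self_mem_nhdsWithin] with s hs
      rw [(hw s hs).2]
    have hmain := add_le_two_mul_of_local_slopes hwcont fun t ht => by
      have htI : t ∈ Set.Icc (0 : ℝ) 1 := ⟨ht.1.le, ht.2.le⟩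
      have hwt : S.Inner σ (w t) :=
        hx.of_comb hy.1 (hw t htI).1 (sub_pos.2 ht.2) ht.1.le (hw t htI).2
      obtain ⟨ε, hε, r, l, hrl, hs⟩ := hc.exists_local_slopes hP hn hσ hd hpos hwt
        (sub_mem (mem_spanOf hy.1) (mem_spanOf hx.1)) hφ
      refine ⟨ε, hε, r, l, hrl, fun s hsε => ⟨fun hI => ?_, fun hI => ?_⟩⟩
      · refine (hs s hsε).1 _ (hw _ hI).1 ?_
        rw [(hw _ hI).2, (hw t htI).2]
        module
      · refine (hs s hsε).2 _ (hw _ hI).1 ?_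
        rw [(hw _ hI).2, (hw t htI).2]
        module
    have hhalf : (1 / 2 : ℝ) ∈ Set.Icc (0 : ℝ) 1 := by norm_num
    rw [hinj 0 (by simp) x hx.1 (by simp), hinj 1 (by simp) y hy.1 (by simp),
      hP.apply_smul_of_isPL hQ hPL hσ hz (hw _ hhalf).1 (t := 1 / 2) (by norm_num)
        (by rw [(hw _ hhalf).2, h]; module)] at hmain
    linarith
  obtain ⟨p, hp⟩ := hP.exists_inner hσ
  -- In general, approach x, y, z by the interior points x + t p, y + t p, z + 2 t p and use the
  -- continuity of φ.
  have hpert : ∀ x ∈ σ, ∀ a : ℝ, 0 < a → ∃ u : ℝ → X, (∀ t, 0 < t → S.Inner σ (u t) ∧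
      S.ι (u t) = S.ι x + (a * t) • S.ι p) ∧ Tendsto (fun t => φ (u t)) (𝓝[>] 0) (𝓝 (φ x)) := by
    intro x hx a ha
    have : ∀ t : ℝ, ∃ w, 0 < t → S.Inner σ w ∧ S.ι w = S.ι x + (a * t) • S.ι p := by
      intro t
      by_cases ht : 0 < t
      · obtain ⟨w, hw, hwι⟩ := hP.exists_comb hσ hp.1 hx (mul_pos ha ht).le zero_le_one
        rw [one_smul] at hwι
        exact ⟨w, fun _ => ⟨hp.of_comb hx hw (mul_pos ha ht) zero_le_one (by rw [hwι, one_smul]),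
          by rw [hwι, add_comm]⟩⟩
      · exact ⟨x, fun h => absurd h ht⟩
    choose u hu using this
    refine ⟨u, hu, (hcont.tendsto _).comp (hP.tendsto_of_tendsto_ι hσ hx ?_ ?_)⟩
    · exact eventually_nhdsWithin_of_forall fun t ht => (hu t ht).1.1
    · have h1 : Tendsto (fun t : ℝ => S.ι x + (a * t) • S.ι p) (𝓝[>] 0) (𝓝 (S.ι x)) := by
        have : Continuous fun t : ℝ => S.ι x + (a * t) • S.ι p := by fun_prop
        exact (this.tendsto' 0 _ (by simp)).mono_left nhdsWithin_le_nhds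
      refine h1.congr' ?_
      filter_upwards [self_mem_nhdsWithin] with t ht
      rw [(hu t ht).2]
  obtain ⟨u, hu, hlu⟩ := hpert x hx 1 one_pos
  obtain ⟨v, hv, hlv⟩ := hpert y hy 1 one_pos
  obtain ⟨w, hw, hlw⟩ := hpert z hz 2 two_pos
  refine le_of_tendsto_of_tendsto (hlu.add hlv) hlw ?_
  filter_upwards [self_mem_nhdsWithin] with t ht
  refine hinner _ _ _ (hu t ht).1 (hv t ht).1 (hw t ht).1.1 ?_
  rw [(hu t ht).2, (hv t ht).2, (hw t ht).2, h]
  module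

end EuclideanConicalSpace

/-! ### Upper bounds near a boundary point of a cone -/

namespace EuclideanConicalSpace

variable {X N : Type*} [TopologicalSpace X] [NormedAddCommGroup N] [InnerProductSpace ℝ N]
  {S : EuclideanConicalSpace X N} {P Q R : ConicalComplex X}
  {σ τ ρ : Set X} {φ ψ : X → ℝ} {C : Set (X → ℝ)} {k : ℕ}

local notation "⟪" x ", " y "⟫" => inner ℝ x y

/-- The function is superadditive and positively homogeneous on each cone. -/
def ConicConcave (S : EuclideanConicalSpace X N) (P : ConicalComplex X) (φ : X → ℝ) : Prop :=
  (∀ σ ∈ P.cones, ∀ x ∈ σ, ∀ y ∈ σ, ∀ z ∈ σ, S.ι z = S.ι x + S.ι y → φ x + φ y ≤ φ z) ∧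
  ∀ σ ∈ P.cones, ∀ x ∈ σ, ∀ y ∈ σ, ∀ t : ℝ, 0 ≤ t → S.ι y = t • S.ι x → φ y = t * φ x

lemma ConicConcave.of_isSubdivision (h : S.ConicConcave P φ) (hQ : Q.IsSubdivision P) :
    S.ConicConcave Q φ := by
  constructor
  · intro σ hσ x hx y hy z hz
    obtain ⟨κ, hκ, hs, -⟩ := hQ σ hσ
    exact h.1 κ hκ x (hs hx) y (hs hy) z (hs hz)
  · intro σ hσ x hx y hy
    obtain ⟨κ, hκ, hs, -⟩ := hQ σ hσ
    exact h.2 κ hκ x (hs hx) y (hs hy)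

variable [FiniteDimensional ℝ N]

lemma ConicConcave.add_le (h : S.ConicConcave P φ) (hP : S.Good P) (hσ : σ ∈ P.cones) {x y z : X}
    (hx : x ∈ σ) (hy : y ∈ σ) (hz : z ∈ σ) {a b : ℝ} (ha : 0 ≤ a) (hb : 0 ≤ b)
    (he : S.ι z = a • S.ι x + b • S.ι y) : a * φ x + b * φ y ≤ φ z := by
  obtain ⟨x', hx', hxι⟩ := hP.exists_smul hσ hx ha
  obtain ⟨y', hy', hyι⟩ := hP.exists_smul hσ hy hb
  rw [← h.2 σ hσ x hx x' hx' a ha hxι, ← h.2 σ hσ y hy y' hy' b hb hyι]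
  exact h.1 σ hσ _ hx' _ hy' _ hz (by rw [he, hxι, hyι])

lemma _root_.ConicalComplex.exists_maximal {n : ℕ} (hpure : P.IsPure n) (hσ : σ ∈ P.cones) :
    ∃ κ ∈ P.cones, σ ⊆ κ ∧ P.dim κ = n := by
  obtain ⟨κ, hs, hκ⟩ := P.cones.exists_le_maximal hσ
  exact ⟨κ, hκ.1, hs, hpure κ hκ⟩

lemma IsTest.conicConcave {c : P.Weight} (hP : S.Good P) {n : ℕ} (hn : 2 ≤ n)
    (hc : S.IsTest C P n c) (hpure : P.IsPure n) (hpos : ∀ σ, P.dim σ.1 = n → 0 < c σ)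
    (hφ : φ ∈ C) : S.ConicConcave P φ := by
  constructor
  · intro σ hσ x hx y hy z hz h
    obtain ⟨κ, hκ, hs, hd⟩ := ConicalComplex.exists_maximal hpure hσ
    exact hc.add_le hP hn hκ hd (hpos ⟨κ, hκ⟩ hd) hφ (hs hx) (hs hy) (hs hz) h
  · intro σ hσ x hx y hy t ht h
    obtain ⟨Q, hQ, hPL, -⟩ := hc.pos φ hφ
    exact hP.apply_smul_of_isPL hQ hPL hσ hx hy ht h

namespace Good

/-- The directional derivative of a concave function dominates the function. -/
lemma le_linearExtension (hQ : S.Good Q) (hR : R.IsSubdivision Q) (hφ : R.IsPL φ)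
    (hcc : S.ConicConcave Q φ) (hσ : σ ∈ Q.cones) {σ' ρ' : Set X} (hσ' : σ' ∈ R.cones)
    (hρ' : ρ' ∈ R.cones) (hs : ρ' ⊆ σ') (hs' : σ' ⊆ σ) (hd : R.dim σ' = R.dim ρ' + 1) {x q : X}
    (hx : S.Inner ρ' x) (hq : q ∈ σ) {a b : ℝ} (ha : 0 ≤ a)
    (he : S.ι q = a • S.normalVector σ' ρ' + b • S.ι x) :
    φ q ≤ S.linearExtension φ σ' (S.ι q) := by
  have hRG := hQ.of_isSubdivision hR
  obtain ⟨ε, hε, h⟩ := hRG.exists_move_normalVector hσ' hρ' hs hd hx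
    (Submodule.smul_mem _ b (mem_spanOf hx.1)) ha
  obtain ⟨z, hz, hzι⟩ := h ε ⟨hε.le, le_rfl⟩
  rw [add_comm (b • _), ← he] at hzι
  have h1 := hcc.add_le hQ hσ (hs' (hs hx.1)) hq (hs' hz) zero_le_one hε.le (by rw [hzι, one_smul])
  rw [← hRG.linearExtension_apply hφ hσ' hz, hzι, map_add, map_smul, smul_eq_mul,
    hRG.linearExtension_apply hφ hσ' (hs hx.1), one_mul] at h1
  exact le_of_mul_le_mul_left (by linarith) hε

/-- The graph of a concave function lies below its tangent line. -/
lemma le_add_linearExtension (hQ : S.Good Q) (hR : R.IsSubdivision Q) (hφ : R.IsPL φ)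
    (hP : S.Good P) (hcc : S.ConicConcave P φ) (hσ : σ ∈ P.cones) {σ' ρ' : Set X}
    (hσ' : σ' ∈ R.cones)
    (hρ' : ρ' ∈ R.cones) (hs : ρ' ⊆ σ') (hs' : σ' ⊆ σ) (hd : R.dim σ' = R.dim ρ' + 1) {x : X}
    {p : N} (hx : S.Inner ρ' x) {a b : ℝ} (ha : 0 ≤ a)
    (he : p = a • S.normalVector σ' ρ' + b • S.ι x) {s : ℝ} (hs0 : 0 < s) {z : X} (hz : z ∈ σ)
    (hzι : S.ι z = S.ι x + s • p) :
    φ z ≤ φ x + s * S.linearExtension φ σ' p := by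
  have hRG := hQ.of_isSubdivision hR
  obtain ⟨ε, hε, h⟩ := hRG.exists_move_normalVector hσ' hρ' hs hd hx
    (Submodule.smul_mem _ b (mem_spanOf hx.1)) ha
  set δ := min ε s with hδ
  have hδ0 : 0 < δ := lt_min hε hs0
  obtain ⟨y, hy, hyι⟩ := h δ ⟨hδ0.le, min_le_left _ _⟩
  rw [add_comm (b • _), ← he] at hyι
  have hr : δ / s ≤ 1 := (div_le_one hs0).2 (min_le_right _ _)
  have h1 := hcc.add_le hP hσ (hs' (hs hx.1)) hz (hs' hy) (sub_nonneg.2 hr)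
    (div_nonneg hδ0.le hs0.le) (by
      rw [hyι, hzι, smul_add, smul_smul, div_mul_cancel₀ _ hs0.ne']; module)
  rw [← hRG.linearExtension_apply hφ hσ' hy, hyι, map_add, map_smul, smul_eq_mul,
    hRG.linearExtension_apply hφ hσ' (hs hx.1)] at h1
  have h2 : δ / s * φ z ≤ δ / s * (φ x + s * S.linearExtension φ σ' p) := by
    have : δ / s * (s * S.linearExtension φ σ' p) = δ * S.linearExtension φ σ' p := by
      field_simp
    rw [mul_add, this]; linarith
  exact le_of_mul_le_mul_left h2 (div_pos hδ0 hs0)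

end Good

/-- A superharmonic function on a two-dimensional balanced space that is bounded below near a
point grows at most linearly from this point, with a bound depending on finitely many values. -/
lemma IsTest.exists_upper_bound_of_two {d : Q.Weight} (hQ : S.Good Q) (hd : S.IsTest C Q 2 d)
    (hcc : ∀ φ ∈ C, S.ConicConcave Q φ) (hρ : ρ ∈ Q.cones) (hρd : Q.dim ρ = 1) {x p : X}
    (hx : S.Inner ρ x) (hsp : S.spanOf ρ = Submodule.span ℝ {S.ι x})
    {κ : Set X} (hκ : κ ∈ Q.cones) (hκd : Q.dim κ = 2)
    (hpos : 0 < d ⟨κ, hκ⟩) (hxκ : x ∈ κ) (hp : p ∈ κ)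
    (hpx : S.ι p ∉ Submodule.span ℝ {S.ι x}) (hP : S.Good P) (hccP : ∀ φ ∈ C, S.ConicConcave P φ)
    (hσ : σ ∈ P.cones) (hκσ : κ ⊆ σ) :
    ∃ B : (X → ℝ) → ℝ, Continuous B ∧ (∀ φ, 0 ≤ B φ) ∧ ∀ φ ∈ C, ∀ s : ℝ, 0 < s → ∀ z ∈ σ,
      S.ι z = S.ι x + s • S.ι p → φ z ≤ φ x + s * B φ := by
  classical
  have hρ_sub : ∀ {τ}, τ ∈ Q.cones → x ∈ τ → ρ ⊆ τ := fun hτ h => hQ.subset_of_inner hτ hρ hx h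
  have hdecomp : ∀ {τ}, τ ∈ Q.cones → Q.dim τ = 2 → ρ ⊆ τ → ∀ q ∈ τ, q ∉ ρ → ∃ a b : ℝ, 0 < a ∧
      S.ι q = a • S.normalVector τ ρ + b • S.ι x := by
    intro τ hτ hτd hs q hq hqρ
    obtain ⟨a, ha, w, hw, he⟩ := hQ.exists_normalVector_eq hτ hρ hs (by omega) hq hqρ
    rw [hsp, Submodule.mem_span_singleton] at hw
    obtain ⟨b, rfl⟩ := hw
    exact ⟨a, b, ha, he⟩
  have hchoose : ∀ τ : {τ // τ ∈ Q.cones}, ∃ (q : X) (a b : ℝ), 0 < a ∧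
      (Q.dim τ.1 = 2 → ρ ⊆ τ.1 → q ∈ τ.1 ∧ S.ι q = a • S.normalVector τ.1 ρ + b • S.ι x) := by
    intro τ
    by_cases h : Q.dim τ.1 = 2 ∧ ρ ⊆ τ.1
    · obtain ⟨q, hq, hqρ⟩ := hQ.exists_mem_notMem τ.2 hρ (by omega)
      obtain ⟨a, b, ha, he⟩ := hdecomp τ.2 h.1 h.2 q hq hqρ
      exact ⟨q, a, b, ha, fun _ _ => ⟨hq, he⟩⟩
    · exact ⟨x, 1, 0, one_pos, fun h1 h2 => absurd ⟨h1, h2⟩ h⟩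
  choose q a b ha hqab using hchoose
  obtain ⟨ap, bp, hap, hpe⟩ := hdecomp hκ hκd (hρ_sub hκ hxκ) p hp fun h => hpx (by
    rw [← hsp]; exact mem_spanOf h)
  -- Concavity makes the derivative of φ at x towards q τ at least φ (q τ); solving for the normal
  -- slope into τ shows that minus this slope is at most W τ φ.
  set W : {τ // τ ∈ Q.cones} → (X → ℝ) → ℝ := fun τ φ => (|φ (q τ)| + |b τ| * |φ x|) / a τ with hW
  have hW0 : ∀ τ φ, 0 ≤ W τ φ := fun τ φ => div_nonneg (by positivity) (ha τ).le
  refine ⟨fun φ => ap / d ⟨κ, hκ⟩ * (∑ τ, W τ φ * d τ) + |bp| * |φ x|, by fun_prop, fun φ => ?_,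
    fun φ hφ s hs z hz hzι => ?_⟩
  · have : 0 ≤ ∑ τ, W τ φ * d τ := Finset.sum_nonneg fun τ _ => mul_nonneg (hW0 τ φ) (hd.nonneg τ)
    have := div_pos hap hpos
    positivity
  -- The complex R on which φ is linear depends on φ, but the bound must not. So the cones of R
  -- above the ray are mapped injectively, by g, to cones of Q with the same weights and normal
  -- vectors.
  obtain ⟨R, hR, hPL, hint⟩ := hd.pos φ hφ
  have hRG := hQ.of_isSubdivision hR
  have hccQ := hcc φ hφ
  obtain ⟨ρ', hρ', hxρ'⟩ := hRG.exists_carrier x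
  have hρρ' := hQ.subset_of_inner_of_isSubdivision hR hρ' hρ hxρ' hx.1
  obtain ⟨hρd', hsp'⟩ : R.dim ρ' = 1 ∧ S.spanOf ρ' = Submodule.span ℝ {S.ι x} := by
    refine hRG.dim_eq_one_of_inner hρ' hxρ'.1 (fun h => ?_) fun y hy => ?_
    · rw [hQ.dim_eq hρ, hsp, h, Submodule.span_zero_singleton, finrank_bot] at hρd
      omega
    · rw [← hsp]; exact mem_spanOf (hρρ' hy)
  -- the cones of `Q` that contain the cones of `R`
  have hg : ∀ σ' : {σ' // σ' ∈ R.cones}, ∃ g : {σ // σ ∈ Q.cones}, σ'.1 ⊆ g.1 ∧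
      Q.pullback R d σ' = if Q.dim g.1 = R.dim σ'.1 then d g else 0 := by
    intro σ'
    obtain ⟨y, hy⟩ := hRG.exists_inner σ'.2
    obtain ⟨g, hg, hyg⟩ := hQ.exists_carrier y
    exact ⟨⟨g, hg⟩, hQ.subset_of_inner_of_isSubdivision hR σ'.2 hg hy hyg.1,
      hQ.pullback_apply hR d hy hyg⟩
  choose g hgs hgd using hg
  have hgprop : ∀ σ' : {σ' // σ' ∈ R.cones}, Q.pullback R d σ' ≠ 0 →
      Q.dim (g σ').1 = R.dim σ'.1 ∧ Q.pullback R d σ' = d (g σ') := by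
    intro σ' h
    rw [hgd] at h ⊢
    split_ifs at h ⊢ with h1
    · exact ⟨h1, rfl⟩
    · exact absurd rfl h
  have hnormal : ∀ (σ' : {σ' // σ' ∈ R.cones}), R.dim σ'.1 = R.dim ρ' + 1 → ρ' ⊆ σ'.1 →
      ∀ {τ}, τ ∈ Q.cones → σ'.1 ⊆ τ → Q.dim τ = R.dim σ'.1 →
      S.normalVector σ'.1 ρ' = S.normalVector τ ρ := by
    intro σ' h1 h2 τ hτ hs' hdim
    exact hQ.normalVector_subdivision hR hτ hρ σ'.2 hρ' hs' hρρ' (hρ_sub hτ (hs' (h2 hxρ'.1))) h2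
      hdim.symm (by omega) (by omega)
  have hlower : ∀ (σ' : {σ' // σ' ∈ R.cones}), R.dim σ'.1 = R.dim ρ' + 1 → ρ' ⊆ σ'.1 →
      Q.pullback R d σ' ≠ 0 →
      -(S.linearExtension φ σ'.1 (S.normalVector σ'.1 ρ')) ≤ W (g σ') φ := by
    intro σ' h1 h2 h3
    obtain ⟨h4, -⟩ := hgprop σ' h3
    obtain ⟨hq1, hq2⟩ := hqab (g σ') (by omega) (hρ_sub (g σ').2 (hgs σ' (h2 hxρ'.1)))
    rw [← hnormal σ' h1 h2 (g σ').2 (hgs σ') h4] at hq2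
    have h5 := hQ.le_linearExtension hR hPL hccQ (g σ').2 σ'.2 hρ' h2 (hgs σ') h1 hxρ' hq1
      (ha _).le hq2
    rw [hq2, map_add, map_smul, map_smul, hRG.linearExtension_apply hPL σ'.2 (h2 hxρ'.1),
      smul_eq_mul, smul_eq_mul] at h5
    rw [hW, le_div_iff₀ (ha _)]
    have h6 := neg_abs_le (φ (q (g σ')))
    have h7 := le_abs_self (b (g σ') * φ x)
    rw [abs_mul] at h7
    linarith
  obtain ⟨σs, hσs, hsρ, hsκ, hsd⟩ := hQ.exists_cone_above hR hκ hρ (hρ_sub hκ hxκ) (by omega) hρ'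
    hρρ' (by omega)
  have hsd1 : R.dim σs = R.dim ρ' + 1 := by omega
  have hsw : Q.pullback R d ⟨σs, hσs⟩ = d ⟨κ, hκ⟩ := by
    obtain ⟨y, hy⟩ := hRG.exists_inner hσs
    rw [hQ.pullback_apply hR d (σ := ⟨κ, hκ⟩) hy (hQ.inner_of_dim_eq hR hκ hσs hsκ hsd hy),
      if_pos hsd.symm]
  rw [← hnormal ⟨σs, hσs⟩ hsd1 hsρ hκ hsκ hsd.symm] at hpe
  set L := S.linearExtension φ σs with hL
  set v := S.normalVector σs ρ' with hv
  -- Nonnegativity of φ · d at the ray: the weighted slope into κ is at most the sum of the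
  -- negatives of the weighted slopes into the other cones.
  have hmain : L v * d ⟨κ, hκ⟩ ≤ ∑ τ, W τ φ * d τ := by
    have h0 := hint R (.refl R) ⟨ρ', hρ'⟩
    rw [hRG.intersect_apply] at h0
    set F : Finset {σ' // σ' ∈ R.cones} :=
      Finset.univ.filter fun σ' => R.dim σ'.1 = R.dim ρ' + 1 ∧ ρ' ⊆ σ'.1 with hF
    have hmem : (⟨σs, hσs⟩ : {σ' // σ' ∈ R.cones}) ∈ F := by
      rw [hF, Finset.mem_filter]; exact ⟨Finset.mem_univ _, hsd1, hsρ⟩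
    have h0' : 0 ≤ ∑ σ' ∈ F, -(S.linearExtension φ σ'.1 (S.normalVector σ'.1 ρ')) *
      Q.pullback R d σ' := h0
    rw [← Finset.add_sum_erase _ _ hmem, hsw] at h0'
    have h1 : ∑ σ' ∈ F.erase ⟨σs, hσs⟩, -(S.linearExtension φ σ'.1 (S.normalVector σ'.1 ρ')) *
        Q.pullback R d σ' ≤ ∑ τ, W τ φ * d τ := by
      rw [← Finset.sum_filter_of_ne (p := fun σ' => Q.pullback R d σ' ≠ 0)
        (fun σ' _ h h' => h (by rw [h', mul_zero]))]
      set F' := (F.erase ⟨σs, hσs⟩).filter fun σ' => Q.pullback R d σ' ≠ 0 with hF'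
      have hF'mem : ∀ σ' ∈ F', (R.dim σ'.1 = R.dim ρ' + 1 ∧ ρ' ⊆ σ'.1) ∧
          Q.pullback R d σ' ≠ 0 := by
        intro σ' h
        rw [hF', Finset.mem_filter] at h
        have h2 := Finset.mem_of_mem_erase h.1
        rw [hF, Finset.mem_filter] at h2
        exact ⟨h2.2, h.2⟩
      calc _ ≤ ∑ σ' ∈ F', W (g σ') φ * d (g σ') := by
            refine Finset.sum_le_sum fun σ' h => ?_
            obtain ⟨⟨h1, h2⟩, h3⟩ := hF'mem σ' h
            rw [(hgprop σ' h3).2]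
            exact mul_le_mul_of_nonneg_right (hlower σ' h1 h2 h3) (hd.nonneg _)
        _ = ∑ τ ∈ F'.image g, W τ φ * d τ := by
            rw [Finset.sum_image]
            intro σ₁ h₁ σ₂ h₂ heq
            obtain ⟨⟨h11, h12⟩, h13⟩ := hF'mem σ₁ h₁
            obtain ⟨⟨h21, h22⟩, h23⟩ := hF'mem σ₂ h₂
            refine Subtype.ext (hQ.eq_of_normalVector_eq hR (g σ₁).2 σ₁.2 σ₂.2 hρ' (hgs σ₁)
              (heq ▸ hgs σ₂) h12 h22 h11 h21 ?_)
            rw [hnormal σ₁ h11 h12 (g σ₁).2 (hgs σ₁) (hgprop σ₁ h13).1,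
              hnormal σ₂ h21 h22 (g σ₂).2 (hgs σ₂) (hgprop σ₂ h23).1, heq]
        _ ≤ _ := Finset.sum_le_univ_sum_of_nonneg fun τ => mul_nonneg (hW0 τ φ) (hd.nonneg τ)
    linarith
  have htangent := hQ.le_add_linearExtension hR hPL hP (hccP φ hφ) hσ hσs hρ' hsρ
    (hsκ.trans hκσ) hsd1 hxρ' hap.le hpe hs hz hzι
  refine htangent.trans ?_
  gcongr
  rw [hpe, map_add, map_smul, map_smul, hRG.linearExtension_apply hPL hσs (hsρ hxρ'.1),
    smul_eq_mul, smul_eq_mul]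
  have h1 : L v ≤ (∑ τ, W τ φ * d τ) / d ⟨κ, hκ⟩ := (le_div_iff₀ hpos).2 hmain
  have h2 := mul_le_mul_of_nonneg_left h1 hap.le
  have h3 := le_abs_self (bp * φ x)
  rw [abs_mul] at h3
  have h4 : ap / d ⟨κ, hκ⟩ * ∑ τ, W τ φ * d τ = ap * ((∑ τ, W τ φ * d τ) / d ⟨κ, hκ⟩) := by
    ring
  beta_reduce
  rw [h4]
  linarith

/-- Slice along x and p, then cut the slice with the line through x so that x spans a ray; the half
of the slice that contains p serves as the two-dimensional cone κ. -/
theorem IsTest.exists_upper_bound {c : P.Weight} (hP : S.Good P) {n : ℕ} (hn : 2 ≤ n)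
    (hc : S.IsTest C P n c) (hcc : ∀ φ ∈ C, S.ConicConcave P φ) (hσ : σ ∈ P.cones)
    (hd : P.dim σ = n) (hpos : 0 < c ⟨σ, hσ⟩) {x p : X} (hx : x ∈ σ) (hx0 : S.ι x ≠ 0)
    (hp : S.Inner σ p) (hpx : S.ι p ∉ Submodule.span ℝ {S.ι x}) :
    ∃ B : (X → ℝ) → ℝ, Continuous B ∧ (∀ φ, 0 ≤ B φ) ∧ ∀ φ ∈ C, ∀ s : ℝ, 0 < s → ∀ z ∈ σ,
      S.ι z = S.ι x + s • S.ι p → φ z ≤ φ x + s * B φ := by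
  obtain ⟨j, rfl⟩ : ∃ j, n = j + 2 := ⟨n - 2, by omega⟩
  obtain ⟨Q, hQ, d, hdt, κ, hκ, hκd, hκpos, hpκ, hxκ, hκσ, -⟩ :=
    IsTest.exists_slice j hP hc hσ hd hpos hp hx
  have hQG := hP.of_isSubdivision hQ
  obtain ⟨m, hmx, hmp, hm⟩ := hQG.exists_functional_of_dim_eq_two hκ hκd hxκ hpκ.1 hx0 hpx
  have hsub := hQG.cut_isSubdivision m
  obtain ⟨ρ, hρ, hxρ⟩ := (hQG.good_cut m).exists_carrier x
  obtain ⟨hρd, hρs⟩ := hQG.dim_carrier_eq_one hκ hxκ hx0 hmx hm (.refl _) hρ hxρ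
  have hsign : SignType.sign (m (S.ι p)) = 1 := sign_pos hmp
  exact (hdt.pullback hQG hsub).exists_upper_bound_of_two (hQG.good_cut m)
    (fun φ hφ => (hcc φ hφ).of_isSubdivision (hsub.trans hQ)) hρ hρd hxρ hρs
    (hQG.halfSpace_mem_cut hκ m 1) (by rw [hQG.dim_halfSpace hκ hpκ hsign (by decide), hκd])
    (by rw [hQG.pullback_halfSpace hκ hpκ hsign (by decide)]; exact hκpos)
    ⟨hxκ, fun h => absurd rfl h, fun _ => hmx.ge⟩ (hQG.inner_halfSpace hκ hpκ hsign).1 hpx hP hcc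
    hσ (Set.inter_subset_left.trans hκσ)

end EuclideanConicalSpace

/-! ### Equicontinuity -/

namespace EuclideanConicalSpace

variable {X N : Type*} [TopologicalSpace X] [NormedAddCommGroup N] [InnerProductSpace ℝ N]
  [FiniteDimensional ℝ N] {S : EuclideanConicalSpace X N} {P : ConicalComplex X}
  {σ : Set X} {φ : X → ℝ} {C : Set (X → ℝ)}

namespace Good

/-- Superadditivity and homogeneity bound φ from below by its values at generators. The sum θ of the
defining inequalities is positive off the apex and measures the size of a point. -/
lemma exists_lower_bound (hP : S.Good P) (hσ : σ ∈ P.cones) :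
    ∃ B : (X → ℝ) → ℝ, Continuous B ∧ (∀ φ, 0 ≤ B φ) ∧ ∃ θ : Module.Dual ℝ N,
      (∀ z ∈ σ, 0 ≤ θ (S.ι z)) ∧
      ∀ φ, S.ConicConcave P φ → ∀ z ∈ σ, -(θ (S.ι z) * B φ) ≤ φ z := by
  classical
  obtain ⟨G, hG⟩ := hP.exists_hull hσ
  obtain ⟨Λ, hΛ⟩ := hP.exists_ineq hσ
  set θ : Module.Dual ℝ N := ∑ ℓ ∈ Λ, ℓ with hθ
  have hθv : ∀ v, θ v = ∑ ℓ ∈ Λ, ℓ v := fun v => by rw [hθ, LinearMap.sum_apply]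
  have hΛ0 : ∀ z ∈ σ, ∀ ℓ ∈ Λ, 0 ≤ ℓ (S.ι z) := fun z hz => (hΛ _).1 ⟨z, hz, rfl⟩
  have hθ0 : ∀ z ∈ σ, 0 ≤ θ (S.ι z) := fun z hz => by
    rw [hθv]; exact Finset.sum_nonneg (hΛ0 z hz)
  have hθpos : ∀ z ∈ σ, θ (S.ι z) = 0 → S.ι z = 0 := by
    intro z hz h
    rw [hθv, Finset.sum_eq_zero_iff_of_nonneg (hΛ0 z hz)] at h
    obtain ⟨y, hy, hyι⟩ := (hΛ (-S.ι z)).2 fun ℓ hℓ => by rw [map_neg, h ℓ hℓ, neg_zero]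
    exact hP.eq_zero_of_eq_neg hσ hz hy (by rw [hyι, neg_neg])
  have hpt : ∀ g : G, ∃ x ∈ σ, S.ι x = g := fun g => (hG _).2 (Submodule.subset_span g.2)
  choose x hx hxι using hpt
  refine ⟨fun φ => ∑ g : G, |φ (x g)| / θ g, by fun_prop, fun φ => ?_, θ, hθ0, ?_⟩
  · refine Finset.sum_nonneg fun g _ => div_nonneg (abs_nonneg _) ?_
    rw [← hxι]; exact hθ0 _ (hx g)
  intro φ hφ
  set B := ∑ g : G, |φ (x g)| / θ g with hB
  have key : ∀ v ∈ PointedCone.hull ℝ (G : Set N), ∃ z ∈ σ, S.ι z = v ∧ -(θ v * B) ≤ φ z := by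
    intro v hv
    induction hv using Submodule.span_induction with
    | mem v hv =>
      refine ⟨x ⟨v, hv⟩, hx _, hxι _, ?_⟩
      have hterm : |φ (x ⟨v, hv⟩)| / θ v ≤ B := by
        rw [hB]
        refine Finset.single_le_sum (f := fun g : G => |φ (x g)| / θ g) (fun g _ => ?_)
          (Finset.mem_univ (⟨v, hv⟩ : G))
        refine div_nonneg (abs_nonneg _) ?_
        rw [← hxι]; exact hθ0 _ (hx g)
      have hv0 : 0 ≤ θ v := by have := hθ0 _ (hx ⟨v, hv⟩); rwa [hxι] at this
      rcases hv0.eq_or_lt with h0 | h0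
      · have h1 := hθpos _ (hx ⟨v, hv⟩) (by rw [hxι]; exact h0.symm)
        have := hφ.2 σ hσ _ (hx ⟨v, hv⟩) _ (hx ⟨v, hv⟩) 0 le_rfl (by rw [h1, smul_zero])
        rw [this, ← h0]; simp
      · rw [div_le_iff₀ h0] at hterm
        have := neg_abs_le (φ (x ⟨v, hv⟩))
        linarith
    | zero =>
      obtain ⟨z, hz, hz0⟩ := hP.exists_zero hσ
      refine ⟨z, hz, hz0, ?_⟩
      rw [hφ.2 σ hσ z hz z hz 0 le_rfl (by rw [hz0, smul_zero])]; simp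
    | add u v _ _ hu hv =>
      obtain ⟨y, hy, rfl, hyb⟩ := hu
      obtain ⟨w, hw, rfl, hwb⟩ := hv
      obtain ⟨z, hz, hzι⟩ := hP.exists_comb hσ hy hw zero_le_one zero_le_one
      rw [one_smul, one_smul] at hzι
      refine ⟨z, hz, hzι, ?_⟩
      have := hφ.1 σ hσ y hy w hw z hz hzι
      rw [map_add]
      linarith
    | smul a v _ hv =>
      obtain ⟨y, hy, rfl, hyb⟩ := hv
      obtain ⟨z, hz, hzι⟩ := hP.exists_smul hσ hy a.2
      refine ⟨z, hz, hzι, ?_⟩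
      change -(θ ((a : ℝ) • S.ι y) * B) ≤ _
      rw [hφ.2 σ hσ y hy z hz a a.2 hzι, map_smul, smul_eq_mul, mul_assoc, ← mul_neg]
      exact mul_le_mul_of_nonneg_left hyb a.2
  intro z hz
  obtain ⟨y, hy, hyι, hb⟩ := key _ ((hG _).1 ⟨z, hz, rfl⟩)
  obtain rfl := hP.2 σ hσ hy hz hyι
  exact hb

/-- For w in the cone near x, the point z = w - (1 - t) x still lies in the cone, since inequalities
tight at x cost nothing, and θ(z) ≤ t (θ(x) + 1). Then φ(w) ≥ (1 - t) φ(x) + φ(z), with φ(z) bounded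
below by θ(z). -/
lemma exists_lower_modulus (hP : S.Good P) (hσ : σ ∈ P.cones) {x : X} (hx : x ∈ σ) :
    ∃ B : (X → ℝ) → ℝ, Continuous B ∧ (∀ φ, 0 ≤ B φ) ∧ ∀ δ : ℝ, 0 < δ → ∀ᶠ v in 𝓝 (S.ι x),
      ∀ w ∈ σ, S.ι w = v → ∀ φ, S.ConicConcave P φ → φ x - δ * B φ ≤ φ w := by
  obtain ⟨B, hBc, hB0, θ, hθ0, hB⟩ := hP.exists_lower_bound hσ
  obtain ⟨Λ, hΛ⟩ := hP.exists_ineq hσ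
  refine ⟨fun φ => |φ x| + (θ (S.ι x) + 1) * B φ, by fun_prop, fun φ => ?_, fun δ hδ => ?_⟩
  · have := hθ0 x hx
    have := hB0 φ
    positivity
  set t := min δ (1 / 2) with ht
  have ht0 : 0 < t := lt_min hδ (by norm_num)
  have ht1 : t ≤ 1 / 2 := min_le_right _ _
  have hcont : ∀ ℓ : Module.Dual ℝ N, Tendsto ℓ (𝓝 (S.ι x)) (𝓝 (ℓ (S.ι x))) := fun ℓ =>
    (LinearMap.continuous_of_finiteDimensional ℓ).tendsto _
  have hev : ∀ᶠ v in 𝓝 (S.ι x), ∀ ℓ ∈ Λ, 0 ≤ ℓ v → (1 - t) * ℓ (S.ι x) ≤ ℓ v := by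
    refine (Filter.eventually_all_finset Λ).2 fun ℓ hℓ => ?_
    rcases ((hΛ _).1 ⟨x, hx, rfl⟩ ℓ hℓ).eq_or_lt with h | h
    · exact Eventually.of_forall fun v hv => by rw [← h]; simpa using hv
    · filter_upwards [(hcont ℓ).eventually_const_lt (u := (1 - t) * ℓ (S.ι x)) (by nlinarith)]
        with v hv _ using hv.le
  filter_upwards [hev, (hcont θ).eventually_lt_const (u := θ (S.ι x) + t) (by linarith)]
    with v hv hvθ w hw hwv φ hφ
  subst hwv
  obtain ⟨z, hz, hzι⟩ := (hΛ (S.ι w - (1 - t) • S.ι x)).2 fun ℓ hℓ => by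
    have := hv ℓ hℓ ((hΛ _).1 ⟨w, hw, rfl⟩ ℓ hℓ)
    rw [map_sub, map_smul, smul_eq_mul]; linarith
  have h1 := hφ.add_le hP hσ hx hz hw (a := 1 - t) (b := 1) (by linarith) zero_le_one
    (by rw [hzι]; module)
  have h2 := hB φ hφ z hz
  have h3 : θ (S.ι z) ≤ t * (θ (S.ι x) + 1) := by
    rw [hzι, map_sub, map_smul, smul_eq_mul]; linarith
  have h4 := mul_le_mul_of_nonneg_right h3 (hB0 φ)
  have h5 := mul_le_mul_of_nonneg_left (le_abs_self (φ x)) ht0.le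
  have h6 : t * (|φ x| + (θ (S.ι x) + 1) * B φ) ≤ δ * (|φ x| + (θ (S.ι x) + 1) * B φ) := by
    have := hθ0 x hx
    have := hB0 φ
    exact mul_le_mul_of_nonneg_right (min_le_left _ _) (by positivity)
  linarith

lemma exists_inner_notMem_span (hP : S.Good P) (hσ : σ ∈ P.cones) (hd : 2 ≤ P.dim σ) (v : N) :
    ∃ p, S.Inner σ p ∧ S.ι p ∉ Submodule.span ℝ {v} := by
  by_contra! hcon
  obtain ⟨p, hp⟩ := hP.exists_inner hσ
  have : S.spanOf σ ≤ Submodule.span ℝ {v} := by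
    intro w hw
    obtain ⟨ε, hε, z, hz, hzι⟩ := hP.exists_inner_move hσ hp hw
    have h := sub_mem (hcon z hz) (hcon p hp)
    rw [hzι, add_sub_cancel_left] at h
    have := Submodule.smul_mem _ ε⁻¹ h
    rwa [smul_smul, inv_mul_cancel₀ hε.ne', one_smul] at this
  have h1 := Submodule.finrank_mono this
  have h2 := finrank_span_le_card (R := ℝ) ({v} : Set N)
  rw [Set.toFinset_singleton, Finset.card_singleton] at h2
  rw [hP.dim_eq hσ] at hd
  omega

end Good

/-- The upper estimate is by reflection: w' = 2 x + 2 s p - w is in the cone for w near x, and w +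
w' = 2 (x + s p). Hence φ(w) ≤ 2 φ(x + s p) - φ(w'), where `exists_upper_bound` controls the first
term and `exists_lower_modulus` the second. -/
lemma IsTest.exists_modulus_within {c : P.Weight} (hP : S.Good P) {n : ℕ} (hn : 2 ≤ n)
    (hc : S.IsTest C P n c) (hcc : ∀ φ ∈ C, S.ConicConcave P φ) (hσ : σ ∈ P.cones)
    (hd : P.dim σ = n) (hpos : 0 < c ⟨σ, hσ⟩) {x : X} (hx : x ∈ σ) (hx0 : S.ι x ≠ 0) :
    ∃ B : (X → ℝ) → ℝ, Continuous B ∧ (∀ φ, 0 ≤ B φ) ∧ ∀ δ : ℝ, 0 < δ → ∀ᶠ w in 𝓝[σ] x,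
      ∀ φ ∈ C, |φ w - φ x| ≤ δ * B φ := by
  obtain ⟨p, hp, hpx⟩ := hP.exists_inner_notMem_span hσ (by omega) (S.ι x)
  obtain ⟨B₁, hB₁c, hB₁0, hB₁⟩ := hc.exists_upper_bound hP hn hcc hσ hd hpos hx hx0 hp hpx
  obtain ⟨B₂, hB₂c, hB₂0, hB₂⟩ := hP.exists_lower_modulus hσ hx
  obtain ⟨Λ, hΛ⟩ := hP.exists_ineq hσ
  refine ⟨fun φ => 2 * B₁ φ + B₂ φ, by fun_prop, fun φ => ?_, fun δ hδ => ?_⟩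
  · have := hB₁0 φ; have := hB₂0 φ; positivity
  have hV := hB₂ δ hδ
  rw [hP.nhdsWithin_eq_comap hσ hx]
  have hV' := eventually_nhds_iff.1 hV
  obtain ⟨V, hVp, hVo, hVx⟩ := hV'
  -- s is chosen so small that the reflection x + 2 s p of x itself lies in the neighbourhood V
  -- where the lower estimate holds.
  obtain ⟨s, ⟨hs0, hsδ⟩, hsV⟩ : ∃ s : ℝ, (0 < s ∧ s ≤ δ) ∧ S.ι x + (2 * s) • S.ι p ∈ V := by
    have h1 : Tendsto (fun s : ℝ => S.ι x + (2 * s) • S.ι p) (𝓝[>] 0) (𝓝 (S.ι x)) := by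
      have : Continuous fun s : ℝ => S.ι x + (2 * s) • S.ι p := by fun_prop
      exact (this.tendsto' 0 _ (by simp)).mono_left nhdsWithin_le_nhds
    obtain ⟨s, hs, hs'⟩ := ((h1.eventually (hVo.mem_nhds hVx)).and (Ioc_mem_nhdsGT hδ)).exists
    exact ⟨s, hs', hs⟩
  have hev1 : ∀ᶠ v in 𝓝 (S.ι x), (2 : ℝ) • S.ι x + (2 * s) • S.ι p - v ∈ V := by
    have : Continuous fun v => (2 : ℝ) • S.ι x + (2 * s) • S.ι p - v := by fun_prop
    refine this.continuousAt.eventually (hVo.mem_nhds ?_)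
    have e : (2 : ℝ) • S.ι x + (2 * s) • S.ι p - S.ι x = S.ι x + (2 * s) • S.ι p := by module
    simpa only [e] using hsV
  have hev2 : ∀ᶠ v in 𝓝 (S.ι x), ∀ ℓ ∈ Λ, v ∈ S.ι '' σ →
      0 ≤ ℓ ((2 : ℝ) • S.ι x + (2 * s) • S.ι p - v) := by
    refine (Filter.eventually_all_finset Λ).2 fun ℓ hℓ => ?_
    have hℓ0 : ∀ y ∈ σ, 0 ≤ ℓ (S.ι y) := fun y hy => (hΛ _).1 ⟨y, hy, rfl⟩ ℓ hℓ
    rcases (hℓ0 p hp.1).eq_or_lt with h | h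
    · refine Eventually.of_forall ?_
      rintro _ ⟨y, hy, rfl⟩
      have := hp.2 ℓ hℓ0 h.symm
      simp [this x hx, this p hp.1, this y hy]
    · have hpos' : 0 < 2 * s * ℓ (S.ι p) := by positivity
      filter_upwards [((LinearMap.continuous_of_finiteDimensional ℓ).tendsto
        (S.ι x)).eventually_lt_const (u := ℓ (S.ι x) + 2 * s * ℓ (S.ι p)) (by linarith)] with v hv _
      have := hℓ0 x hx
      simp only [map_sub, map_add, map_smul, smul_eq_mul]
      linarith
  have hall := (hV.and (hev1.and hev2)).comap S.ι
  filter_upwards [mem_inf_of_left hall, mem_inf_of_right (mem_principal_self σ)]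
    with w hw hwσ φ hφ
  obtain ⟨h1, h2, h3⟩ := hw
  have hlow := h1 w hwσ rfl φ (hcc φ hφ)
  obtain ⟨w', hw', hwι'⟩ := (hΛ _).2 fun ℓ hℓ => h3 ℓ hℓ ⟨w, hwσ, rfl⟩
  have hlow' := hVp _ h2 w' hw' hwι' φ (hcc φ hφ)
  obtain ⟨z, hz, hzι⟩ := hP.exists_comb hσ hx hp.1 zero_le_one hs0.le
  rw [one_smul] at hzι
  have hup := hB₁ φ hφ s hs0 z hz hzι
  obtain ⟨y, hy, hyι⟩ := hP.exists_smul hσ hz (a := 2) (by norm_num)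
  have h4 := (hcc φ hφ).1 σ hσ w hwσ w' hw' y hy (by rw [hyι, hzι, hwι']; module)
  rw [(hcc φ hφ).2 σ hσ z hz y hy 2 (by norm_num) hyι] at h4
  have h5 := mul_le_mul_of_nonneg_right hsδ (hB₁0 φ)
  have h6 := mul_nonneg hδ.le (hB₁0 φ)
  rw [abs_le]
  constructor <;> linarith

/-- Local equicontinuity of superharmonic functions, in a form that is suitable for families
which are only bounded at finitely many points. -/
theorem IsTest.exists_modulus {c : P.Weight} (hP : S.Good P) {n : ℕ} (hn : 2 ≤ n)
    (hc : S.IsTest C P n c) (hpure : P.IsPure n) (hpos : ∀ σ, P.dim σ.1 = n → 0 < c σ) {x : X}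
    (hx0 : S.ι x ≠ 0) :
    ∃ B : (X → ℝ) → ℝ, Continuous B ∧ (∀ φ, 0 ≤ B φ) ∧ ∀ δ : ℝ, 0 < δ → ∀ᶠ w in 𝓝 x,
      ∀ φ ∈ C, |φ w - φ x| ≤ δ * B φ := by
  classical
  have hcc : ∀ φ ∈ C, S.ConicConcave P φ := fun φ hφ => hc.conicConcave hP hn hpure hpos hφ
  have hex : ∀ σ : {σ // σ ∈ P.cones}, ∃ B : (X → ℝ) → ℝ, Continuous B ∧ (∀ φ, 0 ≤ B φ) ∧
      ∀ δ : ℝ, 0 < δ → ∀ᶠ w in 𝓝 x, w ∈ σ.1 → P.dim σ.1 = n →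
        ∀ φ ∈ C, |φ w - φ x| ≤ δ * B φ := by
    intro σ
    by_cases hx : x ∈ σ.1
    · by_cases hd : P.dim σ.1 = n
      · obtain ⟨B, h1, h2, h3⟩ := hc.exists_modulus_within hP hn hcc σ.2 hd (hpos σ hd) hx hx0
        refine ⟨B, h1, h2, fun δ hδ => ?_⟩
        filter_upwards [eventually_nhdsWithin_iff.1 (h3 δ hδ)] with w hw hwσ _ using hw hwσ
      · exact ⟨0, continuous_const, fun _ => le_rfl, fun δ hδ =>
          Eventually.of_forall fun w _ h => absurd h hd⟩
    · refine ⟨0, continuous_const, fun _ => le_rfl, fun δ hδ => ?_⟩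
      filter_upwards [(P.isClosed σ.1 σ.2).isOpen_compl.mem_nhds hx] with w hw hwσ
      exact absurd hwσ hw
  choose B hBc hB0 hB using hex
  refine ⟨fun φ => ∑ σ, B σ φ, by fun_prop, fun φ => Finset.sum_nonneg fun σ _ => hB0 σ φ,
    fun δ hδ => ?_⟩
  filter_upwards [eventually_all.2 fun σ => hB σ δ hδ] with w hw φ hφ
  obtain ⟨τ, hτ, hwτ⟩ := hP.exists_carrier w
  obtain ⟨κ, hκ, hs, hd⟩ := ConicalComplex.exists_maximal hpure hτ
  refine (hw ⟨κ, hκ⟩ (hs hwτ.1) hd φ hφ).trans ?_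
  gcongr
  exact Finset.single_le_sum (f := fun σ => B σ φ) (fun σ _ => hB0 σ φ) (Finset.mem_univ _)

end EuclideanConicalSpace

/-! ### The unit sphere and joint continuity of evaluation -/

namespace EuclideanConicalSpace

variable {X N : Type*} [TopologicalSpace X] [NormedAddCommGroup N] [InnerProductSpace ℝ N]
  (S : EuclideanConicalSpace X N)

lemma continuous_of_mem_PL {S : EuclideanConicalSpace X N} {φ : X → ℝ} (h : φ ∈ S.PL) :
    Continuous φ := by
  obtain ⟨P, -, hφ⟩ := h
  exact hφ.continuous

variable [FiniteDimensional ℝ N]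

lemma isCompact_sphere : IsCompact S.sphere := by
  have hP := S.good_complex
  have h1 : S.sphere = ⋃ σ ∈ S.complex.cones, σ ∩ S.sphere := by
    ext x
    simp only [Set.mem_iUnion, exists_prop, Set.mem_inter_iff]
    constructor
    · intro hx
      obtain ⟨σ, hσ, hxσ⟩ := hP.exists_carrier x
      exact ⟨σ, hσ, hxσ.1, hx⟩
    · rintro ⟨σ, -, -, hx⟩
      exact hx
  rw [h1]
  refine S.complex.cones.isCompact_biUnion fun σ hσ => ?_
  obtain ⟨Λ, hΛ⟩ := hP.exists_ineq hσ
  have hcl : IsClosed (Set.range fun x : σ => S.ι x) := by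
    have : Set.range (fun x : σ => S.ι x) = ⋂ ℓ ∈ Λ, {v | 0 ≤ ℓ v} := by
      ext v
      have := hΛ v
      simp only [Set.mem_image] at this
      simpa only [Set.mem_range, Subtype.exists, exists_prop, Set.mem_iInter, Set.mem_ofPred_eq]
        using this
    rw [this]
    exact isClosed_biInter fun ℓ _ => isClosed_le continuous_const
      (LinearMap.continuous_of_finiteDimensional ℓ)
  have hemb : IsClosedEmbedding fun x : σ => S.ι x := ⟨hP.isEmbedding hσ, hcl⟩
  have := FiniteDimensional.proper_real N
  have h2 := (hemb.isCompact_preimage (_root_.isCompact_sphere (0 : N) 1)).image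
    (continuous_subtype_val (p := (· ∈ σ)))
  convert h2 using 1
  ext x
  simp [sphere, and_comm]

instance : CompactSpace S.sphere := isCompact_iff_compactSpace.1 S.isCompact_sphere

variable {S}

lemma PL_subset_Conic : S.PL ⊆ S.Conic := by
  intro φ h σ hσ x hx y hy t ht he
  obtain ⟨P, hP, hφ⟩ := mem_PL_iff.1 h
  exact S.good_complex.apply_smul_of_isPL hP hφ hσ hx hy ht he

end EuclideanConicalSpace

namespace BalancedSpace

variable {X N : Type*} [TopologicalSpace X] [NormedAddCommGroup N] [InnerProductSpace ℝ N]
  [FiniteDimensional ℝ N] {n : ℕ} {S : BalancedSpace X N n} {C : Set (X → ℝ)}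

lemma isTest_weight (hC : S.IsAdmissible C) (hn : 1 ≤ n) :
    S.IsTest C S.complex n S.weight where
  balanced := S.good_complex.balanced_of_isMinkowskiWeight S.isMinkowski
  nonneg σ := by
    by_cases h : S.complex.dim σ.1 = n
    · exact (S.weight_pos σ h).le
    · rw [S.isMinkowski.1 σ h]
  eq_zero := S.isMinkowski.1
  pos φ hφ := by
    obtain ⟨P, hP, h⟩ := exists_productWeight_nonneg (hC.positive [φ] hn (by simpa using hφ))
    exact ⟨P, hP.2.1, hP.2.2 φ (by simp), fun R hR τ => h R hR τ⟩

/-- Evaluation of functions in the closure of `C` is jointly continuous. -/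
theorem continuous_eval (hC : S.IsAdmissible C) (hn : 2 ≤ n) :
    Continuous fun p : S.conicC C × S.sphere => p.1.1 p.2.1 := by
  rw [continuous_iff_continuousAt]
  rintro ⟨⟨ψ, hψ⟩, x, hx⟩
  have hx0 : S.ι x ≠ 0 := by
    intro h
    have : ‖S.ι x‖ = 1 := hx
    rw [h, norm_zero] at this
    exact zero_ne_one this
  obtain ⟨B, hBc, hB0, hB⟩ := (isTest_weight hC (by omega)).exists_modulus S.good_complex hn
    S.pure S.weight_pos hx0
  rw [ContinuousAt, Metric.tendsto_nhds]
  intro ε hε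
  obtain ⟨δ, hδ, hδε⟩ : ∃ δ : ℝ, 0 < δ ∧ δ * (B ψ + 1) < ε / 2 := by
    have : 0 < B ψ + 1 := by have := hB0 ψ; linarith
    exact ⟨ε / (4 * (B ψ + 1)), by positivity, by field_simp; norm_num⟩
  -- B is continuous for pointwise convergence, so the estimate passes from C to its closure.
  have h1 : ∀ᶠ w in 𝓝 x, ∀ φ ∈ closure C, |φ w - φ x| ≤ δ * B φ := by
    filter_upwards [hB δ hδ] with w hw φ hφ
    have hcl : IsClosed {φ : X → ℝ | |φ w - φ x| ≤ δ * B φ} :=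
      isClosed_le (by fun_prop) (by fun_prop)
    exact closure_minimal hw hcl hφ
  have h2 : ∀ᶠ φ : S.conicC C in 𝓝 ⟨ψ, hψ⟩, B φ.1 < B ψ + 1 ∧ |φ.1 x - ψ x| < ε / 2 := by
    have c1 : Continuous fun φ : S.conicC C => B φ.1 := by fun_prop
    have c2 : Continuous fun φ : S.conicC C => |φ.1 x - ψ x| :=
      (((continuous_apply x).comp continuous_subtype_val).sub continuous_const).abs
    exact (c1.continuousAt.eventually_lt_const (by linarith)).and
      (c2.continuousAt.eventually_lt_const (by simpa using by positivity))
  have h3 : ∀ᶠ w : S.sphere in 𝓝 ⟨x, hx⟩, ∀ φ ∈ closure C, |φ w.1 - φ x| ≤ δ * B φ :=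
    (continuous_subtype_val.tendsto (⟨x, hx⟩ : S.sphere)).eventually h1
  rw [nhds_prod_eq]
  filter_upwards [h2.prod_mk h3] with ⟨φ, w⟩ ⟨⟨ha, hb⟩, hc⟩
  have hc := hc φ.1 φ.2.2
  rw [Real.dist_eq]
  have h4 : δ * B φ.1 ≤ δ * (B ψ + 1) := by gcongr
  calc |φ.1 w.1 - ψ x| = |(φ.1 w.1 - φ.1 x) + (φ.1 x - ψ x)| := by ring_nf
    _ ≤ |φ.1 w.1 - φ.1 x| + |φ.1 x - ψ x| := abs_add_le _ _
    _ < ε := by linarith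

end BalancedSpace

/-! ### Positivity and mass bounds -/

namespace BalancedSpace

variable {X N : Type*} [TopologicalSpace X] [NormedAddCommGroup N] [InnerProductSpace ℝ N]
  {n : ℕ} {S : BalancedSpace X N n} {C : Set (X → ℝ)}

/-- The restriction of a piecewise linear function to the unit sphere. -/
def restrictPL {φ : X → ℝ} (h : φ ∈ S.PL) : C(S.sphere, ℝ) :=
  ⟨fun x => φ x, (EuclideanConicalSpace.continuous_of_mem_PL h).comp continuous_subtype_val⟩

lemma mem_PL_of_append {L F : List (X → ℝ)} (hC : S.IsAdmissible C) (hL : ∀ φ ∈ L, φ ∈ S.plC C)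
    (hF : ∀ φ ∈ F, φ ∈ C) : ∀ φ ∈ L ++ F, φ ∈ S.PL := by
  intro φ h
  rcases List.mem_append.1 h with h | h
  · exact (hL φ h).1
  · exact hC.subset_PL (hF φ h)

/-- The functions 2 b f ± G are nonnegative. -/
lemma abs_le_of_nonneg {M : S.RadonMeasure} (hM : ∀ G : C(S.sphere, ℝ), (∀ x, 0 ≤ G x) → 0 ≤ M G)
    {f : C(S.sphere, ℝ)} (hf : ∀ x, 1 / 2 ≤ f x) {G : C(S.sphere, ℝ)} {b : ℝ}
    (hb : ∀ x, |G x| ≤ b) : |M G| ≤ 2 * b * M f := by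
  have h1 := hM ((2 * b) • f - G) fun x => by
    have := abs_le.1 (hb x)
    have := (abs_nonneg _).trans (hb x)
    have := hf x
    simp only [ContinuousMap.sub_apply, ContinuousMap.smul_apply, smul_eq_mul]
    nlinarith
  have h2 := hM ((2 * b) • f + G) fun x => by
    have := abs_le.1 (hb x)
    have := (abs_nonneg _).trans (hb x)
    have := hf x
    simp only [ContinuousMap.add_apply, ContinuousMap.smul_apply, smul_eq_mul]
    nlinarith
  rw [map_sub, map_smul, smul_eq_mul] at h1
  rw [map_add, map_smul, smul_eq_mul] at h2
  rw [abs_le]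
  constructor <;> linarith

variable [FiniteDimensional ℝ N]

lemma sub_mem_PL {f g : X → ℝ} (hf : f ∈ S.PL) (hg : g ∈ S.PL) : f - g ∈ S.PL := by
  obtain ⟨P, hP, h⟩ := S.toEuclideanConicalSpace.exists_isPL_of_list (L := [f, g]) (by simp [hf, hg])
  exact EuclideanConicalSpace.mem_PL_iff.2 ⟨P, hP, fun σ hσ =>
    sub_mem (h f (by simp) σ hσ) (h g (by simp) σ hσ)⟩

lemma mem_PL_of_mem_sub (hC : S.IsAdmissible C) {γ : X → ℝ} (h : γ ∈ C - C) : γ ∈ S.PL := by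
  obtain ⟨a, ha, b, hb, rfl⟩ := h
  exact sub_mem_PL (hC.subset_PL ha) (hC.subset_PL hb)

lemma subset_plC (hC : S.IsAdmissible C) : C ⊆ S.plC C := fun _ h =>
  ⟨hC.subset_PL h, EuclideanConicalSpace.PL_subset_Conic (hC.subset_PL h), subset_closure h⟩

/-- Functions in `C - C` approximate a nonnegative function from above. -/
lemma mem_closure_nonneg (hC : S.IsAdmissible C) {G : C(S.sphere, ℝ)} (hG : ∀ x, 0 ≤ G x) :
    G ∈ closure {f : C(S.sphere, ℝ) | (∃ φ ∈ C - C, ∀ x : S.sphere, f x = φ x) ∧ ∀ x, 0 ≤ f x} := by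
  rw [Metric.mem_closure_iff]
  intro ε hε
  -- Approximating G + ε / 2 within ε / 2 keeps the approximant nonnegative and within ε of G.
  obtain ⟨f, hf, hd⟩ := Metric.dense_iff.1 hC.dense (G + ContinuousMap.const _ (ε / 2)) (ε / 2)
    (by positivity)
  have hd' : ∀ x, |f x - (G x + ε / 2)| < ε / 2 := fun x => by
    have := (ContinuousMap.dist_lt_iff (by positivity)).1 (Metric.mem_ball.1 hf) x
    rwa [Real.dist_eq] at this
  refine ⟨f, ⟨hd, fun x => ?_⟩, ?_⟩
  · have := (abs_lt.1 (hd' x)).1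
    have := hG x
    linarith
  · rw [ContinuousMap.dist_lt_iff hε]
    intro x
    rw [Real.dist_eq, abs_sub_comm, abs_lt]
    have := abs_lt.1 (hd' x)
    constructor <;> linarith

/-- Approximate the constant 1 within 1/2. The difference a - b tests the total mass and can be
exchanged with factors. -/
lemma exists_half_le (hC : S.IsAdmissible C) :
    ∃ a ∈ C, ∃ b ∈ C, ∀ x : S.sphere, 1 / 2 ≤ (a - b) x := by
  obtain ⟨f, hf, ⟨φ, ⟨a, ha, b, hb, rfl⟩, hd⟩⟩ := Metric.dense_iff.1 hC.dense
    (ContinuousMap.const _ 1) (1 / 2) (by positivity)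
  refine ⟨a, ha, b, hb, fun x => ?_⟩
  have := (ContinuousMap.dist_lt_iff (by positivity)).1 (Metric.mem_ball.1 hf) x
  rw [Real.dist_eq, abs_lt, hd] at this
  have h2 := this.1
  simp only [ContinuousMap.const_apply] at h2
  exact (by linarith)

/-- The measure of a product of piecewise linear `C`-concave functions is positive. -/
theorem cycleMeasure_nonneg_of_plC (hC : S.IsAdmissible C) {L : List (X → ℝ)} :
    ∀ {F : List (X → ℝ)}, (∀ φ ∈ L, φ ∈ S.plC C) → (∀ φ ∈ F, φ ∈ C) → (L ++ F).length ≤ n →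
    ∀ {G : C(S.sphere, ℝ)}, (∀ x, 0 ≤ G x) → 0 ≤ S.cycleMeasure (L ++ F) G := by
  induction L with
  | nil =>
    intro F _ hF hlen G hG
    exact cycleMeasure_nonneg (hC.positive F hlen hF) hG
  | cons f L ih =>
    intro F hL hF hlen G hG
    have hL' : ∀ φ ∈ L, φ ∈ S.plC C := fun φ h => hL φ (List.mem_cons_of_mem _ h)
    have hPL := mem_PL_of_append hC hL' hF
    have hf := hL f (by simp)
    have hcl : IsClosed {G : C(S.sphere, ℝ) | 0 ≤ S.cycleMeasure (f :: (L ++ F)) G} :=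
      isClosed_le continuous_const (S.cycleMeasure (f :: (L ++ F))).continuous
    -- It suffices to integrate a nonnegative γ in C - C. After exchanging γ and f the integral is
    -- pointwise continuous in f, so f may be taken in C, where it joins F and the induction
    -- applies.
    refine closure_minimal ?_ hcl (mem_closure_nonneg hC hG)
    rintro G' ⟨⟨γ, hγ, hγG⟩, hG'⟩
    have hγPL := mem_PL_of_mem_sub hC hγ
    obtain ⟨D, hDc, hD⟩ := exists_continuous_cycleMeasure (S := S) (L := γ :: (L ++ F))
      (List.forall_mem_cons.2 ⟨hγPL, hPL⟩)
    have key : ∀ g (hg : g ∈ S.PL), S.cycleMeasure (g :: (L ++ F)) G' = D g := fun g hg => by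
      rw [cycleMeasure_swap hg hγPL hPL (F := restrictPL hg) (fun _ => rfl) hγG]
      exact hD _ _ fun _ => rfl
    rw [Set.mem_ofPred_eq, key f hf.1]
    have hcl' : IsClosed {g : X → ℝ | 0 ≤ D g} := isClosed_le continuous_const hDc
    refine closure_minimal (fun g hg => ?_) hcl' hf.2.2
    rw [Set.mem_ofPred_eq, ← key g (hC.subset_PL hg)]
    have hF' : ∀ φ ∈ g :: F, φ ∈ C := List.forall_mem_cons.2 ⟨hg, hF⟩
    rw [cycleMeasure_perm (List.forall_mem_cons.2 ⟨hC.subset_PL hg, hPL⟩)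
      (List.perm_middle (l₁ := L) (l₂ := F)).symm]
    exact ih hL' hF' (by simp at hlen ⊢; omega) hG'

/-- Local uniform boundedness of the total mass. -/
theorem exists_mass_bound (hC : S.IsAdmissible C) {f : C(S.sphere, ℝ)} {a b : X → ℝ}
    (ha : a ∈ C) (hb : b ∈ C) (hf : ∀ x : S.sphere, f x = (a - b) x) (hf' : ∀ x, 1 / 2 ≤ f x)
    (R : ℝ) (j : ℕ) :
    ∀ F : List (X → ℝ), (∀ φ ∈ F, φ ∈ C) → j + F.length ≤ n - 1 → ∃ K : ℝ, 0 ≤ K ∧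
      ∀ L : List (X → ℝ), L.length = j → (∀ φ ∈ L, φ ∈ S.plC C) →
        (∀ φ ∈ L, ∀ x : S.sphere, |φ x| ≤ R) → S.cycleMeasure (L ++ F) f ≤ K := by
  induction j with
  | zero =>
    intro F hF hlen
    refine ⟨|S.cycleMeasure F f|, abs_nonneg _, fun L hL _ _ => ?_⟩
    rw [List.length_eq_zero_iff.1 hL]
    exact le_abs_self _
  | succ j ih =>
    intro F hF hlen
    obtain ⟨K₁, h₁, hK₁⟩ := ih (a :: F) (List.forall_mem_cons.2 ⟨ha, hF⟩)
      (by simp only [List.length_cons]; omega)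
    obtain ⟨K₂, h₂, hK₂⟩ := ih (b :: F) (List.forall_mem_cons.2 ⟨hb, hF⟩)
      (by simp only [List.length_cons]; omega)
    refine ⟨2 * |R| * (K₁ + K₂), by positivity, fun L hL hLC hLR => ?_⟩
    obtain ⟨φ, L, rfl⟩ := List.exists_cons_of_length_eq_add_one hL
    obtain ⟨hφ, hLC'⟩ := List.forall_mem_cons.1 hLC
    obtain ⟨hφR, hLR'⟩ := List.forall_mem_cons.1 hLR
    have hlenL : L.length = j := by simpa using hL
    have hPL := mem_PL_of_append hC hLC' hF
    have haPL := hC.subset_PL ha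
    have hbPL := hC.subset_PL hb
    -- Exchanging φ with f = a - b leaves integrals of φ, bounded on the sphere, against the
    -- positive measures with φ replaced by a or b; these have one variable factor less.
    rw [List.cons_append, cycleMeasure_swap hφ.1 (sub_mem_PL haPL hbPL) hPL
      (F := restrictPL hφ.1) (fun _ => rfl) hf, cycleMeasure_sub haPL hbPL hPL]
    have key : ∀ c ∈ C, ∀ K, S.cycleMeasure (L ++ c :: F) f ≤ K →
        |S.cycleMeasure (c :: (L ++ F)) (restrictPL hφ.1)| ≤ 2 * |R| * K := by
      intro c hc K hK
      have hcF : ∀ φ ∈ c :: F, φ ∈ C := List.forall_mem_cons.2 ⟨hc, hF⟩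
      rw [cycleMeasure_perm (List.forall_mem_cons.2 ⟨hC.subset_PL hc, hPL⟩)
        (List.perm_middle (l₁ := L) (l₂ := F)).symm]
      refine (abs_le_of_nonneg (fun G hG => cycleMeasure_nonneg_of_plC hC hLC' hcF
        (by simp only [List.length_append, List.length_cons]; omega) hG) hf' (b := |R|)
        fun x => (hφR x).trans (le_abs_self R)).trans ?_
      gcongr
    have e1 := le_abs_self (S.cycleMeasure (a :: (L ++ F)) (restrictPL hφ.1))
    have e2 := neg_abs_le (S.cycleMeasure (b :: (L ++ F)) (restrictPL hφ.1))
    have e3 := key a ha K₁ (hK₁ L hlenL hLC' hLR')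
    have e4 := key b hb K₂ (hK₂ L hlenL hLC' hLR')
    linarith

end BalancedSpace

/-- An eventually bounded family of functionals that converges on a dense set converges in the
weak-* topology. -/
lemma WeakDual.exists_tendsto_of_dense {V α : Type*} [NormedAddCommGroup V] [NormedSpace ℝ V]
    {l : Filter α} [l.NeBot] {f : α → WeakDual ℝ V} {D : Set V} (hD : Dense D) {K : ℝ} (hK : 0 ≤ K)
    (hb : ∀ᶠ a in l, ∀ G : V, |f a G| ≤ K * ‖G‖)
    (hc : ∀ η ∈ D, ∃ c : ℝ, Tendsto (fun a => f a η) l (𝓝 c)) : ∃ ν, Tendsto f l (𝓝 ν) := by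
  have hcomp := WeakDual.isCompact_closedBall (𝕜 := ℝ) (E := V) 0 K
  have hmem : ∀ᶠ a in l, f a ∈ WeakDual.toStrongDual ⁻¹' Metric.closedBall (0 : StrongDual ℝ V) K := by
    filter_upwards [hb] with a ha
    rw [Set.mem_preimage, mem_closedBall_zero_iff]
    exact ContinuousLinearMap.opNorm_le_bound _ hK ha
  have hval : ∀ ν, MapClusterPt ν l f → ∀ η ∈ D, ∀ c, Tendsto (fun a => f a η) l (𝓝 c) →
      ν η = c := by
    intro ν hν η hη c hc
    have h1 : MapClusterPt (ν η) l (fun a => f a η) :=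
      hν.tendsto_comp ((WeakDual.eval_continuous η).tendsto ν)
    exact eq_of_nhds_neBot (ClusterPt.mono h1 hc)
  -- Banach–Alaoglu gives a cluster point, and all cluster points agree on D.
  obtain ⟨ν, -, hν⟩ := hcomp.exists_mapClusterPt_of_frequently hmem.frequently
  refine ⟨ν, hcomp.tendsto_nhds_of_unique_mapClusterPt hmem fun ν' _ hν' => ?_⟩
  have heq : Set.EqOn ν' ν D := by
    intro η hη
    obtain ⟨c, hc⟩ := hc η hη
    rw [hval ν' hν' η hη c hc, hval ν hν η hη c hc]
  exact DFunLike.ext' (Continuous.ext_on hD ν'.continuous ν.continuous heq)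

/-! ### Lipschitz estimates and extension by continuity -/

namespace BalancedSpace

variable {X N : Type*} [TopologicalSpace X] [NormedAddCommGroup N] [InnerProductSpace ℝ N]
  [FiniteDimensional ℝ N] {n : ℕ} {S : BalancedSpace X N n} {C : Set (X → ℝ)}

/-- Telescoping: the factors φ are replaced by φ' one at a time, and L collects those already
replaced. After exchanging with H = p - q, one replacement costs the integral of φ - φ' against a
difference of two positive measures of bounded mass. -/
lemma exists_lipschitz_replicate (hC : S.IsAdmissible C) {p q : X → ℝ} (hp : p ∈ C) (hq : q ∈ C)
    {H : C(S.sphere, ℝ)} (hH : ∀ x : S.sphere, H x = (p - q) x) (R : ℝ) (m : ℕ)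
    {F : List (X → ℝ)} (hF : ∀ φ ∈ F, φ ∈ C) (hlen : m + F.length ≤ n - 1) :
    ∃ K : ℝ, 0 ≤ K ∧ ∀ φ ∈ S.plC C, ∀ φ' ∈ S.plC C, (∀ x : S.sphere, |φ x| ≤ R) →
      (∀ x : S.sphere, |φ' x| ≤ R) → ∀ δ : ℝ, 0 ≤ δ → (∀ x : S.sphere, |φ x - φ' x| ≤ δ) →
      ∀ (k : ℕ) (L : List (X → ℝ)), k + L.length = m → (∀ χ ∈ L, χ ∈ S.plC C) →
        (∀ χ ∈ L, ∀ x : S.sphere, |χ x| ≤ R) →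
        |S.cycleMeasure ((List.replicate k φ ++ L) ++ F) H -
          S.cycleMeasure ((List.replicate k φ' ++ L) ++ F) H| ≤ k * (K * δ) := by
  rcases m with _ | m
  -- Treated apart because the mass bounds below concern lists with one variable factor less.
  · refine ⟨0, le_rfl, fun φ _ φ' _ _ _ δ _ _ k L hk _ _ => ?_⟩
    obtain rfl : k = 0 := by omega
    simp
  obtain ⟨a, ha, b, hb, hab⟩ := exists_half_le hC
  set f := restrictPL (S := S) (sub_mem_PL (hC.subset_PL ha) (hC.subset_PL hb)) with hf
  obtain ⟨K₁, h₁, hK₁⟩ := exists_mass_bound hC ha hb (f := f) (fun _ => rfl) hab R m (p :: F)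
    (List.forall_mem_cons.2 ⟨hp, hF⟩) (by simp only [List.length_cons]; omega)
  obtain ⟨K₂, h₂, hK₂⟩ := exists_mass_bound hC ha hb (f := f) (fun _ => rfl) hab R m (q :: F)
    (List.forall_mem_cons.2 ⟨hq, hF⟩) (by simp only [List.length_cons]; omega)
  refine ⟨2 * (K₁ + K₂), by positivity, fun φ hφ φ' hφ' hφR hφR' δ hδ0 hδ k => ?_⟩
  induction k with
  | zero => intro L _ _ _; simp
  | succ k ih =>
    intro L hk hL hLR
    set T := List.replicate k φ ++ L with hT
    have hTlen : T.length = m := by simp [hT]; omega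
    have hTC : ∀ χ ∈ T, χ ∈ S.plC C := by
      intro χ h
      rcases List.mem_append.1 h with h | h
      · rw [List.eq_of_mem_replicate h]; exact hφ
      · exact hL χ h
    have hTR : ∀ χ ∈ T, ∀ x : S.sphere, |χ x| ≤ R := by
      intro χ h
      rcases List.mem_append.1 h with h | h
      · rw [List.eq_of_mem_replicate h]; exact hφR
      · exact hLR χ h
    have hPL := mem_PL_of_append hC hTC hF
    have hppl := hC.subset_PL hp
    have hqpl := hC.subset_PL hq
    have hmid : S.cycleMeasure (φ' :: (T ++ F)) =
        S.cycleMeasure ((List.replicate k φ ++ φ' :: L) ++ F) := by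
      refine cycleMeasure_perm (List.forall_mem_cons.2 ⟨hφ'.1, hPL⟩) ?_
      rw [hT, List.append_assoc, List.append_assoc, List.cons_append]
      exact List.perm_middle.symm
    have hmid' : S.cycleMeasure (φ' :: ((List.replicate k φ' ++ L) ++ F)) =
        S.cycleMeasure ((List.replicate k φ' ++ φ' :: L) ++ F) := by
      refine cycleMeasure_perm (List.forall_mem_cons.2 ⟨hφ'.1, mem_PL_of_append hC ?_ hF⟩) ?_
      · intro χ h
        rcases List.mem_append.1 h with h | h
        · rw [List.eq_of_mem_replicate h]; exact hφ'
        · exact hL χ h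
      · rw [List.append_assoc, List.append_assoc, List.cons_append]
        exact List.perm_middle.symm
    have hstep := ih (φ' :: L) (by simp only [List.length_cons]; omega)
      (List.forall_mem_cons.2 ⟨hφ', hL⟩) (List.forall_mem_cons.2 ⟨hφR', hLR⟩)
    rw [← hmid, ← hmid'] at hstep
    have hfirst : |S.cycleMeasure (φ :: (T ++ F)) H - S.cycleMeasure (φ' :: (T ++ F)) H| ≤
        2 * (K₁ + K₂) * δ := by
      rw [cycleMeasure_swap hφ.1 (sub_mem_PL hppl hqpl) hPL (F := restrictPL hφ.1)
          (fun _ => rfl) hH, cycleMeasure_swap hφ'.1 (sub_mem_PL hppl hqpl) hPL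
          (F := restrictPL hφ'.1) (fun _ => rfl) hH, cycleMeasure_sub hppl hqpl hPL,
        cycleMeasure_sub hppl hqpl hPL]
      have key : ∀ c ∈ C, ∀ K, 0 ≤ K → S.cycleMeasure (T ++ c :: F) f ≤ K →
          |S.cycleMeasure (c :: (T ++ F)) (restrictPL hφ.1 - restrictPL hφ'.1)| ≤ 2 * K * δ := by
        intro c hc K hK0 hK
        have hcF : ∀ φ ∈ c :: F, φ ∈ C := List.forall_mem_cons.2 ⟨hc, hF⟩
        rw [cycleMeasure_perm (List.forall_mem_cons.2 ⟨hC.subset_PL hc, hPL⟩)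
          (List.perm_middle (l₁ := T) (l₂ := F)).symm]
        have hpos : ∀ G : C(S.sphere, ℝ), (∀ x, 0 ≤ G x) → 0 ≤ S.cycleMeasure (T ++ c :: F) G :=
          fun G hG => cycleMeasure_nonneg_of_plC hC hTC hcF
            (by simp only [List.length_append, List.length_cons]; omega) hG
        refine (abs_le_of_nonneg hpos (f := f) hab (b := δ) hδ).trans ?_
        have := mul_le_mul_of_nonneg_left hK hδ0
        linarith
      have e1 := key p hp K₁ h₁ (hK₁ T hTlen hTC hTR)
      have e2 := key q hq K₂ h₂ (hK₂ T hTlen hTC hTR)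
      rw [map_sub] at e1 e2
      have e1 := abs_le.1 e1
      have e2 := abs_le.1 e2
      rw [abs_le]
      constructor <;> linarith
    have hrep : ∀ χ : X → ℝ, (List.replicate (k + 1) χ ++ L) ++ F =
        χ :: ((List.replicate k χ ++ L) ++ F) := fun χ => by
      simp [List.replicate_succ]
    rw [hrep, hrep, ← hT]
    calc _ ≤ |S.cycleMeasure (φ :: (T ++ F)) H - S.cycleMeasure (φ' :: (T ++ F)) H| +
          |S.cycleMeasure (φ' :: (T ++ F)) H -
            S.cycleMeasure (φ' :: ((List.replicate k φ' ++ L) ++ F)) H| := abs_sub_le _ _ _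
      _ ≤ _ := by push_cast; linarith

/-- Local boundedness and the Lipschitz property of the mixed measures. -/
lemma exists_mixed_bounds (hC : S.IsAdmissible C) (R : ℝ) (k : ℕ) {Γ : List (X → ℝ)}
    (hΓ : ∀ γ ∈ Γ, γ ∈ C - C) :
    ∀ {F : List (X → ℝ)}, (∀ φ ∈ F, φ ∈ C) → Γ.length + k + F.length ≤ n - 1 →
    (∃ K : ℝ, 0 ≤ K ∧ ∀ φ ∈ S.plC C, (∀ x : S.sphere, |φ x| ≤ R) → ∀ G : C(S.sphere, ℝ),
      |S.cycleMeasure (Γ ++ (List.replicate k φ ++ F)) G| ≤ K * ‖G‖) ∧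
    ∀ H : C(S.sphere, ℝ), (∃ η ∈ C - C, ∀ x : S.sphere, H x = η x) → ∃ K : ℝ, 0 ≤ K ∧
      ∀ φ ∈ S.plC C, ∀ φ' ∈ S.plC C, (∀ x : S.sphere, |φ x| ≤ R) →
      (∀ x : S.sphere, |φ' x| ≤ R) → ∀ δ : ℝ, 0 ≤ δ → (∀ x : S.sphere, |φ x - φ' x| ≤ δ) →
        |S.cycleMeasure (Γ ++ (List.replicate k φ ++ F)) H -
          S.cycleMeasure (Γ ++ (List.replicate k φ' ++ F)) H| ≤ K * δ := by
  induction Γ with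
  | nil =>
    intro F hF hlen
    simp only [List.nil_append, List.length_nil] at hlen ⊢
    constructor
    · obtain ⟨a, ha, b, hb, hab⟩ := exists_half_le hC
      set f := restrictPL (S := S) (sub_mem_PL (hC.subset_PL ha) (hC.subset_PL hb)) with hf
      obtain ⟨K, h, hK⟩ := exists_mass_bound hC ha hb (f := f) (fun _ => rfl) hab R k F hF
        (by omega)
      refine ⟨2 * K, by positivity, fun φ hφ hφR G => ?_⟩
      have h1 : ∀ χ ∈ List.replicate k φ, χ ∈ S.plC C := fun χ h => by
        rw [List.eq_of_mem_replicate h]; exact hφ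
      have h2 : ∀ χ ∈ List.replicate k φ, ∀ x : S.sphere, |χ x| ≤ R := fun χ h => by
        rw [List.eq_of_mem_replicate h]; exact hφR
      have hpos : ∀ G : C(S.sphere, ℝ), (∀ x, 0 ≤ G x) →
          0 ≤ S.cycleMeasure (List.replicate k φ ++ F) G :=
        fun G hG => cycleMeasure_nonneg_of_plC hC h1 hF (by simp; omega) hG
      refine (abs_le_of_nonneg hpos (f := f) hab (b := ‖G‖) fun x => G.norm_coe_le_norm x).trans ?_
      have := mul_le_mul_of_nonneg_left (hK _ (by simp) h1 h2) (norm_nonneg G)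
      linarith
    · rintro H ⟨_, ⟨p, hp, q, hq, rfl⟩, hH⟩
      obtain ⟨K, h, hK⟩ := exists_lipschitz_replicate hC hp hq hH R k hF (by omega)
      refine ⟨k * K, by positivity, fun φ hφ φ' hφ' hφR hφR' δ hδ0 hδ => ?_⟩
      have := hK φ hφ φ' hφ' hφR hφR' δ hδ0 hδ k [] (by simp) (by simp) (by simp)
      simp only [List.append_nil] at this
      rw [mul_assoc]; exact this
  | cons γ Γ ih =>
    intro F hF hlen
    -- Expand γ = a - b by linearity and move a, respectively b, to the fixed factors F.
    obtain ⟨⟨a, ha, b, hb, rfl⟩, hΓ'⟩ := List.forall_mem_cons.1 hΓ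
    obtain ⟨⟨K₁, h₁, hK₁⟩, hL₁⟩ := ih hΓ' (List.forall_mem_cons.2 ⟨ha, hF⟩)
      (by simp only [List.length_cons] at hlen ⊢; omega)
    obtain ⟨⟨K₂, h₂, hK₂⟩, hL₂⟩ := ih hΓ' (List.forall_mem_cons.2 ⟨hb, hF⟩)
      (by simp only [List.length_cons] at hlen ⊢; omega)
    have hexp : ∀ φ ∈ S.plC C, ∀ G, S.cycleMeasure ((a - b) :: Γ ++ (List.replicate k φ ++ F)) G =
        S.cycleMeasure (Γ ++ (List.replicate k φ ++ a :: F)) G -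
          S.cycleMeasure (Γ ++ (List.replicate k φ ++ b :: F)) G := by
      intro φ hφ G
      have hPL : ∀ χ ∈ Γ ++ (List.replicate k φ ++ F), χ ∈ S.PL := by
        intro χ h
        rcases List.mem_append.1 h with h | h
        · exact mem_PL_of_mem_sub hC (hΓ' χ h)
        · exact mem_PL_of_append hC (fun χ h => by rw [List.eq_of_mem_replicate h]; exact hφ) hF χ h
      have hperm : ∀ c ∈ C, S.cycleMeasure (Γ ++ (List.replicate k φ ++ c :: F)) =
          S.cycleMeasure (c :: (Γ ++ (List.replicate k φ ++ F))) := by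
        intro c hc
        refine (cycleMeasure_perm (List.forall_mem_cons.2 ⟨hC.subset_PL hc, hPL⟩) ?_).symm
        rw [← List.append_assoc, ← List.append_assoc]
        exact List.perm_middle.symm
      rw [hperm a ha, hperm b hb, List.cons_append, cycleMeasure_sub (hC.subset_PL ha)
        (hC.subset_PL hb) hPL]
    constructor
    · refine ⟨K₁ + K₂, by positivity, fun φ hφ hφR G => ?_⟩
      rw [hexp φ hφ]
      have e1 := abs_le.1 (hK₁ φ hφ hφR G)
      have e2 := abs_le.1 (hK₂ φ hφ hφR G)
      rw [abs_le]
      constructor <;> linarith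
    · intro H hH
      obtain ⟨K₁, h₁, hK₁⟩ := hL₁ H hH
      obtain ⟨K₂, h₂, hK₂⟩ := hL₂ H hH
      refine ⟨K₁ + K₂, by positivity, fun φ hφ φ' hφ' hφR hφR' δ hδ0 hδ => ?_⟩
      rw [hexp φ hφ, hexp φ' hφ']
      have e1 := abs_le.1 (hK₁ φ hφ φ' hφ' hφR hφR' δ hδ0 hδ)
      have e2 := abs_le.1 (hK₂ φ hφ φ' hφ' hφR hφR' δ hδ0 hδ)
      rw [abs_le]
      constructor <;> linarith

lemma dense_PL (hC : S.IsAdmissible C) : Dense {φ : S.conicC C | φ.1 ∈ S.PL} := by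
  intro ψ
  rw [closure_subtype]
  refine closure_mono (fun φ hφ => ?_) ψ.2.2
  exact ⟨⟨φ, (subset_plC hC hφ).2⟩, hC.subset_PL hφ, rfl⟩

/-- As piecewise linear functions tend to ψ, their convergence is uniform on the sphere; the
measures are then eventually bounded and Cauchy against the dense set C - C, so they converge
weak-*. Existence of all these limits makes the extension along the dense inclusion continuous. -/
theorem exists_continuous_extension (hC : S.IsAdmissible C) (hn : 2 ≤ n) (k : ℕ) (hk : k < n)
    (γ : Fin (n - 1 - k) → X → ℝ) (hγ : ∀ i, γ i ∈ C - C) :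
    ∃ T : S.conicC C → S.RadonMeasure,
      Continuous T ∧ ∀ φ : S.conicC C, φ.1 ∈ S.PL → T φ = S.mixedMeasure γ k φ.1 := by
  -- Currying the jointly continuous evaluation: as the sphere is compact, pointwise convergence in
  -- the source becomes uniform convergence of restrictions.
  let r : C(S.conicC C, C(S.sphere, ℝ)) :=
    ContinuousMap.curry ⟨fun p => p.1.1 p.2.1, continuous_eval hC hn⟩
  have hr : ∀ φ x, r φ x = φ.1 x.1 := fun _ _ => rfl
  have hd := (dense_PL hC).isDenseInducing_val
  let f : {φ : S.conicC C | φ.1 ∈ S.PL} → S.RadonMeasure := fun φ => S.mixedMeasure γ k φ.1.1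
  have hlim : ∀ ψ, ∃ ν, Tendsto f (comap Subtype.val (𝓝 ψ)) (𝓝 ν) := by
    intro ψ
    have hne : (comap (Subtype.val : {φ : S.conicC C | φ.1 ∈ S.PL} → _) (𝓝 ψ)).NeBot :=
      hd.comap_nhds_neBot ψ
    have hΓ : ∀ g ∈ List.ofFn γ, g ∈ C - C := by
      intro g hg
      obtain ⟨i, rfl⟩ := (List.mem_ofFn' γ g).1 hg
      exact hγ i
    have hclose : ∀ δ : ℝ, 0 < δ → ∀ᶠ φ : {φ : S.conicC C | φ.1 ∈ S.PL} in
        comap Subtype.val (𝓝 ψ), ∀ x : S.sphere, |φ.1.1 x - ψ.1 x| ≤ δ := by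
      intro δ hδ
      have h1 := (r.continuous.tendsto ψ).eventually (Metric.ball_mem_nhds (r ψ) hδ)
      filter_upwards [h1.comap Subtype.val] with φ hφ x
      have := (ContinuousMap.dist_lt_iff hδ).1 hφ x
      rw [Real.dist_eq] at this
      exact this.le
    -- The radius ‖r ψ‖ + 1 bounds all functions within distance 1 of ψ on the sphere.
    obtain ⟨⟨K, hK0, hK⟩, hLip⟩ := exists_mixed_bounds hC (‖r ψ‖ + 1) k hΓ (F := []) (by simp)
      (by simp; omega)
    simp only [List.append_nil] at hK hLip
    have hbdd : ∀ᶠ φ : {φ : S.conicC C | φ.1 ∈ S.PL} in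
        comap Subtype.val (𝓝 ψ), ∀ x : S.sphere, |φ.1.1 x| ≤ ‖r ψ‖ + 1 := by
      filter_upwards [hclose 1 one_pos] with φ hφ x
      have h1 := hφ x
      have h2 : |ψ.1 x| ≤ ‖r ψ‖ := (r ψ).norm_coe_le_norm x
      rw [abs_le] at h1 h2 ⊢
      constructor <;> linarith
    refine WeakDual.exists_tendsto_of_dense hC.dense hK0 ?_ fun H hH => ?_
    · filter_upwards [hbdd] with φ hφ G
      exact hK φ.1.1 ⟨φ.2, φ.1.2⟩ hφ G
    · obtain ⟨K', hK0', hK'⟩ := hLip H hH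
      rw [← cauchy_map_iff_exists_tendsto, Metric.cauchy_iff]
      refine ⟨inferInstance, fun ε hε => ?_⟩
      set δ := ε / (4 * (K' + 1)) with hδ
      have hδ0 : 0 < δ := by positivity
      refine ⟨_, image_mem_map ((hclose δ hδ0).and hbdd), ?_⟩
      rintro _ ⟨φ, ⟨h1, h2⟩, rfl⟩ _ ⟨φ', ⟨h1', h2'⟩, rfl⟩
      rw [Real.dist_eq]
      refine (hK' φ.1.1 ⟨φ.2, φ.1.2⟩ φ'.1.1 ⟨φ'.2, φ'.1.2⟩ h2 h2' (2 * δ) (by positivity) fun x => ?_).trans_lt ?_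
      · have h3 := abs_le.1 (h1 x)
        have h4 := abs_le.1 (h1' x)
        rw [abs_le]
        constructor <;> linarith
      · have : (K' + 1) * (2 * δ) = ε / 2 := by rw [hδ]; field_simp; norm_num
        nlinarith
  refine ⟨hd.extend f, hd.continuous_extend hlim, fun φ hφ => ?_⟩
  obtain ⟨ν, hν⟩ := hlim φ
  have hν' : Tendsto f (𝓝 ⟨φ, hφ⟩) (𝓝 ν) := by rwa [nhds_subtype_eq_comap]
  exact hd.extend_eq_at' (a := ⟨φ, hφ⟩) ν hν'

end BalancedSpace

end

/-! ### The theorem -/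

theorem mainTheorem3 {X N : Type*} [TopologicalSpace X] [SecondCountableTopology X]
    [NormedAddCommGroup N] [InnerProductSpace ℝ N] [FiniteDimensional ℝ N]
    {n : ℕ} (S : BalancedSpace X N n) (C : Set (X → ℝ)) (hC : S.IsAdmissible C)
    (k : ℕ) (hk : k < n) (γ : Fin (n - 1 - k) → X → ℝ) (hγ : ∀ i, γ i ∈ C - C) :
    (∀ ψ ∈ S.conicC C, ∀ φ φ' : ℕ → X → ℝ,
      (∀ i, φ i ∈ S.plC C) → (∀ j, φ' j ∈ S.plC C) →
      Tendsto φ atTop (𝓝 ψ) → Tendsto φ' atTop (𝓝 ψ) →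
      ∀ μ ν : S.RadonMeasure,
        Tendsto (fun i => S.mixedMeasure γ k (φ i)) atTop (𝓝 μ) →
        Tendsto (fun j => S.mixedMeasure γ k (φ' j)) atTop (𝓝 ν) → μ = ν) ∧
    ∃! T : S.conicC C → S.RadonMeasure,
      Continuous T ∧ ∀ φ : S.conicC C, φ.1 ∈ S.PL → T φ = S.mixedMeasure γ k φ.1 := by
  obtain ⟨T, hT, hTe⟩ : ∃ T : S.conicC C → S.RadonMeasure,
      Continuous T ∧ ∀ φ : S.conicC C, φ.1 ∈ S.PL → T φ = S.mixedMeasure γ k φ.1 := by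
    rcases le_or_gt 2 n with hn | hn
    · exact BalancedSpace.exists_continuous_extension hC hn k hk γ hγ
    -- For n = 1 no factor φ occurs, so the measure is constant in φ.
    · obtain rfl : k = 0 := by omega
      exact ⟨fun _ => S.mixedMeasure γ 0 0, continuous_const, fun φ _ => rfl⟩
  constructor
  · intro ψ hψ φ φ' hφ hφ' hlim hlim' μ ν hμ hν
    -- Any limit along a sequence tending to ψ is the value of the continuous extension at ψ.
    have key : ∀ φ : ℕ → X → ℝ, (∀ i, φ i ∈ S.plC C) → Tendsto φ atTop (𝓝 ψ) → ∀ μ,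
        Tendsto (fun i => S.mixedMeasure γ k (φ i)) atTop (𝓝 μ) → μ = T ⟨ψ, hψ⟩ := by
      intro φ hφ hlim μ hμ
      have h1 : Tendsto (fun i => (⟨φ i, (hφ i).2⟩ : S.conicC C)) atTop (𝓝 ⟨ψ, hψ⟩) :=
        tendsto_subtype_rng.2 hlim
      refine tendsto_nhds_unique hμ (((hT.tendsto _).comp h1).congr fun i => ?_)
      exact hTe ⟨φ i, (hφ i).2⟩ (hφ i).1
    rw [key φ hφ hlim μ hμ, key φ' hφ' hlim' ν hν]
  · refine ⟨T, ⟨hT, hTe⟩, fun T' ⟨hT', hTe'⟩ => ?_⟩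
    exact Continuous.ext_on (BalancedSpace.dense_PL hC) hT' hT fun φ hφ =>
      (hTe' φ hφ).trans (hTe φ hφ).symm
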